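/- Let $A$ be a finite alphabet, let $A^{\mathbb Z}$ carry the product topology of the discrete topology on $A$, and let $\sigma$ be the shift, $\sigma(x)[i]=x[i+1]$. Let $X\subseteq A^{\mathbb Z}$ be an infinite subshift (a closed set with $\sigma(X)=X$), and let $L(X)$ be the set of all finite words that occur in elements of $X$. Assume that $X$ is transitive (for all $u,v\in L(X)$ there is $w\in L(X)$ with $uwv\in L(X)$) and sofic ($L(X)$ is a regular language). Then there is a reversible cellular automaton $F:X\to X$ (a bijective map given by a local rule, $F(x)[i]=f(x[i+m],\dots,x[i+a])$ for some integers $m\le a$ and some $f:A^{a-m+1}\to A$) that has no almost equicontinuous direction: for all coprime integers $p,q$ with $q>0$, the map $\sigma^p\circ F^q:X\to X$ is not almost equicontinuous, i.e. its set of equicontinuity points (the points at which the family of its iterates is equicontinuous) is not residual in $X$. Equivalently, for all such $p,q$ the map $T=\sigma^p\circ F^q$ is sensitive: for a metric $d$ inducing the topology of $X$ there is $\varepsilon>0$ such that for every $x\in X$ and $\delta>0$ there are $y\in X$ with $d(x,y)<\delta$ and $n\in\mathbb N$ with $d(T^n(x),T^n(y))\geq\varepsilon$. -/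

import Mathlib

open SymbolicDynamics.FullShift

namespace SoficCA

/-- The language `L(X)` of a two-sided subshift `X ⊆ A^ℤ`: the set of all finite words
`x[i] x[i+1] ⋯ x[i+n-1]` with `x ∈ X`, `i ∈ ℤ`, `n ∈ ℕ`. -/
def language {A : Type*} [TopologicalSpace A] (X : Subshift A ℤ) : Language A :=
  {w | ∃ x ∈ X.carrier, ∃ (i : ℤ) (n : ℕ), w = List.ofFn (fun k : Fin n => x (i + (k : ℕ)))}

/-- `X` is transitive: any `u, v ∈ L(X)` can be joined by some `w ∈ L(X)` to `uwv ∈ L(X)`. -/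
def IsTransitive {A : Type*} [TopologicalSpace A] (X : Subshift A ℤ) : Prop :=
  ∀ u ∈ language X, ∀ v ∈ language X, ∃ w ∈ language X, u ++ w ++ v ∈ language X

/-- `X` is sofic: its language is regular. -/
def IsSofic {A : Type*} [TopologicalSpace A] (X : Subshift A ℤ) : Prop :=
  (language X).IsRegular

/-- `F : X → X` is a cellular automaton: there are a memory `m` and an anticipation `a` with
`m ≤ a`, and a local rule `f : A^{[m,a]} → A`, with `F(x)[i] = f(x[i+m], …, x[i+a])`. -/
def IsCellularAutomaton {A : Type*} [TopologicalSpace A] {X : Subshift A ℤ}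
    (F : X.carrier → X.carrier) : Prop :=
  ∃ m a : ℤ, m ≤ a ∧ ∃ f : (Set.Icc m a → A) → A,
    ∀ (x : X.carrier) (i : ℤ), (F x : ℤ → A) i = f (fun j => (x : ℤ → A) (i + j))

/-- A reversible cellular automaton (an automorphism of `X`) is a bijective one. -/
def IsReversibleCA {A : Type*} [TopologicalSpace A] {X : Subshift A ℤ}
    (F : X.carrier → X.carrier) : Prop :=
  IsCellularAutomaton F ∧ Function.Bijective F

/-- The map `σ^p ∘ F^q : X → X`, where `σ` is the shift `σ(x)[i] = x[i+1]`. -/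
def directionMap {A : Type*} [TopologicalSpace A] {X : Subshift A ℤ}
    (F : X.carrier → X.carrier) (p : ℤ) (q : ℕ) : X.carrier → X.carrier :=
  fun x => ⟨shift p (F^[q] x : ℤ → A), X.mapsTo p (F^[q] x).2⟩

/-- The dynamical system `(Y, T)` is almost equicontinuous: its equicontinuity points, that is, the
points at which the family of iterates `(Tⁿ)` is equicontinuous, form a residual set. -/
def IsAlmostEquicontinuous {Y : Type*} [UniformSpace Y] (T : Y → Y) : Prop :=
  {x : Y | EquicontinuousAt (fun n : ℕ => T^[n]) x} ∈ residual Y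

/-- The dynamical system `(Y, T)` is sensitive (to initial conditions): there is a uniform
"distance" `V` such that arbitrarily close to every point there is another one whose orbit is at
some time not `V`-close to that of the first. -/
def IsSensitive {Y : Type*} [UniformSpace Y] (T : Y → Y) : Prop :=
  ∃ V ∈ uniformity Y, ∀ x : Y, ∀ U ∈ nhds x, ∃ y ∈ U, ∃ n : ℕ, (T^[n] x, T^[n] y) ∉ V

/-- `p/q`, with `p` and `q > 0` coprime, is an almost equicontinuous direction of `F`. -/
def IsAlmostEquicontinuousDirection {A : Type*} [UniformSpace A] {X : Subshift A ℤ}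
    (F : X.carrier → X.carrier) (p : ℤ) (q : ℕ) : Prop :=
  0 < q ∧ IsCoprime p (q : ℤ) ∧ IsAlmostEquicontinuous (directionMap F p q)

/-- `p/q`, with `p` and `q > 0` coprime, is a sensitive direction of `F`. -/
def IsSensitiveDirection {A : Type*} [UniformSpace A] {X : Subshift A ℤ}
    (F : X.carrier → X.carrier) (p : ℤ) (q : ℕ) : Prop :=
  0 < q ∧ IsCoprime p (q : ℤ) ∧ IsSensitive (directionMap F p q)

end SoficCA

/-! The automaton is a conveyor belt that erodes its obstacles. Soficity gives a synchronizing word.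
Since `X` is infinite and transitive, this word has two different return blocks, whose
concatenations are all allowed and parse uniquely. From them one builds cells: four interchangeable
words that carry two bits each and occur at mutual distance at least `p` (`exists_cellSystem`). A
conveyor step sends first bits to the left and second bits to the right along the cells, and
reflects them where no cell follows within `H`. Such gaps are walls for information, so a second
step, `swap`, destroys them: it exchanges an empty cell followed by a gap with the same cell
followed by a gap into which full cells have been written. It is an involution, so the composite
`step` is reversible.

Writing into a gap must lose nothing. The gap is cut into as many blocks as there are words of the
length of a block, and the sum of the block numbers in `ZMod B` selects the block to overwrite. The
place of the new cell reveals this sum, and the sum together with the other blocks reveals the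
overwritten one (`φ_injective`). That a core can be replaced by a word of the same length and the
same follower set that contains a cell is `exists_same_length_containing`, a fact about the
numerical semigroup of loop lengths.

Configurations whose two ends are chains of empty cells are dense (`exists_tails`). For these the
sum over the cells between the ends of (number of bits minus two) is unaffected by `swap`, since
full cells weigh nothing, and drops whenever a bit leaves. It is bounded below, so bits stop
leaving. Were some gap recurrent, the part to the left of the leftmost one would drain, the cell
before the gap would become empty, a full cell would be inserted after it, and its first bit would
travel out to the left: a contradiction. So eventually there are no gaps and no bits that move
inwards (`Tails.eventually_quiet`).

A bit then added far out travels through the whole configuration, by at least 1 and less than `H`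
per step, from either side as one likes. In a frame of slope `p/q`, take the side for which the
velocities of bit and frame do not cancel: the bit must cross a fixed window. Starting far enough
out, it can be pulled back by the inverse automaton to a perturbation of the initial point that is
invisible near the origin (`Tails.exists_travelers`). This is sensitivity, and Baire's theorem
excludes almost equicontinuity. -/

namespace SoficCA

/-! ### Words occurring in configurations -/

section Words

variable {A : Type*}

/-- The word `w` occurs in the configuration `x` at position `i`. -/
def At (x : ℤ → A) (i : ℤ) (w : List A) : Prop :=
  ∀ k (h : k < w.length), x (i + (k : ℕ)) = w[k]

/-- The factor of length `n` of `x` at position `i`. -/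
def fac (x : ℤ → A) (i : ℤ) (n : ℕ) : List A :=
  List.ofFn (fun k : Fin n => x (i + (k : ℕ)))

@[simp] lemma length_fac (x : ℤ → A) (i : ℤ) (n : ℕ) : (fac x i n).length = n := by
  simp [fac]

lemma at_fac (x : ℤ → A) (i : ℤ) (n : ℕ) : At x i (fac x i n) := by
  intro k h
  simp [fac]

lemma At.eq_fac {x : ℤ → A} {i : ℤ} {w : List A} (h : At x i w) : fac x i w.length = w := by
  apply List.ext_getElem
  · simp
  · intro k h1 h2
    simpa [fac] using h k h2

lemma At.eq {x : ℤ → A} {i : ℤ} {w w' : List A} (h : At x i w) (h' : At x i w')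
    (hl : w.length = w'.length) : w = w' := by
  rw [← h.eq_fac, ← h'.eq_fac, hl]

lemma at_append {x : ℤ → A} {i : ℤ} {u v : List A} :
    At x i (u ++ v) ↔ At x i u ∧ At x (i + u.length) v := by
  constructor
  · intro h
    refine ⟨fun k hk => ?_, fun k hk => ?_⟩
    · have := h k (by simp; omega)
      rwa [List.getElem_append_left hk] at this
    · have := h (u.length + k) (by simp; omega)
      rw [List.getElem_append_right (by omega)] at this
      simp only [Nat.add_sub_cancel_left] at this
      rw [← this]
      push_cast
      ring_nf
  · rintro ⟨h1, h2⟩ k hk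
    by_cases hku : k < u.length
    · rw [List.getElem_append_left hku]
      exact h1 k hku
    · rw [List.getElem_append_right (by omega)]
      have := h2 (k - u.length) (by simp at hk; omega)
      rw [← this]
      congr 1
      omega

@[simp] lemma at_nil (x : ℤ → A) (i : ℤ) : At x i [] := by
  intro k hk
  simp at hk

lemma At.congr {x y : ℤ → A} {i j : ℤ} {w : List A} (h : At x i w)
    (hxy : ∀ k : ℕ, k < w.length → y (j + k) = x (i + k)) : At y j w :=
  fun k hk => (hxy k hk).trans (h k hk)

lemma At.drop {x : ℤ → A} {i : ℤ} {w : List A} (h : At x i w) (o : ℕ) (ho : o ≤ w.length) :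
    At x (i + o) (w.drop o) := by
  rw [← List.take_append_drop o w, at_append] at h
  simpa [ho] using h.2

lemma At.prefix {x : ℤ → A} {i : ℤ} {u w : List A} (h : At x i u) (h' : At x i w)
    (hl : u.length ≤ w.length) : u <+: w := by
  rw [List.prefix_iff_eq_take]
  rw [← List.take_append_drop u.length w, at_append] at h'
  exact h.eq h'.1 (by simp [hl])

lemma At.of_prefix {x : ℤ → A} {i : ℤ} {u w : List A} (h : At x i w) (hp : u <+: w) :
    At x i u := by
  obtain ⟨t, rfl⟩ := hp
  exact (at_append.1 h).1

lemma at_shift {x : ℤ → A} {i s : ℤ} {w : List A} :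
    At (shift s x) i w ↔ At x (s + i) w := by
  unfold At
  simp [shift_apply, add_assoc]

lemma fac_add (x : ℤ → A) (i : ℤ) (m n : ℕ) :
    fac x i (m + n) = fac x i m ++ fac x (i + m) n := by
  refine (at_fac x i (m + n)).eq (at_append.2 ⟨at_fac _ _ _, ?_⟩) (by simp)
  simpa using at_fac x (i + m) n

lemma fac_congr {x y : ℤ → A} {i j : ℤ} {n : ℕ}
    (h : ∀ k : ℕ, k < n → x (i + k) = y (j + k)) : fac x i n = fac y j n := by
  refine (at_fac x i n).eq ?_ (by simp)
  exact (at_fac y j n).congr (by simpa using h)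

end Words

/-! ### Membership in a subshift through its language -/

section Membership

variable {A : Type*} [TopologicalSpace A] {X : Subshift A ℤ}

lemma mem_language_iff {w : List A} : w ∈ language X ↔ ∃ x ∈ X.carrier, ∃ i, At x i w := by
  constructor
  · rintro ⟨x, hx, i, n, rfl⟩
    exact ⟨x, hx, i, at_fac x i n⟩
  · rintro ⟨x, hx, i, h⟩
    exact ⟨x, hx, i, w.length, h.eq_fac.symm⟩

lemma mem_language_of_at {x : ℤ → A} (hx : x ∈ X.carrier) {i : ℤ} {w : List A} (h : At x i w) :
    w ∈ language X := mem_language_iff.2 ⟨x, hx, i, h⟩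

lemma exists_at_of_mem_language {w : List A} (h : w ∈ language X) (j : ℤ) :
    ∃ x ∈ X.carrier, At x j w := by
  obtain ⟨x, hx, i, hi⟩ := mem_language_iff.1 h
  refine ⟨shift (i - j) x, X.mapsTo _ hx, ?_⟩
  rw [at_shift]
  simpa using hi

lemma language_infix {u w t : List A} (h : u ++ w ++ t ∈ language X) : w ∈ language X := by
  obtain ⟨x, hx, i, hi⟩ := mem_language_iff.1 h
  rw [at_append, at_append] at hi
  exact mem_language_of_at hx hi.1.2

lemma language_left {u w : List A} (h : u ++ w ∈ language X) : u ∈ language X :=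
  language_infix (u := []) (t := w) (by simpa using h)

lemma language_right {u w : List A} (h : u ++ w ∈ language X) : w ∈ language X :=
  language_infix (u := u) (t := []) (by simpa using h)

lemma fac_mem_language {x : ℤ → A} (hx : x ∈ X.carrier) (i : ℤ) (n : ℕ) :
    fac x i n ∈ language X := mem_language_of_at hx (at_fac x i n)

/-- A configuration all of whose central windows are windows of points of `X` is a point of `X`. -/
lemma mem_of_agree {y : ℤ → A}
    (h : ∀ N : ℕ, ∃ x ∈ X.carrier, ∀ k : ℤ, -N ≤ k → k ≤ N → x k = y k) : y ∈ X.carrier := by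
  choose x hx hxy using h
  refine X.isClosed.mem_of_tendsto (f := x) (b := Filter.atTop) ?_ (Filter.Eventually.of_forall hx)
  rw [tendsto_pi_nhds]
  intro k
  refine tendsto_const_nhds.congr' ?_
  filter_upwards [Filter.eventually_ge_atTop k.natAbs] with N hN
  exact (hxy N k (by omega) (by omega)).symm

lemma mem_of_fac_mem {y : ℤ → A}
    (h : ∀ N : ℕ, ∃ a : ℤ, a ≤ -N ∧ ∃ n : ℕ, N < a + n ∧ fac y a n ∈ language X) :
    y ∈ X.carrier := by
  refine mem_of_agree fun N => ?_
  obtain ⟨a, ha, n, hn, hL⟩ := h N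
  obtain ⟨x, hx, hxa⟩ := exists_at_of_mem_language hL a
  refine ⟨x, hx, fun k h1 h2 => ?_⟩
  have h3 := hxa (k - a).toNat (by simp; omega)
  have h4 := at_fac y a n (k - a).toNat (by simp; omega)
  rw [← h4] at h3
  have h5 : a + ((k - a).toNat : ℤ) = k := by omega
  rwa [h5] at h3

/-- Replacing a word by another one of the same length whose contexts include its contexts. -/
lemma mem_of_replace {x y : ℤ → A} (hx : x ∈ X.carrier) {i : ℤ} {w w' : List A}
    (hw : At x i w) (hw' : At y i w') (hl : w'.length = w.length)
    (hout : ∀ j, j < i ∨ i + w.length ≤ j → y j = x j)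
    (hrep : ∀ u t, u ++ w ++ t ∈ language X → u ++ w' ++ t ∈ language X) : y ∈ X.carrier := by
  refine mem_of_fac_mem fun N => ?_
  obtain ⟨p, hp⟩ : ∃ p : ℕ, i - p ≤ -N := ⟨(i + N).toNat, by omega⟩
  obtain ⟨q, hq⟩ : ∃ q : ℕ, (N : ℤ) < i + w.length + q := ⟨(N + 1 - i).toNat, by omega⟩
  refine ⟨i - p, hp, p + w.length + q, by push_cast; omega, ?_⟩
  have hmem := fac_mem_language hx (i - p) (p + w.length + q)
  have e1 : i - (p : ℤ) + p = i := by ring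
  have e2 : i - (p : ℤ) + (p + w.length : ℕ) = i + w.length := by push_cast; ring
  rw [fac_add, fac_add, e1, e2] at hmem ⊢
  rw [hw.eq_fac] at hmem
  have e3 : fac y i w.length = w' := by rw [← hl]; exact hw'.eq_fac
  rw [e3]
  have e4 : fac y (i - p) p = fac x (i - p) p :=
    fac_congr fun k hk => hout _ (Or.inl (by omega))
  have e5 : fac y (i + w.length) q = fac x (i + w.length) q :=
    fac_congr fun k hk => hout _ (Or.inr (by omega))
  rw [e4, e5]
  exact hrep _ _ hmem

end Membership

/-! ### Synchronizing words -/

section Sync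

variable {A : Type*} [TopologicalSpace A] {X : Subshift A ℤ}

/-- Synchronizing words. -/
def Sync (X : Subshift A ℤ) (w : List A) : Prop :=
  w ∈ language X ∧ ∀ u t, u ++ w ∈ language X → w ++ t ∈ language X → u ++ w ++ t ∈ language X

lemma Sync.infix {w : List A} (hw : Sync X w) {a b : List A} (h : a ++ w ++ b ∈ language X) :
    Sync X (a ++ w ++ b) := by
  refine ⟨h, fun u t hu ht => ?_⟩
  have h1 : (u ++ a) ++ w ∈ language X := by
    apply language_left (w := b)
    simpa using hu
  have h2 : w ++ (b ++ t) ∈ language X := by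
    apply language_right (u := a)
    simpa using ht
  simpa using hw.2 _ _ h1 h2

/-- By Myhill–Nerode there is a minimal left quotient among those by words of the language.
Extending the word to the left can only shrink its quotient, so by minimality it does not change it.
-/
lemma exists_sync (hX : X.carrier.Nonempty) (hs : IsSofic X) : ∃ w, Sync X w := by
  obtain ⟨x, hx⟩ := hX
  have hfin : ((language X).leftQuotient '' {w | w ∈ language X}).Finite :=
    hs.finite_range_leftQuotient.subset (Set.image_subset_range _ _)
  have hne : ((language X).leftQuotient '' {w | w ∈ language X}).Nonempty :=
    ⟨_, ⟨[], mem_language_of_at hx (at_nil x 0), rfl⟩⟩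
  obtain ⟨F, ⟨hF1, hF2⟩⟩ := hfin.exists_minimal hne
  obtain ⟨w, hw, rfl⟩ := hF1
  refine ⟨w, hw, fun u t hu ht => ?_⟩
  have := hF2 (y := (language X).leftQuotient (u ++ w)) ⟨u ++ w, hu, rfl⟩ (fun t ht => by
    have ht' : u ++ w ++ t ∈ language X := ht
    have : w ++ t ∈ language X := language_infix (u := u) (t := []) (by simpa using ht')
    exact this)
  exact this ht

/-- Two points of `X` that carry the same synchronizing word at the same place can be spliced. -/
lemma Sync.splice {w : List A} (hw : Sync X w) {x y z : ℤ → A}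
    (hx : x ∈ X.carrier) (hy : y ∈ X.carrier) {i : ℤ} (hxi : At x i w) (hyi : At y i w)
    (hzx : ∀ j < i, z j = x j) (hzy : ∀ j, i ≤ j → z j = y j) : z ∈ X.carrier := by
  refine mem_of_fac_mem fun N => ?_
  obtain ⟨p, hp⟩ : ∃ p : ℕ, i - p ≤ -N := ⟨(i + N).toNat, by omega⟩
  obtain ⟨q, hq⟩ : ∃ q : ℕ, (N : ℤ) < i + w.length + q := ⟨(N + 1 - i).toNat, by omega⟩
  refine ⟨i - p, hp, p + w.length + q, by push_cast; omega, ?_⟩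
  have hzi : At z i w := hyi.congr fun k _ => hzy _ (by omega)
  have e1 : i - (p : ℤ) + p = i := by ring
  have e2 : i - (p : ℤ) + (p + w.length : ℕ) = i + w.length := by push_cast; ring
  rw [fac_add, fac_add, e1, e2, hzi.eq_fac]
  have e4 : fac z (i - p) p = fac x (i - p) p := fac_congr fun k hk => hzx _ (by omega)
  have e5 : fac z (i + w.length) q = fac y (i + w.length) q := fac_congr fun k hk => hzy _ (by omega)
  rw [e4, e5]
  apply hw.2
  · apply mem_language_of_at hx (i := i - p)
    rw [at_append]
    exact ⟨at_fac _ _ _, by simpa using hxi⟩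
  · exact mem_language_of_at hy (at_append.2 ⟨hyi, at_fac _ _ _⟩)

/-- Transitivity, with the three words placed in a point of `X`. -/
lemma IsTransitive.exists_append (ht : IsTransitive X) {u v : List A} (hu : u ∈ language X)
    (hv : v ∈ language X) : ∃ w, u ++ w ++ v ∈ language X :=
  let ⟨w, _, h⟩ := ht u hu v hv
  ⟨w, h⟩

end Sync

/-! ### Return blocks -/

section Returns

variable {A : Type*} [TopologicalSpace A] {X : Subshift A ℤ}

/-- `r` is a return block to `U`: in `rU` the word `U` occurs exactly as a prefix and a suffix. -/
def IsReturn (X : Subshift A ℤ) (U r : List A) : Prop :=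
  r ≠ [] ∧ r ++ U ∈ language X ∧ U <+: r ++ U ∧
    ∀ o, 0 < o → o < r.length → ¬ U <+: (r ++ U).drop o

/-- Cut at the successive occurrences of `U`: the piece up to the first occurrence at a positive
position is a return block, and induction treats the rest. -/
lemma exists_return_decomposition {U : List A} (n : ℕ) : ∀ g : List A, g.length = n →
    g ++ U ∈ language X → U <+: g ++ U → ∃ l : List (List A),
      (∀ r ∈ l, IsReturn X U r) ∧ g = l.flatten := by
  induction n using Nat.strong_induction_on with
  | _ n ih =>
    intro g hg hL hpre
    by_cases hg0 : g = []
    · exact ⟨[], by simp, by simp [hg0]⟩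
    have hpos : 0 < g.length := List.length_pos_iff.2 hg0
    have hex : ∃ o, 0 < o ∧ o ≤ g.length ∧ U <+: (g ++ U).drop o :=
      ⟨g.length, hpos, le_rfl, by simp⟩
    classical
    obtain ⟨h1, h2, h3⟩ := Nat.find_spec hex
    have hmin := fun m hm => Nat.find_min (H := hex) (m := m) hm
    set o := Nat.find hex with ho
    have hdrop : (g ++ U).drop o = g.drop o ++ U := List.drop_append_of_le_length h2
    rw [hdrop] at h3
    have htU : g.take o ++ U <+: g ++ U := by
      conv_rhs => rw [← List.take_append_drop o g, List.append_assoc]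
      exact (List.prefix_append_right_inj _).2 h3
    have hsplit : g.take o ++ (g.drop o ++ U) = g ++ U := by
      rw [← List.append_assoc, List.take_append_drop]
    obtain ⟨l, hl, hgl⟩ := ih (g.length - o) (by omega) (g.drop o) (by simp)
      (language_right (u := g.take o) (by rwa [hsplit])) h3
    refine ⟨g.take o :: l, ?_, by rw [List.flatten_cons, ← hgl, List.take_append_drop]⟩
    intro r hr
    rcases List.mem_cons.1 hr with rfl | hr
    · refine ⟨by simp [hg0]; omega, ?_, ?_, ?_⟩
      · obtain ⟨t, ht⟩ := htU
        exact language_left (w := t) (by rwa [ht])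
      · exact List.prefix_of_prefix_length_le hpre htU (by simp)
      · intro k hk0 hk hpk
        simp only [List.length_take] at hk
        apply hmin k (by omega)
        refine ⟨hk0, by omega, hpk.trans ?_⟩
        obtain ⟨t, ht⟩ := htU
        rw [← ht, List.drop_append_of_le_length (l₁ := g.take o ++ U) (by simp; omega)]
        exact List.prefix_append _ _
    · exact hl r hr

lemma flatten_replicate_getElem {r : List A} (k : ℕ) (j : ℕ)
    (h : j + r.length < (List.replicate k r).flatten.length) :
    (List.replicate k r).flatten[j + r.length] =
      (List.replicate k r).flatten[j]'(by omega) := by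
  cases k with
  | zero => simp at h
  | succ k =>
    have e1 : (List.replicate (k + 1) r).flatten = r ++ (List.replicate k r).flatten := by
      simp [List.replicate_succ]
    have e2 : (List.replicate (k + 1) r).flatten = (List.replicate k r).flatten ++ r := by
      simp [List.replicate_succ']
    have hj : j < (List.replicate k r).flatten.length := by
      rw [e1, List.length_append] at h
      omega
    have f1 : (List.replicate (k + 1) r).flatten[j + r.length]
        = (List.replicate k r).flatten[j] := by
      rw [List.getElem_of_eq e1, List.getElem_append_right (by omega)]
      simp
    rw [f1, List.getElem_of_eq e2, List.getElem_append_left hj]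

lemma finite_of_periodic [Finite A] (n : ℕ) (hn : 0 < n)
    (h : ∀ x ∈ X.carrier, ∀ i : ℤ, x (i + n) = x i) : X.carrier.Finite := by
  rw [← Set.finite_coe_iff]
  refine Finite.of_injective
    (fun (x : X.carrier) (k : Fin n) => (x : ℤ → A) (k : ℕ)) fun x y hxy => ?_
  ext k
  have key : ∀ z : X.carrier, (z : ℤ → A) k = (z : ℤ → A) ((k % n).toNat : ℕ) := by
    intro z
    have hper : Function.Periodic (z : ℤ → A) (n : ℤ) := h z z.2
    have h0 : 0 ≤ k % n := Int.emod_nonneg _ (by omega)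
    have := hper.sub_zsmul_eq (x := k) (k / n)
    rw [← this, Int.toNat_of_nonneg h0, smul_eq_mul, Int.emod_def, mul_comm]
  rw [key x, key y]
  have hlt : (k % n).toNat < n := by
    have := Int.emod_lt_of_pos k (b := n) (by omega)
    omega
  exact congrFun hxy ⟨_, hlt⟩

/-- If `r` were the only return block, every word of the language would lie in a power of `r`, so
all points would have period `r.length` and `X` would be finite. -/
lemma exists_two_returns [Finite A] (hinf : X.carrier.Infinite) (ht : IsTransitive X)
    {U : List A} (hU : U ∈ language X) :
    ∃ r : Bool → List A, (∀ b, IsReturn X U (r b)) ∧ r true ≠ r false := by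
  by_contra hcon
  have heq : ∀ r r', IsReturn X U r → IsReturn X U r' → r = r' := by
    intro r r' h h'
    by_contra hne
    exact hcon ⟨fun b => if b then r else r', by rintro (_ | _) <;> simpa, by simpa⟩
  have key : ∀ v, v ∈ language X → ∃ w w', ∃ l : List (List A), (∀ r ∈ l, IsReturn X U r) ∧
      U ++ w ++ v ++ w' = l.flatten := by
    intro v hv
    obtain ⟨w, hw⟩ := ht.exists_append hU hv
    obtain ⟨w', hw'⟩ := ht.exists_append hw hU
    obtain ⟨l, hl, hl'⟩ := exists_return_decomposition _ (U ++ w ++ v ++ w') rfl hw' (by simp)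
    exact ⟨w, w', l, hl, hl'⟩
  obtain ⟨x₀, hx₀⟩ := hinf.nonempty
  obtain ⟨r, hr⟩ : ∃ r, IsReturn X U r := by
    obtain ⟨w, w', l, hl, hl'⟩ := key _ (fac_mem_language hx₀ 0 1)
    cases l with
    | nil =>
      have := congrArg List.length hl'
      simp at this
    | cons r l => exact ⟨r, hl r (by simp)⟩
  refine hinf (finite_of_periodic r.length (List.length_pos_iff.2 hr.1) fun x hx i => ?_)
  -- This window is just long enough to contain the positions `i` and `i + r.length`.
  obtain ⟨w, w', l, hl, hl'⟩ := key _ (fac_mem_language hx i (r.length + 1))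
  have hlr : l = List.replicate l.length r :=
    List.eq_replicate_of_mem fun s hs => heq _ _ (hl s hs) hr
  rw [hlr] at hl'
  have hlen := congrArg List.length hl'
  simp only [List.length_append, length_fac] at hlen
  have hper := flatten_replicate_getElem (r := r) l.length (U ++ w).length
    (by rw [← hlen, List.length_append]; omega)
  rw [← List.getElem_of_eq hl', ← List.getElem_of_eq hl'] at hper
  · have g1 : ∀ k (hk : k < r.length + 1),
        (U ++ w ++ fac x i (r.length + 1) ++ w')[(U ++ w).length + k]'(by simp; omega)
          = x (i + k) := by
      intro k hk
      rw [List.getElem_append_left (by simp; omega), List.getElem_append_right (by omega)]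
      simp only [Nat.add_sub_cancel_left]
      exact (at_fac x i (r.length + 1) k (by simpa using hk)).symm
    have h1 := g1 r.length (by omega)
    have h0 := g1 0 (by omega)
    simp only [Nat.cast_zero, add_zero] at h0
    rw [h1, h0] at hper
    exact hper
  all_goals simp only [List.length_append, length_fac]; omega

end Returns

/-! ### The code generated by two return blocks -/

section Code

variable {A : Type*} [TopologicalSpace A] {X : Subshift A ℤ}

/-- The word coded by `e`: a concatenation of return blocks, closed by `U`. -/
def codeWord (r : Bool → List A) (U : List A) (e : List Bool) : List A := e.flatMap r ++ U

variable {r : Bool → List A} {U : List A}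

lemma codeWord_append (e e' : List Bool) :
    codeWord r U (e ++ e') = e.flatMap r ++ codeWord r U e' := by
  simp [codeWord]

lemma prefix_codeWord (hr : ∀ b, IsReturn X U (r b)) (e : List Bool) :
    U <+: codeWord r U e := by
  induction e with
  | nil => simp [codeWord]
  | cons b e ih =>
    have : codeWord r U (b :: e) = r b ++ codeWord r U e := codeWord_append [b] e |>.trans (by simp)
    rw [this]
    exact (hr b).2.2.1.trans ((List.prefix_append_right_inj _).2 ih)

lemma codeWord_prefix (hr : ∀ b, IsReturn X U (r b)) (e e' : List Bool) :
    codeWord r U e <+: codeWord r U (e ++ e') := by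
  rw [codeWord_append]
  exact (List.prefix_append_right_inj _).2 (prefix_codeWord hr e')

/-- Every code word begins with the synchronizing word `U`, so a further block can be put in front
of it. -/
lemma codeWord_mem (hU : Sync X U) (hr : ∀ b, IsReturn X U (r b)) (e : List Bool) :
    codeWord r U e ∈ language X := by
  induction e with
  | nil => simpa [codeWord] using hU.1
  | cons b e ih =>
    have : codeWord r U (b :: e) = r b ++ codeWord r U e := codeWord_append [b] e |>.trans (by simp)
    rw [this]
    obtain ⟨t, ht⟩ := prefix_codeWord hr e
    rw [← ht] at ih ⊢
    rw [← List.append_assoc]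
    exact hU.2 _ _ (hr b).2.1 ih

/-- If one of the two first blocks were shorter, `U` would occur strictly inside the longer one
followed by `U`. So they have equal length, hence are equal, and can be cancelled. -/
lemma eq_of_prefix_codeWord (hr : ∀ b, IsReturn X U (r b)) (hne : r true ≠ r false) {e' : List Bool} :
    ∀ {e : List Bool}, codeWord r U e' <+: codeWord r U e → e' <+: e := by
  have hinj : ∀ b b', r b = r b' → b = b' := by
    rintro (_ | _) (_ | _) h
    all_goals first | rfl | exact absurd h hne | exact absurd h.symm hne
  have hcons : ∀ b e, codeWord r U (b :: e) = r b ++ codeWord r U e :=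
    fun b e => codeWord_append [b] e |>.trans (by simp)
  have hno : ∀ b b' e e', codeWord r U (b' :: e') <+: codeWord r U (b :: e) →
      ¬ (r b').length < (r b).length := by
    intro b b' e e' hpre hlt
    refine (hr b).2.2.2 (r b').length (List.length_pos_iff.2 (hr b').1) hlt ?_
    have h1 : r b' ++ U <+: codeWord r U (b :: e) := by
      refine List.IsPrefix.trans ?_ hpre
      rw [hcons]
      exact (List.prefix_append_right_inj _).2 (prefix_codeWord hr _)
    have h2 : r b ++ U <+: codeWord r U (b :: e) := by
      rw [hcons]
      exact (List.prefix_append_right_inj _).2 (prefix_codeWord hr _)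
    have h3 : r b' ++ U <+: r b ++ U := List.prefix_of_prefix_length_le h1 h2 (by simp; omega)
    simpa using h3.drop (r b').length
  induction e' with
  | nil => intro e _; simp
  | cons b' e' ih =>
    intro e hpre
    cases e with
    | nil =>
      have := hpre.length_le
      have hpos := List.length_pos_iff.2 (hr b').1
      rw [hcons] at this
      have h2 := (prefix_codeWord hr e').length_le
      simp [codeWord] at this h2
      omega
    | cons b e =>
      have hlen : (r b').length = (r b).length := by
        have h1 := hno b b' e e' hpre
        have h2 : ¬ (r b).length < (r b').length := by
          intro hlt
          refine (hr b').2.2.2 (r b).length (List.length_pos_iff.2 (hr b).1) hlt ?_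
          have h1 : r b' ++ U <+: codeWord r U (b :: e) := by
            refine List.IsPrefix.trans ?_ hpre
            rw [hcons]
            exact (List.prefix_append_right_inj _).2 (prefix_codeWord hr _)
          have h2 : r b ++ U <+: codeWord r U (b :: e) := by
            rw [hcons]
            exact (List.prefix_append_right_inj _).2 (prefix_codeWord hr _)
          have h3 : r b ++ U <+: r b' ++ U := List.prefix_of_prefix_length_le h2 h1 (by simp; omega)
          simpa using h3.drop (r b).length
        omega
      rw [hcons, hcons] at hpre
      obtain ⟨t, ht⟩ := hpre
      rw [List.append_assoc] at ht
      obtain ⟨hb, hrest⟩ := List.append_inj ht hlen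
      obtain rfl := hinj _ _ hb
      exact (List.prefix_append_right_inj [_]).2 (ih ⟨t, hrest⟩)

/-- The word `U` occurs in a code word only at block boundaries, because a return block has no inner
occurrence. -/
lemma exists_of_prefix_drop_codeWord (hr : ∀ b, IsReturn X U (r b)) (e : List Bool) :
    ∀ o, o ≤ (e.flatMap r).length → U <+: (codeWord r U e).drop o →
      ∃ k, o = ((e.take k).flatMap r).length := by
  induction e with
  | nil => intro o ho _; exact ⟨0, by simpa using ho⟩
  | cons b e ih =>
    intro o ho hpre
    have hcons : codeWord r U (b :: e) = r b ++ codeWord r U e :=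
      codeWord_append [b] e |>.trans (by simp)
    rw [hcons] at hpre
    by_cases hob : o < (r b).length
    · by_cases ho0 : o = 0
      · exact ⟨0, by simp [ho0]⟩
      · exfalso
        refine (hr b).2.2.2 o (by omega) hob ?_
        refine List.prefix_of_prefix_length_le hpre ?_ (by simp; omega)
        rw [List.drop_append_of_le_length hob.le, List.drop_append_of_le_length hob.le]
        exact (List.prefix_append_right_inj _).2 (prefix_codeWord hr _)
    · simp only [List.flatMap_cons, List.length_append] at ho
      rw [List.drop_append, List.drop_eq_nil_of_le (by omega), List.nil_append] at hpre
      obtain ⟨k, hk⟩ := ih (o - (r b).length) (by omega) hpre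
      exact ⟨k + 1, by simp at hk ⊢; omega⟩

lemma exists_of_codeWord_prefix_drop (hr : ∀ b, IsReturn X U (r b)) (hne : r true ≠ r false)
    {e e' : List Bool} {o : ℕ} (ho : o ≤ (e.flatMap r).length)
    (h : codeWord r U e' <+: (codeWord r U e).drop o) :
    ∃ k, o = ((e.take k).flatMap r).length ∧ e' <+: e.drop k := by
  obtain ⟨k, hk⟩ := exists_of_prefix_drop_codeWord hr e o ho ((prefix_codeWord hr e').trans h)
  refine ⟨k, hk, eq_of_prefix_codeWord hr hne (List.IsPrefix.trans h ?_)⟩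
  conv_lhs => rw [← List.take_append_drop k e, codeWord_append, hk]
  simp

end Code

/-! ### Construction of the cells -/

section Cells

variable {A : Type*} [TopologicalSpace A]

/-- Four interchangeable synchronizing words ("cells") of length `m`, any two different occurrences
of which are at distance at least `p`, and which can be chained at distance `p`. -/
structure CellSystem (X : Subshift A ℤ) where
  /-- the cell carrying two given bits -/
  c : Bool × Bool → List A
  /-- the least distance of two cells -/
  p : ℕ
  /-- the length of a cell -/
  m : ℕ
  p_pos : 0 < p
  p_le : p ≤ m
  length_c : ∀ v, (c v).length = m
  inj : Function.Injective c
  sep : ∀ (x : ℤ → A) (i j : ℤ) (v v' : Bool × Bool), At x i (c v) → At x j (c v') → i < j →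
    i + p ≤ j
  -- Cells at distance `p` overlap in a word that does not depend on their bits.
  drop_eq_take : ∀ v v', (c v).drop p = (c v').take (m - p)
  sync : ∀ v, Sync X (c v)
  repl : ∀ v v' u t, u ++ c v ++ t ∈ language X → u ++ c v' ++ t ∈ language X
  belt : ∃ e ∈ X.carrier, ∀ k : ℤ, At e (k * p) (c (false, false))

/-- The code of the cell carrying the bits `v`. -/
def cellCode (v : Bool × Bool) : List Bool :=
  -- The middle is one-hot, so all four codes use each block equally often and give words of equal
  -- length. The outer triples are markers.
  [true, true, true, false, !v.1 && !v.2, v.1 && !v.2, !v.1 && v.2, v.1 && v.2,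
    false, true, true, true]

/-- The marker occurs at the two ends only, as the part between them has a single `true`. -/
lemma cellCode_prefix (v : Bool × Bool) (k : ℕ) (h : [true, true, true] <+: (cellCode v).drop k) :
    k = 0 ∨ k = 9 := by
  have hk : k ≤ 12 := by
    by_contra hk
    rw [List.drop_eq_nil_of_le (by simp [cellCode]; omega)] at h
    simp at h
  revert v
  interval_cases k <;> decide

variable {X : Subshift A ℤ}

lemma at_flatten_replicate {y : ℤ → A} {q : List A} (n : ℕ) : ∀ i : ℤ,
    (∀ k : ℕ, k < n → At y (i + k * q.length) q) → At y i (List.replicate n q).flatten := by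
  induction n with
  | zero => intro i _; simp
  | succ n ih =>
    intro i h
    rw [List.replicate_succ, List.flatten_cons, at_append]
    refine ⟨by simpa using h 0 (by omega), ih _ fun k hk => ?_⟩
    have := h (k + 1) (by omega)
    convert this using 1
    push_cast
    ring

/-- The coded marker `V` is synchronizing and is both a prefix and a suffix of each cell. This makes
cells interchangeable and lets consecutive ones share it. -/
theorem exists_cellSystem [Finite A] (hinf : X.carrier.Infinite) (ht : IsTransitive X)
    (hs : IsSofic X) : Nonempty (CellSystem X) := by
  obtain ⟨U, hU⟩ := exists_sync hinf.nonempty hs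
  obtain ⟨r, hr, hne⟩ := exists_two_returns hinf ht hU.1
  have hpos : ∀ b, 0 < (r b).length := fun b => List.length_pos_iff.2 (hr b).1
  set V := codeWord r U [true, true, true] with hV
  set p := (((cellCode (false, false)).take 9).flatMap r).length with hp
  have hp' : ∀ v, (((cellCode v).take 9).flatMap r).length = p := by
    rintro ⟨_ | _, _ | _⟩ <;> simp [hp, cellCode] <;> omega
  have hsplit : ∀ v, codeWord r U (cellCode v) = ((cellCode v).take 9).flatMap r ++ V := by
    intro v
    conv_lhs => rw [← List.take_append_drop 9 (cellCode v), codeWord_append]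
    rfl
  have hpre : ∀ v, V <+: codeWord r U (cellCode v) := fun v =>
    codeWord_prefix hr [true, true, true] ((cellCode v).drop 3)
  have hlen : ∀ v, (codeWord r U (cellCode v)).length = p + V.length := by
    intro v
    rw [hsplit, List.length_append, hp']
  have hp0 : 0 < p := by
    have := hpos true
    simp [hp, cellCode]
    omega
  have hVs : Sync X V := by
    have := codeWord_mem hU hr [true, true, true]
    have h2 : codeWord r U [true, true, true] = [true, true, true].flatMap r ++ U ++ [] := by
      simp [codeWord]
    rw [hV, h2]
    rw [h2] at this
    exact hU.infix this
  have hdrop : ∀ v, (codeWord r U (cellCode v)).drop p = V := by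
    intro v
    rw [hsplit, ← hp' v]
    simp
  have htake : ∀ v, (codeWord r U (cellCode v)).take V.length = V := fun v =>
    (List.prefix_iff_eq_take.1 (hpre v)).symm
  refine ⟨⟨fun v => codeWord r U (cellCode v), p, p + V.length, hp0, by omega, hlen, ?_, ?_, ?_,
    ?_, ?_, ?_⟩⟩
  · intro v v' h
    have h1 : cellCode v <+: cellCode v' :=
      eq_of_prefix_codeWord hr hne (by simp only at h; rw [h])
    have h2 := h1.eq_of_length (by simp [cellCode])
    clear h h1
    revert v v'
    decide
  · intro x i j v v' hi hj hij
    by_contra hlt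
    -- A cell at offset `o < p` would put a marker at `o` inside the first cell, but its markers are
    -- at the offsets 0 and `p`.
    obtain ⟨o, ho⟩ : ∃ o : ℕ, j = i + o := ⟨(j - i).toNat, by omega⟩
    subst ho
    have h1 := hi.drop o (by rw [hlen]; omega)
    have h2 := hj.of_prefix (hpre v')
    have h3 := h2.prefix h1 (by rw [List.length_drop, hlen]; omega)
    obtain ⟨k, hk, hk'⟩ := exists_of_codeWord_prefix_drop hr hne (by
      have := hlen v
      simp only [codeWord, List.length_append] at this
      have h4 : U.length ≤ V.length := by simp [hV, codeWord]; omega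
      omega) h3
    rcases cellCode_prefix v k hk' with rfl | rfl
    · simp at hk
      omega
    · rw [hp'] at hk
      omega
  · intro v v'
    simp [hdrop, htake]
  · intro v
    have h1 : codeWord r U (cellCode v) = ((cellCode v).take 9).flatMap r ++ V ++ [] := by
      rw [hsplit, List.append_nil]
    show Sync X (codeWord r U (cellCode v))
    rw [h1]
    apply hVs.infix
    rw [← h1]
    exact codeWord_mem hU hr _
  · intro v v' u t h
    obtain ⟨s, hs⟩ := hpre v'
    obtain ⟨s₀, hs₀⟩ := hpre v
    have h1 : u ++ V ∈ language X := by
      apply language_left (w := s₀ ++ t)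
      simp only [← hs₀] at h
      simpa using h
    have h2 : V ++ t ∈ language X := by
      apply language_right (u := u ++ ((cellCode v).take 9).flatMap r)
      simp only [hsplit] at h
      simpa using h
    have h3 : u ++ codeWord r U (cellCode v') ∈ language X := by
      rw [← hs, ← List.append_assoc]
      apply hVs.2 _ _ h1
      rw [hs]
      exact codeWord_mem hU hr _
    show u ++ codeWord r U (cellCode v') ++ t ∈ language X
    rw [hsplit] at h3 ⊢
    rw [← List.append_assoc] at h3 ⊢
    exact hVs.2 _ _ h3 h2
  -- Powers of `q` closed by `V` are code words, so the periodic point made of copies of `q` lies in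
  -- `X`. Since `V` is a prefix of every such word, it is a prefix of a long power of `q`, hence
  -- each `q` is followed by `V`.
  · set q := ((cellCode (false, false)).take 9).flatMap r with hq
    have hqV : codeWord r U (cellCode (false, false)) = q ++ V := hsplit _
    have hqlen : q.length = p := rfl
    have hVq : V <+: q ++ V := by rw [← hqV]; exact hpre _
    have hL : ∀ n : ℕ, (List.replicate n q).flatten ++ V ∈ language X := by
      intro n
      have : (List.replicate n q).flatten ++ V = codeWord r U
          ((List.replicate n ((cellCode (false, false)).take 9)).flatten ++ [true, true, true]) := by
        rw [codeWord_append, hV]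
        congr 1
        induction n with
        | zero => simp
        | succ n ih =>
          simp only [List.replicate_succ, List.flatten_cons, List.flatMap_append, ih]
          rfl
      rw [this]
      exact codeWord_mem hU hr _
    set e : ℤ → A := fun j => q[(j % p).toNat]'(by
      have h1 := Int.emod_lt_of_pos j (b := p) (by omega)
      omega) with he
    have heq : ∀ k : ℤ, At e (k * p) q := by
      intro k j hj
      have : ((k * p + (j : ℤ)) % (p : ℤ)).toNat = j := by
        rw [Int.add_comm, Int.add_mul_emod_self_right, Int.emod_eq_of_lt (by omega) (by omega)]
        simp
      simp only [he, this]
    have heX : e ∈ X.carrier := by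
      refine mem_of_fac_mem fun N => ?_
      refine ⟨-N * p, by nlinarith, 2 * N * p + p, by push_cast; nlinarith, ?_⟩
      have h1 : At e (-N * p) (List.replicate (2 * N + 1) q).flatten := by
        apply at_flatten_replicate
        intro k _
        have := heq (-N + k)
        convert this using 1
        rw [hqlen]
        ring
      have h2 := h1.eq_fac
      have h3 : (List.replicate (2 * N + 1) q).flatten.length = 2 * N * p + p := by
        simp [hqlen]
        ring
      rw [h3] at h2
      rw [h2]
      exact language_left (hL (2 * N + 1))
    refine ⟨e, heX, fun k => ?_⟩
    show At e (k * p) (codeWord r U (cellCode (false, false)))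
    have hVlen : ∃ n : ℕ, V.length ≤ n * p := ⟨V.length, Nat.le_mul_of_pos_right _ hp0⟩
    obtain ⟨n, hn⟩ := hVlen
    have hpow : ∀ n : ℕ, V <+: (List.replicate n q).flatten ++ V := by
      intro n
      induction n with
      | zero => simp
      | succ n ih =>
        rw [List.replicate_succ, List.flatten_cons, List.append_assoc]
        exact hVq.trans ((List.prefix_append_right_inj _).2 ih)
    rw [hqV, at_append]
    refine ⟨heq k, ?_⟩
    have h1 : At e (k * p + q.length) (List.replicate n q).flatten := by
      apply at_flatten_replicate
      intro j _
      have := heq (k + 1 + j)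
      convert this using 1
      rw [hqlen]
      ring
    refine h1.of_prefix ?_
    exact List.prefix_of_prefix_length_le (hpow n) (List.prefix_append _ _) (by simp [hqlen]; omega)

end Cells

/-! ### Replacing a word by one of equal length and equal follower set -/

section SameLength

variable {A : Type*} [TopologicalSpace A] {X : Subshift A ℤ}

lemma Sync.mem_iff {c : List A} (hc : Sync X c) {u : List A} (hu : u ++ c ∈ language X)
    (t : List A) : u ++ c ++ t ∈ language X ↔ c ++ t ∈ language X :=
  ⟨fun h => language_right (u := u) (by simpa using h), fun h => hc.2 _ _ hu h⟩

/-- There are finitely many follower sets. Choose for each one a representative and a way back to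
`c`; both then serve every `v` with that follower set. -/
lemma exists_bounded_representatives (ht : IsTransitive X) (hs : IsSofic X) {c : List A}
    (hc : Sync X c) : ∃ B : ℕ, ∀ v, c ++ v ∈ language X → ∃ r g : List A, r.length ≤ B ∧
      g.length ≤ B ∧ (∀ t, c ++ r ++ t ∈ language X ↔ c ++ v ++ t ∈ language X) ∧
      c ++ v ++ g ++ c ∈ language X := by
  have hfin := hs.finite_range_leftQuotient
  have hex : ∀ Q : Language A, ∃ n : ℕ, ∀ v, (language X).leftQuotient (c ++ v) = Q →
      c ++ v ∈ language X → ∃ r g : List A, r.length ≤ n ∧ g.length ≤ n ∧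
      (∀ t, c ++ r ++ t ∈ language X ↔ c ++ v ++ t ∈ language X) ∧
      c ++ v ++ g ++ c ∈ language X := by
    intro Q
    by_cases hQ : ∃ r, (language X).leftQuotient (c ++ r) = Q ∧ c ++ r ∈ language X
    · obtain ⟨r, hr, hrL⟩ := hQ
      obtain ⟨g, hg⟩ := ht.exists_append hrL hc.1
      refine ⟨max r.length g.length, fun v hv hvL => ⟨r, g, le_max_left _ _, le_max_right _ _, ?_⟩⟩
      have key : ∀ t, c ++ r ++ t ∈ language X ↔ c ++ v ++ t ∈ language X := by
        intro t
        have : t ∈ (language X).leftQuotient (c ++ r) ↔ t ∈ (language X).leftQuotient (c ++ v) := by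
          rw [hr, hv]
        exact this
      refine ⟨key, ?_⟩
      have := (key (g ++ c)).1 (by simpa using hg)
      simpa using this
    · exact ⟨0, fun v hv hvL => absurd ⟨v, hv, hvL⟩ hQ⟩
  choose n hn using hex
  refine ⟨hfin.toFinset.sup n, fun v hv => ?_⟩
  obtain ⟨r, g, h1, h2, h3⟩ := hn _ v rfl hv
  have hle : n ((language X).leftQuotient (c ++ v)) ≤ hfin.toFinset.sup n :=
    Finset.le_sup (f := n) (by simp)
  exact ⟨r, g, h1.trans hle, h2.trans hle, h3⟩

/-- The lengths of the loops at `c`. -/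
def loopLengths (X : Subshift A ℤ) {c : List A} (hc : Sync X c) : AddSubmonoid ℕ where
  carrier := {n | n = 0 ∨ ∃ g, c.length + g.length = n ∧ c ++ g ++ c ∈ language X}
  zero_mem' := Or.inl rfl
  add_mem' := by
    rintro a b (rfl | ⟨g, hg, hgL⟩) (rfl | ⟨g', hg', hgL'⟩)
    · left; rfl
    · right; exact ⟨g', by omega, hgL'⟩
    · right; exact ⟨g, by omega, hgL⟩
    · right
      refine ⟨g ++ c ++ g', by simp; omega, ?_⟩
      have := (hc.mem_iff (u := c ++ g) hgL (g' ++ c)).2 (by simpa using hgL')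
      simpa using this

/-- In a long word following `c`, the letters can be replaced by equally many letters that
contain `c` and lead to the same state. -/
theorem exists_same_length_containing (ht : IsTransitive X) (hs : IsSofic X) {c : List A}
    (hc : Sync X c) (hc0 : c ≠ []) : ∃ R₀ : ℕ, ∀ v b, R₀ ≤ b.length → c ++ v ++ b ∈ language X →
      ∃ g h : List A, (g ++ c ++ h).length = b.length ∧
        ∀ t, c ++ v ++ (g ++ c ++ h) ++ t ∈ language X ↔ c ++ v ++ b ++ t ∈ language X := by
  obtain ⟨B, hB⟩ := exists_bounded_representatives ht hs hc
  -- The loop lengths contain all sufficiently large multiples of their gcd.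
  obtain ⟨n₀, hn₀⟩ := Nat.exists_mem_closure_of_ge (loopLengths X hc : Set ℕ)
  rw [AddSubmonoid.closure_eq] at hn₀
  have hcpos := List.length_pos_iff.2 hc0
  -- What remains of the length of `b` after `g`, `c` and `h` then exceeds `n₀`, so a loop can fill
  -- it and this loop is not the trivial one.
  refine ⟨n₀ + 2 * B + c.length + 1, fun v b hb hL => ?_⟩
  obtain ⟨-, g, -, hg, -, hgL⟩ := hB v (language_left hL)
  obtain ⟨h, t, hh, -, hF, htL⟩ := hB (v ++ b) (by simpa using hL)
  have htL' : c ++ h ++ t ++ c ∈ language X := by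
    have := (hF (t ++ c)).2 (by simpa using htL)
    simpa using this
  set d := Nat.setGcd (loopLengths X hc : Set ℕ) with hd
  have hdvd : ∀ g : List A, c ++ g ++ c ∈ language X → d ∣ c.length + g.length :=
    fun g hg => Nat.setGcd_dvd_of_mem (Or.inr ⟨g, rfl, hg⟩)
  have d1 := hdvd (v ++ b ++ t) (by simpa using htL)
  have d2 := hdvd (v ++ g) (by simpa using hgL)
  have d3 := hdvd (h ++ t) (by simpa using htL')
  simp only [List.length_append] at d1 d2 d3
  -- The remaining length is the length of the loop through `v ++ b ++ t` minus those of the loops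
  -- through `v ++ g` and `h ++ t`.
  have hdn : d ∣ b.length - g.length - c.length - h.length := by
    have h1 : c.length + (v.length + b.length + t.length) = (c.length + (v.length + g.length)) +
        ((c.length + (h.length + t.length)) + (b.length - g.length - c.length - h.length)) := by
      omega
    rw [h1] at d1
    exact (Nat.dvd_add_right d3).1 ((Nat.dvd_add_right d2).1 d1)
  rcases hn₀ _ (by omega) hdn with h0 | ⟨g', hg', hgL'⟩
  · omega
  refine ⟨g ++ c ++ g', h, by simp; omega, fun s => ?_⟩
  have h1 : c ++ v ++ g ++ c ++ g' ++ c ∈ language X := by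
    have := (hc.mem_iff (u := c ++ v ++ g) hgL (g' ++ c)).2 (by simpa using hgL')
    simpa using this
  have h2 := hc.mem_iff (u := c ++ v ++ g ++ c ++ g') h1 (h ++ s)
  have h3 := hF s
  simp only [List.append_assoc] at h2 h3 ⊢
  exact h2.trans h3

end SameLength

/-! ### Windows, and recoloring of cells -/

/-- Two configurations agree on the interval `[a, b)`. -/
def EqWin {A : Type*} (x y : ℤ → A) (a b : ℤ) : Prop := ∀ k, a ≤ k → k < b → x k = y k

lemma EqWin.symm {A : Type*} {x y : ℤ → A} {a b : ℤ} (h : EqWin x y a b) : EqWin y x a b :=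
  fun k h1 h2 => (h k h1 h2).symm

lemma EqWin.mono {A : Type*} {x y : ℤ → A} {a b a' b' : ℤ} (h : EqWin x y a b) (ha : a ≤ a')
    (hb : b' ≤ b) : EqWin x y a' b' :=
  fun k h1 h2 => h k (ha.trans h1) (h2.trans_le hb)

lemma EqWin.at {A : Type*} {x y : ℤ → A} {a b i : ℤ} {w : List A} (h : EqWin x y a b)
    (hw : At x i w) (ha : a ≤ i) (hb : i + w.length ≤ b) : At y i w :=
  hw.congr fun k hk => (h _ (by omega) (by omega)).symm

namespace CellSystem

variable {A : Type*} [TopologicalSpace A] {X : Subshift A ℤ} (cs : CellSystem X)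

/-- There is a cell of `x` at `i`. -/
def IsCell (x : ℤ → A) (i : ℤ) : Prop := ∃ v, At x i (cs.c v)

open Classical in
/-- The bits carried by the cell of `x` at `i`. -/
noncomputable def val (x : ℤ → A) (i : ℤ) : Bool × Bool :=
  if h : cs.IsCell x i then h.choose else (false, false)

variable {cs}

lemma val_eq {x : ℤ → A} {i : ℤ} {v : Bool × Bool} (h : At x i (cs.c v)) : cs.val x i = v := by
  have hex : cs.IsCell x i := ⟨v, h⟩
  rw [val, dif_pos hex]
  exact cs.inj (hex.choose_spec.eq h (by simp [cs.length_c]))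

/-- Thanks to this default, statements that some bits vanish can range over all positions instead of
the cells only. -/
lemma val_of_not {x : ℤ → A} {i : ℤ} (h : ¬ cs.IsCell x i) : cs.val x i = (false, false) :=
  dif_neg h

lemma IsCell.at {x : ℤ → A} {i : ℤ} (h : cs.IsCell x i) : At x i (cs.c (cs.val x i)) := by
  obtain ⟨v, hv⟩ := h
  rwa [val_eq hv]

lemma IsCell.sep {x : ℤ → A} {i j : ℤ} (hi : cs.IsCell x i) (hj : cs.IsCell x j) (hij : i < j) :
    i + cs.p ≤ j :=
  cs.sep x i j _ _ hi.at hj.at hij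

lemma IsCell.unique {x : ℤ → A} {i j k : ℤ} (hi : cs.IsCell x i) (hj : cs.IsCell x j)
    (h1 : i ≤ k) (h2 : k < i + cs.p) (h3 : j ≤ k) (h4 : k < j + cs.p) : i = j := by
  rcases lt_trichotomy i j with h | h | h
  · have := hi.sep hj h
    omega
  · exact h
  · have := hj.sep hi h
    omega

lemma isCell_shift {x : ℤ → A} {s i : ℤ} : cs.IsCell (shift s x) i ↔ cs.IsCell x (s + i) := by
  simp [IsCell, at_shift]

lemma val_shift (x : ℤ → A) (s i : ℤ) : cs.val (shift s x) i = cs.val x (s + i) := by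
  by_cases h : cs.IsCell x (s + i)
  · exact val_eq (at_shift.2 h.at)
  · rw [val_of_not h, val_of_not (mt isCell_shift.1 h)]

lemma isCell_congr {x y : ℤ → A} {a b i : ℤ} (h : EqWin x y a b) (ha : a ≤ i)
    (hb : i + cs.m ≤ b) : cs.IsCell x i ↔ cs.IsCell y i :=
  ⟨fun ⟨v, hv⟩ => ⟨v, h.at hv ha (by simpa [cs.length_c] using hb)⟩,
    fun ⟨v, hv⟩ => ⟨v, h.symm.at hv ha (by simpa [cs.length_c] using hb)⟩⟩

lemma val_congr {x y : ℤ → A} {a b i : ℤ} (h : EqWin x y a b) (ha : a ≤ i)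
    (hb : i + cs.m ≤ b) : cs.val x i = cs.val y i := by
  by_cases hx : cs.IsCell x i
  · exact (val_eq (h.at hx.at ha (by simpa [cs.length_c] using hb))).symm
  · have hy := mt (isCell_congr h ha hb).2 hx
    rw [val_of_not hx, val_of_not hy]

lemma c_eq_of_le (v v' : Bool × Bool) (n : ℕ) (h : cs.p ≤ n) (hn : n < cs.m) :
    (cs.c v)[n]'(by rwa [cs.length_c]) = (cs.c v')[n]'(by rwa [cs.length_c]) := by
  have h1 : (cs.c v).drop cs.p = (cs.c v').drop cs.p :=
    (cs.drop_eq_take v v).trans (cs.drop_eq_take v' v).symm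
  have h2 := List.getElem_of_eq h1 (i := n - cs.p) (by rw [List.length_drop, cs.length_c]; omega)
  simpa [List.getElem_drop, Nat.add_sub_cancel' h] using h2

lemma c_eq_of_lt (v v' : Bool × Bool) (n : ℕ) (h : n + cs.p < cs.m) :
    (cs.c v)[n]'(by rw [cs.length_c]; omega) = (cs.c v')[n]'(by rw [cs.length_c]; omega) := by
  have h1 : (cs.c v).take (cs.m - cs.p) = (cs.c v').take (cs.m - cs.p) :=
    (cs.drop_eq_take v v).symm.trans (cs.drop_eq_take v v')
  have h2 := List.getElem_of_eq h1 (i := n) (by rw [List.length_take, cs.length_c]; omega)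
  simpa using h2

variable (cs)

open Classical in
/-- Replace the bits of the cells of `x`: those of the cell at `i` become `f i`. -/
noncomputable def recolor (x : ℤ → A) (f : ℤ → Bool × Bool) : ℤ → A := fun k =>
  if h : ∃ i, cs.IsCell x i ∧ i ≤ k ∧ k < i + cs.p then
    ((cs.c (f h.choose))[(k - h.choose).toNat]?).getD (x k) else x k

variable {cs}

lemma recolor_of_not {x : ℤ → A} {f : ℤ → Bool × Bool} {k : ℤ}
    (h : ∀ i, cs.IsCell x i → i ≤ k → i + cs.p ≤ k) : cs.recolor x f k = x k := by
  rw [recolor, dif_neg]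
  rintro ⟨i, hi, h1, h2⟩
  have := h i hi h1
  omega

lemma recolor_apply {x : ℤ → A} {f : ℤ → Bool × Bool} {i : ℤ} (hi : cs.IsCell x i) {n : ℕ}
    (hn : n < cs.p) : cs.recolor x f (i + n) =
      (cs.c (f i))[n]'(by rw [cs.length_c]; exact hn.trans_le cs.p_le) := by
  have hex : ∃ j, cs.IsCell x j ∧ j ≤ i + n ∧ i + n < j + cs.p := ⟨i, hi, by omega, by omega⟩
  have hch : hex.choose = i :=
    hex.choose_spec.1.unique hi hex.choose_spec.2.1 hex.choose_spec.2.2 (by omega) (by omega)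
  rw [recolor, dif_pos hex, hch]
  have e : (i + (n : ℤ) - i).toNat = n := by omega
  rw [e, List.getElem?_eq_getElem (by rw [cs.length_c]; exact hn.trans_le cs.p_le)]
  rfl

lemma recolor_congr_at {x : ℤ → A} {f g : ℤ → Bool × Bool} {k : ℤ}
    (h : ∀ i, cs.IsCell x i → i ≤ k → k < i + cs.p → f i = g i) :
    cs.recolor x f k = cs.recolor x g k := by
  by_cases hex : ∃ i, cs.IsCell x i ∧ i ≤ k ∧ k < i + cs.p
  · rw [recolor, recolor, dif_pos hex, dif_pos hex,
      h _ hex.choose_spec.1 hex.choose_spec.2.1 hex.choose_spec.2.2]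
  · rw [recolor, recolor, dif_neg hex, dif_neg hex]

lemma recolor_congr {x : ℤ → A} {f g : ℤ → Bool × Bool} (h : ∀ i, cs.IsCell x i → f i = g i) :
    cs.recolor x f = cs.recolor x g :=
  funext fun _ => recolor_congr_at fun i hi _ _ => h i hi

lemma recolor_val (x : ℤ → A) : cs.recolor x (cs.val x) = x := by
  funext k
  by_cases hex : ∃ i, cs.IsCell x i ∧ i ≤ k ∧ k < i + cs.p
  · obtain ⟨i, hi, h1, h2⟩ := hex
    obtain ⟨n, rfl⟩ : ∃ n : ℕ, k = i + n := ⟨(k - i).toNat, by omega⟩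
    rw [recolor_apply hi (by omega)]
    exact (hi.at n _).symm
  · exact recolor_of_not fun i hi h1 => by
      by_contra h2
      exact hex ⟨i, hi, h1, by omega⟩

lemma recolor_eq_self_at {x : ℤ → A} {f : ℤ → Bool × Bool} {k : ℤ}
    (h : ∀ i, cs.IsCell x i → i ≤ k → k < i + cs.p → f i = cs.val x i) :
    cs.recolor x f k = x k := by
  conv_rhs => rw [← recolor_val (cs := cs) x]
  exact recolor_congr_at h

/-- The first `m - p` letters of a cell are common to all four cells, so recoloring can change a
cell only from the offset `m - p` to the offset `p - 1`. -/
lemma recolor_overlap {x : ℤ → A} {f : ℤ → Bool × Bool} {k : ℤ}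
    (h : ∀ i, cs.IsCell x i → i ≤ k → k + cs.p < i + cs.m ∨ i + cs.p ≤ k) :
    cs.recolor x f k = x k := by
  by_cases hex : ∃ i, cs.IsCell x i ∧ i ≤ k ∧ k < i + cs.p
  · obtain ⟨i, hi, h1, h2⟩ := hex
    obtain ⟨n, rfl⟩ : ∃ n : ℕ, k = i + n := ⟨(k - i).toNat, by omega⟩
    rw [recolor_apply hi (by omega)]
    have := h i hi h1
    rw [c_eq_of_lt _ (cs.val x i) n (by omega)]
    exact (hi.at n _).symm
  · exact recolor_of_not fun i hi h1 => by
      by_contra h2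
      exact hex ⟨i, hi, h1, by omega⟩

lemma at_recolor {x : ℤ → A} (f : ℤ → Bool × Bool) {i : ℤ} (hi : cs.IsCell x i) :
    At (cs.recolor x f) i (cs.c (f i)) := by
  intro n hn
  rw [cs.length_c] at hn
  by_cases hnp : n < cs.p
  · exact recolor_apply hi hnp
  · rw [c_eq_of_le _ (cs.val x i) n (by omega) hn, ← hi.at n (by rwa [cs.length_c])]
    refine recolor_overlap fun j hj hjk => ?_
    rcases lt_trichotomy i j with h | rfl | h
    · have := hi.sep hj h
      omega
    · omega
    · have := hj.sep hi h
      omega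

/-- Old cells remain cells, so a new one would be separated from them by `p`. It would overlap them
only in letters common to all four cells, and so would have been a cell before. -/
lemma isCell_recolor {x : ℤ → A} {f : ℤ → Bool × Bool} {i : ℤ} :
    cs.IsCell (cs.recolor x f) i ↔ cs.IsCell x i := by
  refine ⟨fun h => ?_, fun h => ⟨_, at_recolor f h⟩⟩
  by_contra hx
  refine hx ⟨cs.val (cs.recolor x f) i, h.at.congr fun n hn => ?_⟩
  rw [cs.length_c] at hn
  symm
  refine recolor_overlap fun j hj hjk => ?_
  have hj' : cs.IsCell (cs.recolor x f) j := ⟨_, at_recolor f hj⟩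
  rcases lt_trichotomy i j with h' | rfl | h'
  · have := h.sep hj' h'
    omega
  · exact absurd hj hx
  · have := hj'.sep h h'
    omega

lemma val_recolor {x : ℤ → A} (f : ℤ → Bool × Bool) {i : ℤ} (hi : cs.IsCell x i) :
    cs.val (cs.recolor x f) i = f i := val_eq (at_recolor f hi)

lemma recolor_recolor (x : ℤ → A) (f g : ℤ → Bool × Bool) :
    cs.recolor (cs.recolor x f) g = cs.recolor x g := by
  funext k
  by_cases hex : ∃ i, cs.IsCell x i ∧ i ≤ k ∧ k < i + cs.p
  · obtain ⟨i, hi, h1, h2⟩ := hex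
    obtain ⟨n, rfl⟩ : ∃ n : ℕ, k = i + n := ⟨(k - i).toNat, by omega⟩
    rw [recolor_apply hi (by omega), recolor_apply (isCell_recolor.2 hi) (by omega)]
  · have h : ∀ i, cs.IsCell x i → i ≤ k → i + cs.p ≤ k := fun i hi h1 => by
      by_contra h2
      exact hex ⟨i, hi, h1, by omega⟩
    rw [recolor_of_not h, recolor_of_not fun i hi => h i (isCell_recolor.1 hi), recolor_of_not h]

lemma recolor_shift (x : ℤ → A) (f : ℤ → Bool × Bool) (s : ℤ) :
    cs.recolor (shift s x) (fun i => f (s + i)) = shift s (cs.recolor x f) := by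
  funext k
  rw [shift_apply]
  by_cases hex : ∃ i, cs.IsCell x i ∧ i ≤ s + k ∧ s + k < i + cs.p
  · obtain ⟨i, hi, h1, h2⟩ := hex
    obtain ⟨n, hn⟩ : ∃ n : ℕ, s + k = i + n := ⟨(s + k - i).toNat, by omega⟩
    have hi' : cs.IsCell (shift s x) (i - s) := isCell_shift.2 (by simpa using hi)
    obtain rfl : k = i - s + n := by omega
    have hnp : n < cs.p := by omega
    rw [hn, recolor_apply hi hnp, recolor_apply hi' hnp]
    simp
  · have h : ∀ i, cs.IsCell x i → i ≤ s + k → i + cs.p ≤ s + k := fun i hi h1 => by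
      by_contra h2
      exact hex ⟨i, hi, h1, by omega⟩
    rw [recolor_of_not h, recolor_of_not fun i hi h1 => by
      have := h _ (isCell_shift.1 hi) (by omega)
      omega]
    rfl

lemma recolor_local {x y : ℤ → A} {f g : ℤ → Bool × Bool} {k : ℤ}
    (h : EqWin x y (k - cs.m) (k + cs.m))
    (hfg : ∀ i, cs.IsCell x i → i ≤ k → k < i + cs.p → f i = g i) :
    cs.recolor x f k = cs.recolor y g k := by
  have hpm := cs.p_le
  have hp := cs.p_pos
  by_cases hex : ∃ i, cs.IsCell x i ∧ i ≤ k ∧ k < i + cs.p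
  · obtain ⟨i, hi, h1, h2⟩ := hex
    have hi' : cs.IsCell y i := (isCell_congr h (by omega) (by omega)).1 hi
    have hfi := hfg i hi h1 h2
    obtain ⟨n, rfl⟩ : ∃ n : ℕ, k = i + n := ⟨(k - i).toNat, by omega⟩
    rw [recolor_apply hi (by omega), recolor_apply hi' (by omega)]
    simp only [hfi]
  · have h' : ∀ i, cs.IsCell x i → i ≤ k → i + cs.p ≤ k := fun i hi h1 => by
      by_contra h2
      exact hex ⟨i, hi, h1, by omega⟩
    rw [recolor_of_not h', recolor_of_not fun i hi h1 => ?_]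
    · exact h k (by omega) (by omega)
    · by_contra h2
      exact h2 (h' i ((isCell_congr h (by omega) (by omega)).2 hi) h1)

/-- One cell can be changed since the four words have the same contexts. Induction gives finitely
many cells, and closedness of `X` gives all of them. -/
theorem recolor_mem {x : ℤ → A} (hx : x ∈ X.carrier) (f : ℤ → Bool × Bool) :
    cs.recolor x f ∈ X.carrier := by
  classical
  have hp := cs.p_pos
  have hfin : ∀ I : Finset ℤ,
      cs.recolor x (fun i => if i ∈ I then f i else cs.val x i) ∈ X.carrier := by
    intro I
    induction I using Finset.induction_on with
    | empty => simpa [recolor_val] using hx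
    | insert j I hj ih =>
      by_cases hcell : cs.IsCell x j
      · have h1 := at_recolor (cs := cs) (fun i => if i ∈ I then f i else cs.val x i) hcell
        have h2 := at_recolor (cs := cs) (fun i => if i ∈ insert j I then f i else cs.val x i) hcell
        refine mem_of_replace ih h1 h2 (by simp [cs.length_c]) (fun k hk => ?_) (cs.repl _ _)
        rw [cs.length_c] at hk
        refine recolor_congr_at fun i _ hi1 hi2 => ?_
        have hij : i ≠ j := by
          rintro rfl
          have := cs.p_le
          omega
        simp [Finset.mem_insert, hij]
      · convert ih using 1
        refine recolor_congr fun i hi => ?_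
        have hij : i ≠ j := by
          rintro rfl
          exact hcell hi
        simp [Finset.mem_insert, hij]
  -- This interval contains every cell whose first `p` letters meet the window from `-N` to `N`.
  refine mem_of_agree fun N => ⟨_, hfin (Finset.Icc (-N - cs.p) N), fun k h1 h2 => ?_⟩
  refine recolor_congr_at fun i _ hi1 hi2 => ?_
  rw [if_pos (Finset.mem_Icc.2 ⟨by omega, by omega⟩)]

end CellSystem

/-! ### The erosion rule: reversible insertion of full cells into gaps -/

namespace CellSystem

variable {A : Type*} [TopologicalSpace A] {X : Subshift A ℤ}

/-- An empty cell at `0` and no other cell before `H`. -/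
def Gap (cs : CellSystem X) (H : ℕ) (x : ℤ → A) : Prop :=
  x ∈ X.carrier ∧ At x 0 (cs.c (false, false)) ∧ ∀ i : ℤ, 0 < i → i < H → ¬ cs.IsCell x i

/-- A rule that inserts full cells after an empty cell followed by a gap, reversibly. -/
structure Erosion (cs : CellSystem X) where
  /-- the length of a gap -/
  H : ℕ
  /-- the insertion -/
  φ : (ℤ → A) → (ℤ → A)
  p_lt : 2 * cs.p < H
  mem : ∀ {x}, cs.Gap H x → φ x ∈ X.carrier
  out : ∀ {x}, cs.Gap H x → ∀ k : ℤ, (k < cs.m ∨ H ≤ k) → φ x k = x k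
  inner : ∀ {x}, cs.Gap H x → ∀ i : ℤ, 0 < i → i < H → cs.IsCell (φ x) i →
    cs.val (φ x) i = (true, true)
  exists_inner : ∀ {x}, cs.Gap H x → ∃ i : ℤ, 0 < i ∧ i < H ∧ cs.IsCell (φ x) i
  loc : ∀ {x y}, cs.Gap H x → cs.Gap H y → EqWin x y 0 (H + cs.m) → EqWin (φ x) (φ y) cs.m H
  inj : ∀ {x y}, cs.Gap H x → cs.Gap H y → EqWin (φ x) (φ y) 0 (H + cs.m) → EqWin x y cs.m H
  -- An insertion can be undone in any point that shows its window, whatever stands outside. This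
  -- makes filled gaps recognizable locally.
  back : ∀ {x y z}, cs.Gap H x → y ∈ X.carrier → EqWin y (φ x) 0 (H + cs.m) →
    EqWin z x cs.m H → (∀ k : ℤ, (k < cs.m ∨ H ≤ k) → z k = y k) → z ∈ X.carrier

/-- The parameters of the construction of an erosion rule. -/
structure ErosionData (cs : CellSystem X) where
  /-- the length of the blocks -/
  R : ℕ
  /-- the number of blocks -/
  B : ℕ
  neZero : NeZero B
  /-- the numbering of the blocks -/
  e : (Fin R → A) ≃ ZMod B
  /-- the word that replaces the core of a block, given what precedes it -/
  β : List A → List A → List A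
  lt_R : 3 * cs.m < R
  length_β : ∀ v b, b.length + 2 * cs.m = R → cs.c (false, false) ++ v ++ b ∈ language X →
    (β v b).length = b.length
  exists_β : ∀ v b, b.length + 2 * cs.m = R → cs.c (false, false) ++ v ++ b ∈ language X →
    ∃ g h, β v b = g ++ cs.c (false, false) ++ h
  iff_β : ∀ v b, b.length + 2 * cs.m = R → cs.c (false, false) ++ v ++ b ∈ language X →
    ∀ t, cs.c (false, false) ++ v ++ β v b ++ t ∈ language X ↔
      cs.c (false, false) ++ v ++ b ++ t ∈ language X

theorem exists_erosionData [Finite A] (cs : CellSystem X) (hne : X.carrier.Nonempty)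
    (ht : IsTransitive X) (hs : IsSofic X) : Nonempty (ErosionData cs) := by
  classical
  have hc0 : cs.c (false, false) ≠ [] := by
    have h1 := cs.length_c (false, false)
    have h2 := cs.p_pos
    have h3 := cs.p_le
    intro h
    rw [h] at h1
    simp at h1
    omega
  obtain ⟨R₀, hR₀⟩ := exists_same_length_containing ht hs (cs.sync (false, false)) hc0
  have hR₀' : ∀ v b : List A, ∃ β : List A, R₀ ≤ b.length →
      cs.c (false, false) ++ v ++ b ∈ language X → β.length = b.length ∧
      (∃ g h, β = g ++ cs.c (false, false) ++ h) ∧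
      ∀ t, cs.c (false, false) ++ v ++ β ++ t ∈ language X ↔
        cs.c (false, false) ++ v ++ b ++ t ∈ language X := by
    intro v b
    by_cases h : R₀ ≤ b.length ∧ cs.c (false, false) ++ v ++ b ∈ language X
    · obtain ⟨g, k, h1, h2⟩ := hR₀ v b h.1 h.2
      exact ⟨g ++ cs.c (false, false) ++ k, fun _ _ => ⟨h1, ⟨g, k, rfl⟩, h2⟩⟩
    · exact ⟨[], fun h1 h2 => absurd ⟨h1, h2⟩ h⟩
  choose β hβ using hR₀'
  obtain ⟨x, -⟩ := hne
  have : Nonempty A := ⟨x 0⟩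
  have := Fintype.ofFinite A
  set R := R₀ + 3 * cs.m + 1 with hR
  -- There are as many blocks as words of length `R`, so a residue modulo `B` can name a block as
  -- well as encode the content of one.
  have hB : NeZero (Fintype.card (Fin R → A)) := ⟨Fintype.card_ne_zero⟩
  have e : (Fin R → A) ≃ ZMod (Fintype.card (Fin R → A)) :=
    Fintype.equivOfCardEq (by rw [ZMod.card])
  exact ⟨⟨R, _, hB, e, β, by omega, fun v b h1 h2 => (hβ v b (by omega) h2).1,
    fun v b h1 h2 => (hβ v b (by omega) h2).2.1, fun v b h1 h2 => (hβ v b (by omega) h2).2.2⟩⟩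

namespace ErosionData

variable {cs : CellSystem X} (D : ErosionData cs)

/-- The length of the gaps that the rule detects. -/
def H : ℕ := cs.m + D.B * D.R

/-- The block number `j`. -/
def blk (x : ℤ → A) (j : ZMod D.B) : Fin D.R → A := fun t => x ((cs.m + j.val * D.R + t : ℕ) : ℤ)

/-- The number of the block to be modified. -/
noncomputable def K (x : ℤ → A) : ZMod D.B :=
  haveI := D.neZero
  ∑ j, D.e (D.blk x j)

/-- The beginning of the block to be modified. -/
noncomputable def start (x : ℤ → A) : ℕ := cs.m + (D.K x).val * D.R

/-- The word put into the core of the block to be modified. -/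
noncomputable def newCore (x : ℤ → A) : List A :=
  D.β (fac x cs.m (D.start x)) (fac x (D.start x + cs.m) (D.R - 2 * cs.m))

open Classical in
/-- The configuration with the core of one block replaced. -/
noncomputable def insertCore (x : ℤ → A) : ℤ → A := fun k =>
  if D.start x + cs.m ≤ k ∧ k + cs.m < D.start x + D.R then
    ((D.newCore x)[(k - (D.start x + cs.m)).toNat]?).getD (x k) else x k

open Classical in
/-- The insertion rule. -/
noncomputable def φ (x : ℤ → A) : ℤ → A :=
  cs.recolor (D.insertCore x)
    (fun i => if 0 < i ∧ i < D.H then (true, true) else cs.val (D.insertCore x) i)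

variable {D}

lemma start_add_le (x : ℤ → A) : D.start x + D.R ≤ D.H := by
  have := D.neZero
  have h : (D.K x).val + 1 ≤ D.B := ZMod.val_lt _
  have := Nat.mul_le_mul_right D.R h
  rw [Nat.add_mul, Nat.one_mul] at this
  unfold start H
  omega

lemma m_le_start (x : ℤ → A) : cs.m ≤ D.start x := by
  unfold start
  omega

lemma insertCore_out {x : ℤ → A} {k : ℤ}
    (h : k < D.start x + cs.m ∨ D.start x + D.R ≤ k + cs.m) : D.insertCore x k = x k := by
  rw [insertCore, if_neg (by omega)]

/-- The word of a gap, up to the end of the core of the block to be modified. -/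
lemma at_gap {x : ℤ → A} (hx : cs.Gap D.H x) :
    At x 0 (cs.c (false, false) ++ fac x cs.m (D.start x) ++
      fac x (D.start x + cs.m) (D.R - 2 * cs.m)) := by
  rw [at_append, at_append]
  refine ⟨⟨hx.2.1, ?_⟩, ?_⟩
  · simpa [cs.length_c] using at_fac x cs.m (D.start x)
  · have := at_fac x (D.start x + cs.m) (D.R - 2 * cs.m)
    simpa [cs.length_c, add_comm] using this

lemma gap_mem {x : ℤ → A} (hx : cs.Gap D.H x) :
    cs.c (false, false) ++ fac x cs.m (D.start x) ++
      fac x (D.start x + cs.m) (D.R - 2 * cs.m) ∈ language X :=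
  mem_language_of_at hx.1 (at_gap hx)

lemma length_core {x : ℤ → A} :
    (fac x (D.start x + cs.m) (D.R - 2 * cs.m)).length + 2 * cs.m = D.R := by
  have := D.lt_R
  rw [length_fac]
  omega

lemma length_newCore {x : ℤ → A} (hx : cs.Gap D.H x) :
    (D.newCore x).length = D.R - 2 * cs.m := by
  rw [newCore, D.length_β _ _ length_core (gap_mem hx), length_fac]

lemma at_newCore {x : ℤ → A} (hx : cs.Gap D.H x) :
    At (D.insertCore x) (D.start x + cs.m) (D.newCore x) := by
  intro k hk
  have hk' := hk
  rw [length_newCore hx] at hk'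
  rw [insertCore, if_pos (by omega)]
  have e : ((D.start x : ℤ) + cs.m + k - (D.start x + cs.m)).toNat = k := by omega
  rw [e, List.getElem?_eq_getElem hk]
  rfl

lemma at_insertCore {x : ℤ → A} (hx : cs.Gap D.H x) :
    At (D.insertCore x) 0 (cs.c (false, false) ++ fac x cs.m (D.start x) ++ D.newCore x) := by
  have h := at_gap hx
  rw [at_append] at h ⊢
  constructor
  · refine h.1.congr fun k hk => insertCore_out (Or.inl ?_)
    simp [cs.length_c] at hk
    omega
  · have := at_newCore hx
    simpa [cs.length_c, add_comm] using this

/-- On the left only the synchronizing cell at the beginning matters, and on the right the new core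
has the same follower set as the old one. -/
lemma replace_iff {x : ℤ → A} (hx : cs.Gap D.H x) (u t : List A) :
    u ++ (cs.c (false, false) ++ fac x cs.m (D.start x) ++ D.newCore x) ++ t ∈ language X ↔
    u ++ (cs.c (false, false) ++ fac x cs.m (D.start x) ++
      fac x (D.start x + cs.m) (D.R - 2 * cs.m)) ++ t ∈ language X := by
  have hiff := D.iff_β _ _ length_core (gap_mem hx) t
  have hs := cs.sync (false, false)
  constructor
  · intro h
    have h1 : u ++ cs.c (false, false) ∈ language X :=
      language_left (w := fac x cs.m (D.start x) ++ D.newCore x ++ t) (by simpa using h)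
    have h2 := hiff.1 (language_right (u := u) (by simpa [newCore] using h))
    have := (hs.mem_iff h1 _).2 (by simpa using h2)
    simpa using this
  · intro h
    have h1 : u ++ cs.c (false, false) ∈ language X :=
      language_left (w := fac x cs.m (D.start x) ++
        fac x (D.start x + cs.m) (D.R - 2 * cs.m) ++ t) (by simpa using h)
    have h2 := hiff.2 (language_right (u := u) (by simpa using h))
    have := (hs.mem_iff h1 _).2 (by simpa using h2)
    simpa [newCore] using this

lemma insertCore_mem {x : ℤ → A} (hx : cs.Gap D.H x) : D.insertCore x ∈ X.carrier := by
  have hl := length_newCore hx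
  have hR := D.lt_R
  refine mem_of_replace hx.1 (at_gap hx) (at_insertCore hx) (by simp [hl]) (fun k hk => ?_)
    fun u t h => (replace_iff hx u t).2 h
  simp [cs.length_c] at hk
  exact insertCore_out (by omega)

/-- A cell disjoint from the new core would be a cell of `x` inside its gap. The core has margins of
length `m` in its block, so a cell that meets it stays strictly inside the block. -/
lemma cell_insertCore {x : ℤ → A} (hx : cs.Gap D.H x) {i : ℤ} (h0 : 0 < i) (hH : i < D.H)
    (hi : cs.IsCell (D.insertCore x) i) : D.start x < i ∧ i + cs.m < D.start x + D.R := by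
  by_contra hcon
  refine hx.2.2 i h0 hH ⟨_, hi.at.congr fun k hk => (insertCore_out ?_).symm⟩
  rw [cs.length_c] at hk
  omega

lemma exists_cell_insertCore {x : ℤ → A} (hx : cs.Gap D.H x) :
    ∃ i : ℤ, 0 < i ∧ i < D.H ∧ cs.IsCell (D.insertCore x) i := by
  obtain ⟨g, h, hgh⟩ := D.exists_β _ _ length_core (gap_mem hx)
  have h1 := at_newCore hx
  have hl := length_newCore hx
  rw [newCore] at h1 hl
  rw [hgh, at_append, at_append] at h1
  rw [hgh] at hl
  simp [cs.length_c] at hl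
  have h2 := start_add_le (D := D) x
  have h3 := cs.p_pos
  have h4 := cs.p_le
  have h5 := D.lt_R
  exact ⟨_, by omega, by omega, ⟨_, h1.1.2⟩⟩

lemma isCell_φ {x : ℤ → A} {i : ℤ} : cs.IsCell (D.φ x) i ↔ cs.IsCell (D.insertCore x) i :=
  isCell_recolor

lemma φ_out {x : ℤ → A} (hx : cs.Gap D.H x) {k : ℤ} (hk : k ≤ D.start x ∨ D.start x + D.R ≤ k) :
    D.φ x k = x k := by
  have hpm := cs.p_le
  have hp := cs.p_pos
  rw [φ, recolor_eq_self_at, insertCore_out (by omega)]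
  intro i hi h1 h2
  by_cases h : 0 < i ∧ i < D.H
  · have := cell_insertCore hx h.1 h.2 hi
    omega
  · rw [if_neg h]

lemma val_φ {x : ℤ → A} {i : ℤ} (h0 : 0 < i) (hH : i < D.H) (hi : cs.IsCell (D.φ x) i) :
    cs.val (D.φ x) i = (true, true) := by
  have := val_recolor (cs := cs) (fun i => if 0 < i ∧ i < (D.H : ℤ) then (true, true)
    else cs.val (D.insertCore x) i) (isCell_φ.1 hi)
  rw [φ, this, if_pos ⟨h0, hH⟩]

lemma blk_congr {x y : ℤ → A} {j : ZMod D.B}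
    (h : EqWin x y (cs.m + j.val * D.R) (cs.m + j.val * D.R + D.R)) : D.blk x j = D.blk y j := by
  funext t
  exact h _ (by push_cast; omega) (by push_cast; omega)

lemma mul_R_le (j : ZMod D.B) : j.val * D.R + D.R ≤ D.B * D.R := by
  have := D.neZero
  have h : j.val + 1 ≤ D.B := ZMod.val_lt _
  have := Nat.mul_le_mul_right D.R h
  rwa [Nat.add_mul, Nat.one_mul] at this

lemma eq_of_mem_block {a b R : ℕ} {t : ℤ} (h1 : (a : ℤ) * R ≤ t) (h2 : t < a * R + R)
    (h3 : (b : ℤ) * R ≤ t) (h4 : t < b * R + R) : a = b := by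
  by_contra hab
  rcases Nat.lt_or_gt_of_ne hab with h | h
  · have h5 : (a + 1 : ℤ) ≤ b := by exact_mod_cast h
    nlinarith [Int.natCast_nonneg R]
  · have h5 : (b + 1 : ℤ) ≤ a := by exact_mod_cast h
    nlinarith [Int.natCast_nonneg R]

lemma H_cast : (D.H : ℤ) = cs.m + D.B * D.R := by
  simp [H]

lemma start_cast (x : ℤ → A) : (D.start x : ℤ) = cs.m + (D.K x).val * D.R := by
  simp [start]

lemma K_congr {x y : ℤ → A} (h : EqWin x y 0 (D.H + cs.m)) : D.K x = D.K y := by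
  have := D.neZero
  refine Finset.sum_congr rfl fun j _ => ?_
  rw [blk_congr (h.mono (by positivity) ?_)]
  have := mul_R_le (D := D) j
  zify at this
  rw [H_cast]
  omega

lemma insertCore_congr {x y : ℤ → A} (h : EqWin x y 0 (D.H + cs.m)) :
    EqWin (D.insertCore x) (D.insertCore y) 0 (D.H + cs.m) := by
  have hs : D.start x = D.start y := by rw [start, start, K_congr h]
  have hle := start_add_le (D := D) x
  have hR := D.lt_R
  have hn : D.newCore x = D.newCore y := by
    rw [newCore, newCore, ← hs]
    congr 1
    · exact fac_congr fun k hk => h _ (by omega) (by omega)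
    · exact fac_congr fun k hk => h _ (by omega) (by omega)
  intro k h1 h2
  rw [insertCore, insertCore, hs, hn, h k h1 h2]

lemma φ_local {x y : ℤ → A} (h : EqWin x y 0 (D.H + cs.m)) : EqWin (D.φ x) (D.φ y) cs.m D.H := by
  intro k h1 h2
  have := cs.p_le
  refine recolor_local ((insertCore_congr h).mono (by omega) (by omega)) fun i hi h3 h4 => ?_
  rw [if_pos (by omega), if_pos (by omega)]

/-- An inserted cell shows which block was modified, that is, the sum `K` of all block numbers. The
other blocks are intact, so subtracting their numbers from `K` gives the number of the lost block.
-/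
lemma φ_injective {x y : ℤ → A} (hx : cs.Gap D.H x) (hy : cs.Gap D.H y)
    (h : EqWin (D.φ x) (D.φ y) 0 (D.H + cs.m)) : EqWin x y cs.m D.H := by
  have := D.neZero
  obtain ⟨i, h0, hH, hi⟩ := exists_cell_insertCore hx
  have hi' : cs.IsCell (D.insertCore y) i :=
    isCell_φ.1 ((isCell_congr h (by omega) (by omega)).1 (isCell_φ.2 hi))
  have h1 := cell_insertCore hx h0 hH hi
  have h2 := cell_insertCore hy h0 hH hi'
  have hK : D.K x = D.K y := by
    apply ZMod.val_injective
    rw [start_cast] at h1 h2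
    exact eq_of_mem_block (t := i - cs.m) (R := D.R) (by omega) (by omega) (by omega) (by omega)
  have hs : D.start x = D.start y := by rw [start, start, hK]
  have hle := start_add_le (D := D) x
  have hout : ∀ k : ℤ, cs.m ≤ k → k < D.H → (k ≤ D.start x ∨ D.start x + D.R ≤ k) → x k = y k := by
    intro k hk1 hk2 hk3
    rw [← φ_out hx hk3, ← φ_out hy (hs ▸ hk3)]
    exact h k (by omega) (by omega)
  have hblk : D.blk x (D.K x) = D.blk y (D.K x) := by
    apply D.e.injective
    have e1 := Finset.add_sum_erase Finset.univ (fun j => D.e (D.blk x j)) (Finset.mem_univ (D.K x))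
    have e2 := Finset.add_sum_erase Finset.univ (fun j => D.e (D.blk y j)) (Finset.mem_univ (D.K x))
    have e3 : ∑ j ∈ Finset.univ.erase (D.K x), D.e (D.blk x j) =
        ∑ j ∈ Finset.univ.erase (D.K x), D.e (D.blk y j) := by
      refine Finset.sum_congr rfl fun j hj => ?_
      rw [blk_congr (x := x) (y := y)]
      intro k hk1 hk2
      have h3 := mul_R_le (D := D) j
      zify at h3
      have h4 : (0 : ℤ) ≤ j.val * D.R := by positivity
      refine hout k (by omega) (by rw [H_cast]; omega) ?_
      by_contra hcon
      refine (Finset.mem_erase.1 hj).1 (ZMod.val_injective _ ?_)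
      rw [start_cast] at hcon
      exact eq_of_mem_block (t := k - cs.m) (R := D.R) (by omega) (by omega) (by omega) (by omega)
    have e4 : ∑ j, D.e (D.blk x j) = ∑ j, D.e (D.blk y j) := hK
    rw [← e1, ← e2, e3] at e4
    exact add_right_cancel e4
  intro k hk1 hk2
  by_cases hk : k ≤ D.start x ∨ D.start x + D.R ≤ k
  · exact hout k hk1 hk2 hk
  · have := congrFun hblk ⟨(k - D.start x).toNat, by omega⟩
    simp only [blk] at this
    have e : ((cs.m + (D.K x).val * D.R + (k - D.start x).toNat : ℕ) : ℤ) = k := by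
      have := start_cast (D := D) x
      push_cast
      rw [Int.toNat_of_nonneg (by omega)]
      omega
    rwa [e] at this

/-- Give the cells of `y` inside the gap the bits they had before they were filled; the result
agrees with `insertCore x` on the window. The old core can then replace the new one because both
have the same contexts. -/
lemma φ_back {x y z : ℤ → A} (hx : cs.Gap D.H x) (hy : y ∈ X.carrier)
    (h : EqWin y (D.φ x) 0 (D.H + cs.m)) (hz : EqWin z x cs.m D.H)
    (hzy : ∀ k : ℤ, (k < cs.m ∨ D.H ≤ k) → z k = y k) : z ∈ X.carrier := by
  classical
  have hp := cs.p_pos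
  have hpm := cs.p_le
  have hle := start_add_le (D := D) x
  have hR := D.lt_R
  have hms := m_le_start (D := D) x
  set f : ℤ → Bool × Bool :=
    fun i => if 0 < i ∧ i < (D.H : ℤ) then cs.val (D.insertCore x) i else cs.val y i with hf
  have hfy : ∀ k : ℤ, (k < cs.m ∨ D.H ≤ k) → cs.recolor y f k = y k := by
    intro k hk
    refine recolor_eq_self_at fun i hi h1 h2 => ?_
    by_cases h3 : 0 < i ∧ i < D.H
    · have h4 : cs.IsCell (D.insertCore x) i :=
        isCell_φ.1 ((isCell_congr h (by omega) (by omega)).1 hi)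
      have := cell_insertCore hx h3.1 h3.2 h4
      omega
    · rw [hf]
      simp only [if_neg h3]
  have hx1 : cs.recolor (D.φ x) (cs.val (D.insertCore x)) = D.insertCore x := by
    rw [φ, recolor_recolor, recolor_val]
  have hfx : EqWin (cs.recolor y f) (D.insertCore x) 0 (D.H + cs.m) := by
    intro k h1 h2
    by_cases hk : k < cs.m ∨ D.H ≤ k
    · rw [hfy k hk, h k h1 h2, φ_out hx (by omega), insertCore_out (by omega)]
    · rw [← hx1]
      refine recolor_local (h.mono (by omega) (by omega)) fun i _ h3 h4 => ?_
      rw [hf]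
      simp only
      rw [if_pos (by omega)]
  have hzx : ∀ k : ℤ, 0 ≤ k → k < D.H → z k = x k := by
    intro k h1 h2
    by_cases hk : k < cs.m
    · rw [hzy k (Or.inl hk), h k h1 (by omega), φ_out hx (by omega)]
    · exact hz k (by omega) h2
  have hl := length_newCore hx
  refine mem_of_replace (x := cs.recolor y f) (recolor_mem hy f) (i := 0) ?_ ?_ ?_ ?_
    fun u t => (replace_iff hx u t).1
  · refine hfx.symm.at (at_insertCore hx) le_rfl ?_
    simp [cs.length_c, hl]
    omega
  · refine (at_gap hx).congr fun k hk => hzx _ (by omega) ?_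
    simp [cs.length_c] at hk
    omega
  · simp [hl]
  · intro k hk
    simp [cs.length_c, hl] at hk
    by_cases h3 : k < cs.m ∨ D.H ≤ k
    · rw [hzy k h3, hfy k h3]
    · rw [hzx k (by omega) (by omega), hfx k (by omega) (by omega), insertCore_out (by omega)]

variable (D) in
/-- The erosion rule constructed from the data. -/
noncomputable def erosion : Erosion cs where
  H := D.H
  φ := D.φ
  p_lt := by
    have := D.neZero
    have h1 := start_add_le (D := D) cs.belt.choose
    have := D.lt_R
    have := cs.p_le
    omega
  mem := fun hx => recolor_mem (insertCore_mem hx) _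
  out := fun {x} hx k hk => φ_out hx (by
    have := m_le_start (D := D) x
    have := start_add_le (D := D) x
    omega)
  inner := fun _ i h0 hH hi => val_φ h0 hH hi
  exists_inner := fun hx => by
    obtain ⟨i, h0, hH, hi⟩ := exists_cell_insertCore hx
    exact ⟨i, h0, hH, isCell_φ.2 hi⟩
  loc := fun _ _ h => φ_local h
  inj := φ_injective
  back := φ_back

end ErosionData

end CellSystem

/-! ### The involution exchanging gaps and filled gaps -/

namespace CellSystem

variable {A : Type*} [TopologicalSpace A] {X : Subshift A ℤ}

theorem exists_erosion [Finite A] (cs : CellSystem X) (hne : X.carrier.Nonempty)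
    (ht : IsTransitive X) (hs : IsSofic X) : Nonempty (Erosion cs) :=
  (exists_erosionData cs hne ht hs).map ErosionData.erosion

lemma Gap.congr {cs : CellSystem X} {H : ℕ} {x y : ℤ → A} (hx : cs.Gap H x)
    (hy : y ∈ X.carrier) (h : EqWin x y 0 (H + cs.m)) : cs.Gap H y := by
  refine ⟨hy, h.at hx.2.1 le_rfl (by simp [cs.length_c]), fun i h0 hH hi => ?_⟩
  exact hx.2.2 i h0 hH ((isCell_congr h (by omega) (by omega)).2 hi)

namespace Erosion

variable {cs : CellSystem X} (E : Erosion cs)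

/-- The window at `0` is that of a gap or that of a freshly filled gap. -/
def Active (x : ℤ → A) : Prop := cs.Gap E.H x ∨ ∃ z, cs.Gap E.H z ∧ E.φ z = x

open Classical in
/-- Exchange of the gaps and of the freshly filled gaps, at `0`. -/
noncomputable def ψ (x : ℤ → A) : ℤ → A :=
  if cs.Gap E.H x then E.φ x else if h : ∃ z, cs.Gap E.H z ∧ E.φ z = x then h.choose else x

variable {E}

lemma not_gap_φ {x : ℤ → A} (hx : cs.Gap E.H x) : ¬ cs.Gap E.H (E.φ x) := fun h => by
  obtain ⟨i, h0, hH, hi⟩ := E.exists_inner hx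
  exact h.2.2 i h0 hH hi

lemma φ_inj {x y : ℤ → A} (hx : cs.Gap E.H x) (hy : cs.Gap E.H y) (h : E.φ x = E.φ y) :
    x = y := by
  funext k
  by_cases hk : k < cs.m ∨ E.H ≤ k
  · rw [← E.out hx k hk, ← E.out hy k hk, h]
  · exact E.inj hx hy (fun k _ _ => congrFun h k) k (by omega) (by omega)

lemma ψ_of_gap {x : ℤ → A} (hx : cs.Gap E.H x) : E.ψ x = E.φ x := if_pos hx

lemma ψ_φ {x : ℤ → A} (hx : cs.Gap E.H x) : E.ψ (E.φ x) = x := by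
  have hex : ∃ z, cs.Gap E.H z ∧ E.φ z = E.φ x := ⟨x, hx, rfl⟩
  rw [ψ, if_neg (not_gap_φ hx), dif_pos hex]
  exact φ_inj hex.choose_spec.1 hx hex.choose_spec.2

lemma Active.mem {x : ℤ → A} (hx : E.Active x) : x ∈ X.carrier := by
  rcases hx with hx | ⟨z, hz, rfl⟩
  · exact hx.1
  · exact E.mem hz

lemma Active.ψ_ψ {x : ℤ → A} (hx : E.Active x) : E.ψ (E.ψ x) = x := by
  rcases hx with hx | ⟨z, hz, rfl⟩
  · rw [ψ_of_gap hx, ψ_φ hx]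
  · rw [ψ_φ hz, ψ_of_gap hz]

lemma Active.ψ {x : ℤ → A} (hx : E.Active x) : E.Active (E.ψ x) := by
  rcases hx with hx | ⟨z, hz, rfl⟩
  · rw [ψ_of_gap hx]
    exact Or.inr ⟨x, hx, rfl⟩
  · rw [ψ_φ hz]
    exact Or.inl hz

lemma Active.ψ_out {x : ℤ → A} (hx : E.Active x) {k : ℤ} (hk : k < cs.m ∨ E.H ≤ k) :
    E.ψ x k = x k := by
  rcases hx with hx | ⟨z, hz, rfl⟩
  · rw [ψ_of_gap hx, E.out hx k hk]
  · rw [ψ_φ hz, E.out hz k hk]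

lemma Active.at_zero {x : ℤ → A} (hx : E.Active x) : At x 0 (cs.c (false, false)) := by
  rcases hx with hx | ⟨z, hz, rfl⟩
  · exact hx.2.1
  · refine hz.2.1.congr fun k hk => E.out hz _ (Or.inl ?_)
    rw [cs.length_c] at hk
    omega

lemma Active.inner {x : ℤ → A} (hx : E.Active x) {i : ℤ} (h0 : 0 < i) (hH : i < E.H)
    (hi : cs.IsCell x i) : cs.val x i = (true, true) := by
  rcases hx with hx | ⟨z, hz, rfl⟩
  · exact absurd hi (hx.2.2 i h0 hH)
  · exact E.inner hz i h0 hH hi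

/-- For a filled gap a preimage is needed in the new surroundings. It is `w`, which is `z` inside
the gap and `y` elsewhere, and `back` places it in `X`. -/
lemma Active.congr {x y : ℤ → A} (hx : E.Active x) (hy : y ∈ X.carrier)
    (h : EqWin x y 0 (E.H + cs.m)) :
    E.Active y ∧ EqWin (E.ψ x) (E.ψ y) 0 (E.H + cs.m) := by
  classical
  rcases hx with hx | ⟨z, hz, rfl⟩
  · have hy' := hx.congr hy h
    refine ⟨Or.inl hy', fun k h1 h2 => ?_⟩
    rw [ψ_of_gap hx, ψ_of_gap hy']
    by_cases hk : k < cs.m ∨ E.H ≤ k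
    · rw [E.out hx k hk, E.out hy' k hk, h k h1 h2]
    · exact E.loc hx hy' h k (by omega) (by omega)
  · set w : ℤ → A := fun k => if cs.m ≤ k ∧ k < E.H then z k else y k with hw
    have hw1 : ∀ k : ℤ, (k < cs.m ∨ E.H ≤ k) → w k = y k := fun k hk => if_neg (by omega)
    have hw2 : EqWin w z cs.m E.H := fun k h1 h2 => if_pos ⟨h1, h2⟩
    have hwX : w ∈ X.carrier := E.back hz hy h.symm hw2 hw1
    have hzw : EqWin z w 0 (E.H + cs.m) := by
      intro k h1 h2
      by_cases hk : k < cs.m ∨ E.H ≤ k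
      · rw [hw1 k hk, ← h k h1 h2, E.out hz k hk]
      · exact (hw2 k (by omega) (by omega)).symm
    have hwG := hz.congr hwX hzw
    have hwy : E.φ w = y := by
      funext k
      by_cases hk : k < cs.m ∨ E.H ≤ k
      · rw [E.out hwG k hk, hw1 k hk]
      · rw [← h k (by omega) (by omega)]
        exact (E.loc hz hwG hzw k (by omega) (by omega)).symm
    refine ⟨Or.inr ⟨w, hwG, hwy⟩, ?_⟩
    rw [ψ_φ hz, ← hwy, ψ_φ hwG]
    exact hzw

variable (E)

/-- `i` is an active site of `x`. -/
def Site (x : ℤ → A) (i : ℤ) : Prop := E.Active (shift i x)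

open Classical in
/-- Exchange of the gaps and of the freshly filled gaps, at the active sites in `I`. -/
noncomputable def swapOn (I : Set ℤ) (x : ℤ → A) : ℤ → A := fun k =>
  if h : ∃ i, i ∈ I ∧ E.Site x i ∧ i + cs.m ≤ k ∧ k < i + E.H then
    E.ψ (shift h.choose x) (k - h.choose) else x k

variable {E}

lemma Site.at {x : ℤ → A} {i : ℤ} (h : E.Site x i) : At x i (cs.c (false, false)) := by
  have := h.at_zero
  rwa [at_shift, add_zero] at this

lemma Site.inner {x : ℤ → A} {i j : ℤ} (h : E.Site x i) (h0 : i < j) (hH : j < i + E.H)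
    (hj : cs.IsCell x j) : cs.val x j = (true, true) := by
  have := Active.inner h (i := j - i) (by omega) (by omega) (isCell_shift.2 (by simpa using hj))
  rw [val_shift] at this
  simpa using this

/-- A site carries an empty cell, whereas the cells met within `H` after a site are full. -/
lemma Site.sep {x : ℤ → A} {i j : ℤ} (hi : E.Site x i) (hj : E.Site x j) (hij : i < j) :
    i + E.H ≤ j := by
  by_contra h
  have h1 := hi.inner hij (by omega) ⟨_, hj.at⟩
  rw [val_eq hj.at] at h1
  simp at h1

lemma Site.eq {x : ℤ → A} {i j : ℤ} (hi : E.Site x i) (hj : E.Site x j)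
    (h1 : i < j + E.H) (h2 : j < i + E.H) : i = j := by
  rcases lt_trichotomy i j with h | h | h
  · have := hi.sep hj h
    omega
  · exact h
  · have := hj.sep hi h
    omega

lemma swapOn_apply {I : Set ℤ} {x : ℤ → A} {i k : ℤ} (hI : i ∈ I) (hi : E.Site x i)
    (h1 : i + cs.m ≤ k) (h2 : k < i + E.H) : E.swapOn I x k = E.ψ (shift i x) (k - i) := by
  have hex : ∃ i, i ∈ I ∧ E.Site x i ∧ i + cs.m ≤ k ∧ k < i + E.H := ⟨i, hI, hi, h1, h2⟩
  obtain ⟨-, g2, g3, g4⟩ := hex.choose_spec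
  have hch : hex.choose = i := g2.eq hi (by omega) (by omega)
  rw [swapOn, dif_pos hex, hch]

lemma swapOn_of_not {I : Set ℤ} {x : ℤ → A} {k : ℤ}
    (h : ∀ i ∈ I, E.Site x i → i + cs.m ≤ k → i + E.H ≤ k) : E.swapOn I x k = x k := by
  rw [swapOn, dif_neg]
  rintro ⟨i, hI, hi, h1, h2⟩
  have := h i hI hi h1
  omega

/-- The windows of different sites share at most the `m` letters of the cell at the later site,
which no swap modifies. -/
lemma swapOn_window {I : Set ℤ} {x : ℤ → A} {i : ℤ} (hI : i ∈ I) (hi : E.Site x i) {k : ℤ}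
    (h1 : i ≤ k) (h2 : k < i + (E.H + cs.m)) : E.swapOn I x k = E.ψ (shift i x) (k - i) := by
  by_cases hk : i + cs.m ≤ k ∧ k < i + E.H
  · exact swapOn_apply hI hi hk.1 hk.2
  · rw [Active.ψ_out hi (by omega), shift_apply, add_sub_cancel, swapOn_of_not]
    intro j _ hj h3
    by_contra h4
    have := hi.eq hj (by omega) (by omega)
    omega

lemma swapOn_window_not {I : Set ℤ} {x : ℤ → A} {i : ℤ} (hI : i ∉ I) (hi : E.Site x i) {k : ℤ}
    (h1 : i ≤ k) (h2 : k < i + (E.H + cs.m)) : E.swapOn I x k = x k := by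
  refine swapOn_of_not fun j hjI hj h3 => ?_
  by_contra h4
  have := hi.eq hj (by omega) (by omega)
  exact hI (this ▸ hjI)

lemma swapOn_congr {I J : Set ℤ} {x : ℤ → A} {k : ℤ}
    (h : ∀ i, i + cs.m ≤ k → k < i + E.H → (i ∈ I ↔ i ∈ J)) :
    E.swapOn I x k = E.swapOn J x k := by
  by_cases hex : ∃ i, i ∈ I ∧ E.Site x i ∧ i + cs.m ≤ k ∧ k < i + E.H
  · obtain ⟨i, hI, hi, h1, h2⟩ := hex
    rw [swapOn_apply hI hi h1 h2, swapOn_apply ((h i h1 h2).1 hI) hi h1 h2]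
  · rw [swapOn_of_not, swapOn_of_not]
    · intro i hJ hi h1
      by_contra h2
      exact hex ⟨i, (h i h1 (by omega)).2 hJ, hi, h1, by omega⟩
    · intro i hI hi h1
      by_contra h2
      exact hex ⟨i, hI, hi, h1, by omega⟩

lemma shift_mem {x : ℤ → A} (hx : x ∈ X.carrier) (s : ℤ) : shift s x ∈ X.carrier := X.mapsTo s hx

/-- Swap one site after the other: swaps at other sites leave the window of `j` intact, so `j` is
still active when its turn comes. Closedness of `X` covers infinite sets. -/
lemma swapOn_mem {x : ℤ → A} (hx : x ∈ X.carrier) (I : Set ℤ) : E.swapOn I x ∈ X.carrier := by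
  classical
  have hfin : ∀ J : Finset ℤ, E.swapOn (J : Set ℤ) x ∈ X.carrier := by
    intro J
    induction J using Finset.induction_on with
    | empty =>
      have : E.swapOn ((∅ : Finset ℤ) : Set ℤ) x = x := funext fun k => swapOn_of_not (by simp)
      rwa [this]
    | insert j J hj ih =>
      by_cases hs : E.Site x j
      · have hact := Active.congr hs (shift_mem ih j) fun k h1 h2 =>
          (swapOn_window_not (I := (J : Set ℤ)) (by simpa using hj) hs (k := j + k)
            (by omega) (by omega)).symm
        have heq : E.swapOn ((insert j J : Finset ℤ) : Set ℤ) x =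
            shift (-j) (E.ψ (shift j (E.swapOn (J : Set ℤ) x))) := by
          funext k
          rw [shift_apply]
          by_cases hk : j + cs.m ≤ k ∧ k < j + E.H
          · rw [swapOn_apply (by simp) hs hk.1 hk.2,
              hact.2 (k - j) (by omega) (by omega), neg_add_eq_sub]
          · rw [hact.1.ψ_out (by omega), shift_apply, add_neg_cancel_left]
            refine swapOn_congr fun i h1 h2 => ?_
            have hij : i ≠ j := by
              rintro rfl
              exact hk ⟨h1, h2⟩
            simp [hij]
        rw [heq]
        exact shift_mem hact.1.ψ.mem _
      · convert ih using 1
        funext k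
        by_cases hk : j + cs.m ≤ k ∧ k < j + E.H
        · by_cases hex : ∃ i, i ∈ J ∧ E.Site x i ∧ i + cs.m ≤ k ∧ k < i + E.H
          · obtain ⟨i, hI, hi, h1, h2⟩ := hex
            rw [swapOn_apply (by simp [hI]) hi h1 h2, swapOn_apply (by simpa using hI) hi h1 h2]
          · rw [swapOn_of_not, swapOn_of_not]
            · intro i hJ hi h1
              by_contra h2
              exact hex ⟨i, hJ, hi, h1, by omega⟩
            · intro i hJ hi h1
              by_contra h2
              have hij : i ≠ j := by
                rintro rfl
                exact hs hi
              exact hex ⟨i, by simpa [hij] using hJ, hi, h1, by omega⟩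
        · refine swapOn_congr fun i h1 h2 => ?_
          have hij : i ≠ j := by
            rintro rfl
            exact hk ⟨h1, h2⟩
          simp [hij]
  refine mem_of_agree fun N => ?_
  refine ⟨_, hfin ((Finset.Icc (-(N : ℤ) - E.H) N).filter (· ∈ I)), fun k h1 h2 => ?_⟩
  refine swapOn_congr fun i h3 h4 => ?_
  simp only [Finset.coe_filter, Finset.mem_Icc, Set.mem_ofPred_eq]
  exact ⟨fun h => h.2, fun h => ⟨by omega, h⟩⟩

variable (E) in
/-- The swap at all active sites. -/
noncomputable def swap (x : ℤ → A) : ℤ → A := E.swapOn Set.univ x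

lemma swap_mem {x : ℤ → A} (hx : x ∈ X.carrier) : E.swap x ∈ X.carrier := swapOn_mem hx _

lemma swap_window {x : ℤ → A} {i : ℤ} (hi : E.Site x i) {k : ℤ}
    (h1 : i ≤ k) (h2 : k < i + (E.H + cs.m)) : E.swap x k = E.ψ (shift i x) (k - i) :=
  swapOn_window (Set.mem_univ _) hi h1 h2

lemma swap_of_not {x : ℤ → A} {k : ℤ}
    (h : ∀ i, E.Site x i → i + cs.m ≤ k → i + E.H ≤ k) : E.swap x k = x k :=
  swapOn_of_not fun i _ => h i

lemma Site.eqWin_swap {x : ℤ → A} {i : ℤ} (hi : E.Site x i) :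
    EqWin (E.ψ (shift i x)) (shift i (E.swap x)) 0 (E.H + cs.m) := fun k h1 h2 => by
  rw [shift_apply, swap_window hi (by omega) (by omega), add_sub_cancel_left]

lemma Site.swap {x : ℤ → A} (hx : x ∈ X.carrier) {i : ℤ} (hi : E.Site x i) :
    E.Site (E.swap x) i ∧
      EqWin (E.ψ (E.ψ (shift i x))) (E.ψ (shift i (E.swap x))) 0 (E.H + cs.m) :=
  Active.congr (Active.ψ hi) (shift_mem (swap_mem hx) i) hi.eqWin_swap

/-- Old sites stay sites, so a new one would be at distance at least `H` from all of them. No swap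
would have touched its window, and it would have been a site before. -/
lemma site_swap_iff {x : ℤ → A} (hx : x ∈ X.carrier) {i : ℤ} :
    E.Site (E.swap x) i ↔ E.Site x i := by
  refine ⟨fun h => ?_, fun h => (h.swap hx).1⟩
  by_contra hi
  refine hi (Active.congr h (shift_mem hx i) fun k h1 h2 => ?_).1
  rw [shift_apply, shift_apply]
  refine swap_of_not fun j hj h3 => ?_
  by_contra h4
  have := h.eq (hj.swap hx).1 (by omega) (by omega)
  exact hi (this ▸ hj)

theorem swap_swap {x : ℤ → A} (hx : x ∈ X.carrier) : E.swap (E.swap x) = x := by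
  funext k
  by_cases hex : ∃ i, E.Site x i ∧ i + cs.m ≤ k ∧ k < i + E.H
  · obtain ⟨i, hi, h1, h2⟩ := hex
    have := hi.swap hx
    rw [swap_window this.1 (by omega) (by omega), ← this.2 (k - i) (by omega) (by omega),
      Active.ψ_ψ hi, shift_apply, add_sub_cancel]
  · have h : ∀ i, E.Site x i → i + cs.m ≤ k → i + E.H ≤ k := fun i hi h1 => by
      by_contra h2
      exact hex ⟨i, hi, h1, by omega⟩
    rw [swap_of_not fun i hi => h i ((site_swap_iff hx).1 hi), swap_of_not h]

lemma site_shift {x : ℤ → A} {s i : ℤ} : E.Site (shift s x) i ↔ E.Site x (s + i) := by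
  rw [Site, Site, shift_add]

lemma swap_shift (x : ℤ → A) (s : ℤ) : E.swap (shift s x) = shift s (E.swap x) := by
  funext k
  rw [shift_apply]
  by_cases hex : ∃ i, E.Site x i ∧ i + cs.m ≤ s + k ∧ s + k < i + E.H
  · obtain ⟨i, hi, h1, h2⟩ := hex
    have hi' : E.Site (shift s x) (i - s) := site_shift.2 (by simpa using hi)
    rw [swap_window hi (by omega) (by omega), swap_window hi' (by omega) (by omega),
      ← shift_add, add_sub_cancel]
    congr 1
    ring
  · have h : ∀ i, E.Site x i → i + cs.m ≤ s + k → i + E.H ≤ s + k := fun i hi h1 => by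
      by_contra h2
      exact hex ⟨i, hi, h1, by omega⟩
    rw [swap_of_not h, swap_of_not, shift_apply]
    intro i hi h1
    have := h _ (site_shift.1 hi) (by omega)
    omega

lemma swap_local {x y : ℤ → A} (hx : x ∈ X.carrier) (hy : y ∈ X.carrier) {k : ℤ}
    (h : EqWin x y (k - E.H) (k + E.H + cs.m)) : E.swap x k = E.swap y k := by
  have hs : ∀ {x y : ℤ → A}, y ∈ X.carrier → EqWin x y (k - E.H) (k + E.H + cs.m) →
      ∀ i, E.Site x i → i + cs.m ≤ k → k < i + E.H →
        E.Site y i ∧ EqWin (E.ψ (shift i x)) (E.ψ (shift i y)) 0 (E.H + cs.m) :=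
    fun hy h i hi h1 h2 => Active.congr hi (shift_mem hy i) fun j h3 h4 =>
      h _ (by omega) (by omega)
  by_cases hex : ∃ i, E.Site x i ∧ i + cs.m ≤ k ∧ k < i + E.H
  · obtain ⟨i, hi, h1, h2⟩ := hex
    obtain ⟨h3, h4⟩ := hs hy h i hi h1 h2
    rw [swap_window hi (by omega) (by omega), swap_window h3 (by omega) (by omega)]
    exact h4 _ (by omega) (by omega)
  · have hn : ∀ i, E.Site x i → i + cs.m ≤ k → i + E.H ≤ k := fun i hi h1 => by
      by_contra h2
      exact hex ⟨i, hi, h1, by omega⟩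
    have hp := cs.p_pos
    have hpm := cs.p_le
    rw [swap_of_not hn, swap_of_not fun i hi h1 => ?_]
    · exact h k (by omega) (by omega)
    · by_contra h2
      exact h2 (hn i (hs hx h.symm i hi h1 (by omega)).1 h1)

end Erosion

end CellSystem

/-! ### The conveyor belt and the automaton -/

section Local

variable {A : Type*} [TopologicalSpace A] {X : Subshift A ℤ}

/-- A shift-commuting map that is determined locally is a cellular automaton. -/
lemma isCellularAutomaton_of_local (G : (ℤ → A) → ℤ → A) (hG : ∀ x ∈ X.carrier, G x ∈ X.carrier)
    (hshift : ∀ x s, G (shift s x) = shift s (G x)) (r : ℕ)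
    (hloc : ∀ x ∈ X.carrier, ∀ y ∈ X.carrier, EqWin x y (-r) (r + 1) → G x 0 = G y 0) :
    IsCellularAutomaton (X := X) fun x => ⟨G x, hG x x.2⟩ := by
  classical
  refine ⟨-r, r, by omega, fun u => if h : ∃ x ∈ X.carrier,
    ∀ j : Set.Icc (-(r : ℤ)) r, x j = u j then G h.choose 0
    -- Patterns that no point of `X` shows get an arbitrary value.
    else u ⟨0, by simp⟩, fun x i => ?_⟩
  have hex : ∃ y ∈ X.carrier, ∀ j : Set.Icc (-(r : ℤ)) r,
      y j = (fun j : Set.Icc (-(r : ℤ)) r => (x : ℤ → A) (i + j)) j :=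
    ⟨shift i x, X.mapsTo i x.2, fun j => rfl⟩
  refine Eq.trans ?_ (dif_pos hex).symm
  have h1 : G x i = G (shift i x) 0 := by rw [hshift, shift_apply, add_zero]
  refine h1.trans (hloc _ (X.mapsTo i x.2) _ hex.choose_spec.1 fun k h2 h3 => ?_)
  exact (hex.choose_spec.2 ⟨k, by simp; omega⟩).symm

end Local

namespace CellSystem

namespace Erosion

variable {A : Type*} [TopologicalSpace A] {X : Subshift A ℤ} {cs : CellSystem X} (E : Erosion cs)

/-- `i` and `j` are positions of consecutive cells of `x` at distance less than `H`. -/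
def Adj (x : ℤ → A) (i j : ℤ) : Prop :=
  cs.IsCell x i ∧ cs.IsCell x j ∧ i < j ∧ j < i + E.H ∧ ∀ k, i < k → k < j → ¬ cs.IsCell x k

open Classical in
/-- The bits of the cell at `i` after a step of the conveyor belt: first bits move to the left,
second bits to the right, and bits are reflected at gaps. -/
noncomputable def moveVal (x : ℤ → A) (i : ℤ) : Bool × Bool :=
  (if h : ∃ j, E.Adj x i j then (cs.val x h.choose).1 else (cs.val x i).2,
    if h : ∃ j, E.Adj x j i then (cs.val x h.choose).2 else (cs.val x i).1)

open Classical in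
/-- The bits of the cell at `i` before a step of the conveyor belt. -/
noncomputable def unmoveVal (x : ℤ → A) (i : ℤ) : Bool × Bool :=
  (if h : ∃ j, E.Adj x j i then (cs.val x h.choose).1 else (cs.val x i).2,
    if h : ∃ j, E.Adj x i j then (cs.val x h.choose).2 else (cs.val x i).1)

/-- A step of the conveyor belt. -/
noncomputable def move (x : ℤ → A) : ℤ → A := cs.recolor x (E.moveVal x)

/-- A backward step of the conveyor belt. -/
noncomputable def unmove (x : ℤ → A) : ℤ → A := cs.recolor x (E.unmoveVal x)

variable {E}

lemma Adj.right_unique {x : ℤ → A} {i j k : ℤ} (h : E.Adj x i j) (h' : E.Adj x i k) : j = k := by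
  rcases lt_trichotomy j k with hjk | hjk | hjk
  · exact absurd h.2.1 (h'.2.2.2.2 j h.2.2.1 hjk)
  · exact hjk
  · exact absurd h'.2.1 (h.2.2.2.2 k h'.2.2.1 hjk)

lemma Adj.left_unique {x : ℤ → A} {i j k : ℤ} (h : E.Adj x i k) (h' : E.Adj x j k) : i = j := by
  rcases lt_trichotomy i j with hij | hij | hij
  · exact absurd h'.1 (h.2.2.2.2 j hij h'.2.2.1)
  · exact hij
  · exact absurd h.1 (h'.2.2.2.2 i hij h.2.2.1)

lemma exists_adj_of_lt {x : ℤ → A} {i j : ℤ} (hi : cs.IsCell x i) (hj : cs.IsCell x j)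
    (hij : i < j) (hH : j < i + E.H) : ∃ k, E.Adj x i k ∧ k ≤ j := by
  classical
  have hex : ∃ n : ℕ, i < i + n ∧ cs.IsCell x (i + n) :=
    ⟨(j - i).toNat, by omega, by rwa [Int.toNat_of_nonneg (by omega), add_sub_cancel]⟩
  obtain ⟨h1, h2⟩ := Nat.find_spec hex
  have hle : Nat.find hex ≤ (j - i).toNat :=
    Nat.find_min' hex ⟨by omega, by rwa [Int.toNat_of_nonneg (by omega), add_sub_cancel]⟩
  refine ⟨i + Nat.find hex, ⟨hi, h2, h1, by omega, fun k hk1 hk2 hk => ?_⟩, by omega⟩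
  refine Nat.find_min hex (m := (k - i).toNat) (by omega) ⟨by omega, ?_⟩
  rwa [Int.toNat_of_nonneg (by omega), add_sub_cancel]

lemma moveVal_fst {x : ℤ → A} {i j : ℤ} (h : E.Adj x i j) :
    (E.moveVal x i).1 = (cs.val x j).1 := by
  have hex : ∃ j, E.Adj x i j := ⟨j, h⟩
  simp only [moveVal, dif_pos hex]
  rw [hex.choose_spec.right_unique h]

lemma moveVal_fst_of_not {x : ℤ → A} {i : ℤ} (h : ¬ ∃ j, E.Adj x i j) :
    (E.moveVal x i).1 = (cs.val x i).2 := by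
  simp only [moveVal, dif_neg h]

lemma moveVal_snd {x : ℤ → A} {i j : ℤ} (h : E.Adj x i j) :
    (E.moveVal x j).2 = (cs.val x i).2 := by
  have hex : ∃ i, E.Adj x i j := ⟨i, h⟩
  simp only [moveVal, dif_pos hex]
  rw [hex.choose_spec.left_unique h]

lemma moveVal_snd_of_not {x : ℤ → A} {i : ℤ} (h : ¬ ∃ j, E.Adj x j i) :
    (E.moveVal x i).2 = (cs.val x i).1 := by
  simp only [moveVal, dif_neg h]

lemma unmoveVal_fst {x : ℤ → A} {i j : ℤ} (h : E.Adj x i j) :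
    (E.unmoveVal x j).1 = (cs.val x i).1 := by
  have hex : ∃ i, E.Adj x i j := ⟨i, h⟩
  simp only [unmoveVal, dif_pos hex]
  rw [hex.choose_spec.left_unique h]

lemma unmoveVal_fst_of_not {x : ℤ → A} {i : ℤ} (h : ¬ ∃ j, E.Adj x j i) :
    (E.unmoveVal x i).1 = (cs.val x i).2 := by
  simp only [unmoveVal, dif_neg h]

lemma unmoveVal_snd {x : ℤ → A} {i j : ℤ} (h : E.Adj x i j) :
    (E.unmoveVal x i).2 = (cs.val x j).2 := by
  have hex : ∃ j, E.Adj x i j := ⟨j, h⟩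
  simp only [unmoveVal, dif_pos hex]
  rw [hex.choose_spec.right_unique h]

lemma unmoveVal_snd_of_not {x : ℤ → A} {i : ℤ} (h : ¬ ∃ j, E.Adj x i j) :
    (E.unmoveVal x i).2 = (cs.val x i).1 := by
  simp only [unmoveVal, dif_neg h]

lemma adj_recolor {x : ℤ → A} {f : ℤ → Bool × Bool} {i j : ℤ} :
    E.Adj (cs.recolor x f) i j ↔ E.Adj x i j := by
  simp only [Adj, isCell_recolor]

/-- Adjacency does not depend on the bits. On a finite chain of adjacent cells the first bits and
the second bits form two lanes joined at the ends, and a step rotates this loop by one place. -/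
lemma unmove_move (x : ℤ → A) : E.unmove (E.move x) = x := by
  rw [unmove, move, recolor_recolor]
  conv_rhs => rw [← recolor_val (cs := cs) x]
  refine recolor_congr fun i hi => Prod.ext ?_ ?_
  · by_cases h : ∃ j, E.Adj x j i
    · obtain ⟨j, hj⟩ := h
      rw [unmoveVal_fst (adj_recolor.2 hj), val_recolor _ hj.1, moveVal_fst hj]
    · rw [unmoveVal_fst_of_not (by simpa only [adj_recolor] using h), val_recolor _ hi,
        moveVal_snd_of_not h]
  · by_cases h : ∃ j, E.Adj x i j
    · obtain ⟨j, hj⟩ := h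
      rw [unmoveVal_snd (adj_recolor.2 hj), val_recolor _ hj.2.1, moveVal_snd hj]
    · rw [unmoveVal_snd_of_not (by simpa only [adj_recolor] using h), val_recolor _ hi,
        moveVal_fst_of_not h]

lemma move_unmove (x : ℤ → A) : E.move (E.unmove x) = x := by
  rw [unmove, move, recolor_recolor]
  conv_rhs => rw [← recolor_val (cs := cs) x]
  refine recolor_congr fun i hi => Prod.ext ?_ ?_
  · by_cases h : ∃ j, E.Adj x i j
    · obtain ⟨j, hj⟩ := h
      rw [moveVal_fst (adj_recolor.2 hj), val_recolor _ hj.2.1, unmoveVal_fst hj]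
    · rw [moveVal_fst_of_not (by simpa only [adj_recolor] using h), val_recolor _ hi,
        unmoveVal_snd_of_not h]
  · by_cases h : ∃ j, E.Adj x j i
    · obtain ⟨j, hj⟩ := h
      rw [moveVal_snd (adj_recolor.2 hj), val_recolor _ hj.1, unmoveVal_snd hj]
    · rw [moveVal_snd_of_not (by simpa only [adj_recolor] using h), val_recolor _ hi,
        unmoveVal_fst_of_not h]

lemma adj_shift {x : ℤ → A} {s i j : ℤ} :
    E.Adj (shift s x) i j ↔ E.Adj x (s + i) (s + j) := by
  simp only [Adj, isCell_shift]
  refine and_congr_right fun _ => and_congr_right fun _ => ?_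
  refine ⟨fun ⟨h1, h2, h3⟩ => ⟨by omega, by omega, fun k h4 h5 => ?_⟩,
    fun ⟨h1, h2, h3⟩ => ⟨by omega, by omega, fun k h4 h5 => h3 _ (by omega) (by omega)⟩⟩
  simpa using h3 (k - s) (by omega) (by omega)

lemma moveVal_shift (x : ℤ → A) (s i : ℤ) : E.moveVal (shift s x) i = E.moveVal x (s + i) := by
  refine Prod.ext ?_ ?_
  · by_cases h : ∃ j, E.Adj x (s + i) j
    · obtain ⟨j, hj⟩ := h
      rw [moveVal_fst hj, moveVal_fst (adj_shift.2 (by rwa [add_sub_cancel] : E.Adj x (s + i)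
        (s + (j - s)))), val_shift, add_sub_cancel]
    · rw [moveVal_fst_of_not h, moveVal_fst_of_not fun ⟨j, hj⟩ => h ⟨_, adj_shift.1 hj⟩, val_shift]
  · by_cases h : ∃ j, E.Adj x j (s + i)
    · obtain ⟨j, hj⟩ := h
      rw [moveVal_snd hj, moveVal_snd (adj_shift.2 (by rwa [add_sub_cancel] : E.Adj x (s + (j - s))
        (s + i))), val_shift, add_sub_cancel]
    · rw [moveVal_snd_of_not h, moveVal_snd_of_not fun ⟨j, hj⟩ => h ⟨_, adj_shift.1 hj⟩, val_shift]

lemma move_shift (x : ℤ → A) (s : ℤ) : E.move (shift s x) = shift s (E.move x) := by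
  rw [move, move, ← recolor_shift]
  exact recolor_congr fun i _ => moveVal_shift x s i

lemma Adj.congr {x y : ℤ → A} {a b i j : ℤ} (h : E.Adj x i j) (hxy : EqWin x y a b)
    (ha : a ≤ i) (hb : j + cs.m ≤ b) : E.Adj y i j := by
  obtain ⟨h1, h2, h3, h4, h5⟩ := h
  exact ⟨(isCell_congr hxy ha (by omega)).1 h1, (isCell_congr hxy (by omega) hb).1 h2, h3, h4,
    fun k hk1 hk2 hk => h5 k hk1 hk2 ((isCell_congr hxy (by omega) (by omega)).2 hk)⟩

lemma moveVal_local {x y : ℤ → A} {i : ℤ} (h : EqWin x y (i - E.H) (i + E.H + cs.m)) :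
    E.moveVal x i = E.moveVal y i := by
  have hr : ∀ {x y : ℤ → A}, EqWin x y (i - E.H) (i + E.H + cs.m) → ∀ j, E.Adj x i j →
      E.Adj y i j := fun h j hj => hj.congr h (by omega) (by have := hj.2.2.2.1; omega)
  have hl : ∀ {x y : ℤ → A}, EqWin x y (i - E.H) (i + E.H + cs.m) → ∀ j, E.Adj x j i →
      E.Adj y j i := fun h j hj => hj.congr h (by have := hj.2.2.2.1; omega) (by omega)
  refine Prod.ext ?_ ?_
  · by_cases hex : ∃ j, E.Adj x i j
    · obtain ⟨j, hj⟩ := hex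
      have := hj.2.2
      rw [moveVal_fst hj, moveVal_fst (hr h j hj), val_congr h (by omega) (by omega)]
    · rw [moveVal_fst_of_not hex, moveVal_fst_of_not fun ⟨j, hj⟩ => hex ⟨j, hr h.symm j hj⟩,
        val_congr h (by omega) (by omega)]
  · by_cases hex : ∃ j, E.Adj x j i
    · obtain ⟨j, hj⟩ := hex
      have := hj.2.2
      rw [moveVal_snd hj, moveVal_snd (hl h j hj), val_congr h (by omega) (by omega)]
    · rw [moveVal_snd_of_not hex, moveVal_snd_of_not fun ⟨j, hj⟩ => hex ⟨j, hl h.symm j hj⟩,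
        val_congr h (by omega) (by omega)]

lemma move_local {x y : ℤ → A} {k : ℤ}
    (h : EqWin x y (k - E.H - cs.m) (k + E.H + cs.m)) : E.move x k = E.move y k := by
  have := cs.p_le
  exact recolor_local (h.mono (by omega) (by omega)) fun i _ h1 h2 =>
    moveVal_local (h.mono (by omega) (by omega))

lemma move_mem {x : ℤ → A} (hx : x ∈ X.carrier) : E.move x ∈ X.carrier := recolor_mem hx _

variable (E)

/-- The automaton, on configurations: a conveyor step followed by a swap. -/
noncomputable def step (x : ℤ → A) : ℤ → A := E.swap (E.move x)

variable {E}

lemma step_mem {x : ℤ → A} (hx : x ∈ X.carrier) : E.step x ∈ X.carrier := swap_mem (move_mem hx)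

lemma step_shift (x : ℤ → A) (s : ℤ) : E.step (shift s x) = shift s (E.step x) := by
  rw [step, move_shift, swap_shift, step]

lemma step_local {x y : ℤ → A} (hx : x ∈ X.carrier) (hy : y ∈ X.carrier) {k : ℤ}
    (h : EqWin x y (k - 2 * (E.H + cs.m)) (k + 2 * (E.H + cs.m))) : E.step x k = E.step y k :=
  swap_local (move_mem hx) (move_mem hy) fun _ _ _ =>
    move_local (h.mono (by omega) (by omega))

variable (E)

/-- The automaton. -/
noncomputable def automaton (x : X.carrier) : X.carrier := ⟨E.step x, step_mem x.2⟩

theorem isReversibleCA_automaton : IsReversibleCA E.automaton := by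
  constructor
  · refine isCellularAutomaton_of_local E.step (fun _ => step_mem) step_shift
      (2 * (E.H + cs.m)) fun x hx y hy h => step_local hx hy (h.mono (by push_cast; omega) ?_)
    push_cast
    omega
  · constructor
    · intro x y h
      have h1 : E.swap (E.move x) = E.swap (E.move y) := congrArg Subtype.val h
      have h2 : E.move x = E.move y := by
        rw [← swap_swap (E := E) (move_mem x.2), h1, swap_swap (move_mem y.2)]
      exact Subtype.ext (by rw [← unmove_move (E := E) x, h2, unmove_move])
    · intro y
      refine ⟨⟨E.unmove (E.swap y), recolor_mem (swap_mem y.2) _⟩, Subtype.ext ?_⟩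
      show E.swap (E.move (E.unmove (E.swap y))) = y
      rw [move_unmove, swap_swap y.2]

end Erosion

end CellSystem

/-! ### The balance of bits in configurations with tails -/

namespace CellSystem

namespace Erosion

variable {A : Type*} [TopologicalSpace A] {X : Subshift A ℤ} {cs : CellSystem X} {E : Erosion cs}

lemma eqWin_swap {x : ℤ → A} {j : ℤ} (h : ∀ i, E.Site x i → i < j → i + E.H ≤ j) :
    EqWin x (E.swap x) j (j + cs.m) := fun k h1 h2 => by
  refine (swap_of_not fun i hi h3 => ?_).symm
  have := h i hi (by omega)
  omega

lemma isCell_swap {x : ℤ → A} {j : ℤ} (h : ∀ i, E.Site x i → i < j → i + E.H ≤ j) :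
    cs.IsCell (E.swap x) j ↔ cs.IsCell x j :=
  (isCell_congr (eqWin_swap h) le_rfl le_rfl).symm

lemma val_swap {x : ℤ → A} {j : ℤ} (h : ∀ i, E.Site x i → i < j → i + E.H ≤ j) :
    cs.val (E.swap x) j = cs.val x j :=
  (val_congr (eqWin_swap h) le_rfl le_rfl).symm

lemma swap_eq_self {x : ℤ → A} (h : ∀ i, ¬ E.Site x i) : E.swap x = x :=
  funext fun _ => swap_of_not fun i hi => absurd hi (h i)

/-- `i` is the position of a cell of `x` not followed by another cell within `H`. -/
def GapEnd (E : Erosion cs) (x : ℤ → A) (i : ℤ) : Prop := cs.IsCell x i ∧ ¬ ∃ j, E.Adj x i j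

lemma gapEnd_of_gap {x : ℤ → A} {i : ℤ} (h : cs.Gap E.H (shift i x)) : E.GapEnd x i := by
  refine ⟨⟨_, by simpa [at_shift] using h.2.1⟩, fun ⟨j, hj⟩ => ?_⟩
  obtain ⟨-, h2, h3, h4, -⟩ := hj
  exact h.2.2 (j - i) (by omega) (by omega) (isCell_shift.2 (by simpa using h2))

lemma gap_of_gapEnd {x : ℤ → A} (hx : x ∈ X.carrier) {i : ℤ} (h : E.GapEnd x i)
    (hv : cs.val x i = (false, false)) : cs.Gap E.H (shift i x) := by
  refine ⟨shift_mem hx i, ?_, fun j h0 hH hj => ?_⟩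
  · rw [at_shift, add_zero, ← hv]
    exact h.1.at
  · obtain ⟨k, hk, -⟩ := exists_adj_of_lt (E := E) h.1 (isCell_shift.1 hj) (by omega) (by omega)
    exact h.2 ⟨k, hk⟩

lemma Site.gapEnd {x : ℤ → A} (hx : x ∈ X.carrier) {i : ℤ} (h : E.Site x i) :
    E.GapEnd x i ∨ E.GapEnd (E.swap x) i := by
  rcases h with h' | ⟨z, hz, hzx⟩
  · exact Or.inl (gapEnd_of_gap h')
  · right
    have hs : E.Site x i := Or.inr ⟨z, hz, hzx⟩
    have h1 := hs.eqWin_swap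
    rw [← hzx, ψ_φ hz] at h1
    exact gapEnd_of_gap (hz.congr (shift_mem (swap_mem hx) i) h1)

lemma exists_adj_swap {x : ℤ → A} (hx : x ∈ X.carrier) {i : ℤ} (h : E.GapEnd x i)
    (hv : cs.val x i = (false, false)) :
    ∃ j, E.Adj (E.swap x) i j ∧ cs.val (E.swap x) j = (true, true) := by
  have hg := gap_of_gapEnd hx h hv
  have hs : E.Site x i := Or.inl hg
  obtain ⟨j, h0, hH, hj⟩ := E.exists_inner hg
  have h1 := hs.eqWin_swap
  rw [ψ_of_gap hg] at h1
  have hj' : cs.IsCell (E.swap x) (i + j) :=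
    isCell_shift.1 ((isCell_congr h1 (by omega) (by omega)).1 hj)
  obtain ⟨k, hk, hkj⟩ := exists_adj_of_lt (E := E) ⟨_, (hs.swap hx).1.at⟩ hj' (by omega) (by omega)
  exact ⟨k, hk, (hs.swap hx).1.inner hk.2.2.1 hk.2.2.2.1 hk.2.1⟩

/-- A bit as an integer. -/
def bitInt (b : Bool) : ℤ := if b then 1 else 0

open Classical in
/-- The number of bits of the cell at `i`, minus two. -/
noncomputable def wt (cs : CellSystem X) (x : ℤ → A) (i : ℤ) : ℤ :=
  if cs.IsCell x i then bitInt (cs.val x i).1 + bitInt (cs.val x i).2 - 2 else 0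

lemma bitInt_nonneg (b : Bool) : 0 ≤ bitInt b := by cases b <;> simp [bitInt]

lemma neg_two_le_wt (x : ℤ → A) (i : ℤ) : -2 ≤ wt cs x i := by
  unfold wt
  split_ifs
  · have := bitInt_nonneg (cs.val x i).1
    have := bitInt_nonneg (cs.val x i).2
    omega
  · omega

/-- Every cell inside the gap of a site is full, before as well as after the swap. Subtracting two
makes such cells weightless, so creating or deleting them changes nothing. -/
lemma wt_swap {x : ℤ → A} (hx : x ∈ X.carrier) (j : ℤ) : wt cs (E.swap x) j = wt cs x j := by
  by_cases h : ∀ i, E.Site x i → i < j → i + E.H ≤ j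
  · unfold wt
    rw [val_swap h]
    by_cases hc : cs.IsCell x j
    · rw [if_pos hc, if_pos ((isCell_swap h).2 hc)]
    · rw [if_neg hc, if_neg (mt (isCell_swap h).1 hc)]
  · push Not at h
    obtain ⟨i, hi, h1, h2⟩ := h
    have key : ∀ y, E.Site y i → wt cs y j = 0 := by
      intro y hy
      unfold wt
      split_ifs with hc
      · rw [hy.inner h1 h2 hc]
        simp [bitInt]
      · rfl
    rw [key x hi, key _ (hi.swap hx).1]

open Classical in
/-- The net number of bits that cross `k` from the left to the right in a conveyor step. -/
noncomputable def current (E : Erosion cs) (x : ℤ → A) (k : ℤ) : ℤ :=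
  if h : ∃ q : ℤ × ℤ, E.Adj x q.1 q.2 ∧ q.1 < k ∧ k ≤ q.2 then
    bitInt (cs.val x h.choose.1).2 - bitInt (cs.val x h.choose.2).1 else 0

lemma current_of_adj {x : ℤ → A} {i j k : ℤ} (h : E.Adj x i j) (h1 : i < k) (h2 : k ≤ j) :
    E.current x k = bitInt (cs.val x i).2 - bitInt (cs.val x j).1 := by
  have hex : ∃ q : ℤ × ℤ, E.Adj x q.1 q.2 ∧ q.1 < k ∧ k ≤ q.2 := ⟨(i, j), h, h1, h2⟩
  obtain ⟨g1, g2, g3⟩ := hex.choose_spec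
  have e1 : hex.choose.1 = i := by
    rcases lt_trichotomy hex.choose.1 i with h' | h' | h'
    · exact absurd h.1 (g1.2.2.2.2 i h' (by omega))
    · exact h'
    · exact absurd g1.1 (h.2.2.2.2 _ h' (by omega))
  have e2 : hex.choose.2 = j := by
    rw [e1] at g1
    exact g1.right_unique h
  rw [current, dif_pos hex, e1, e2]

lemma current_of_not {x : ℤ → A} {k : ℤ} (h : ∀ i j, E.Adj x i j → i < k → j < k) :
    E.current x k = 0 := by
  rw [current, dif_neg]
  rintro ⟨q, h1, h2, h3⟩
  have := h _ _ h1 h2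
  omega

/-- This is the discrete continuity equation: a cell gains and loses bits only across its two sides,
a reflected bit crosses neither, and between cells the current is constant. -/
lemma wt_move (x : ℤ → A) (k : ℤ) :
    wt cs (E.move x) k - wt cs x k = E.current x k - E.current x (k + 1) := by
  by_cases hk : cs.IsCell x k
  · have hk' : cs.IsCell (E.move x) k := isCell_recolor.2 hk
    have hv : cs.val (E.move x) k = E.moveVal x k := val_recolor _ hk
    unfold wt
    rw [if_pos hk, if_pos hk', hv]
    have hl : E.current x k = bitInt (E.moveVal x k).2 - bitInt (cs.val x k).1 := by
      by_cases h : ∃ i, E.Adj x i k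
      · obtain ⟨i, hi⟩ := h
        rw [current_of_adj hi hi.2.2.1 le_rfl, moveVal_snd hi]
      · rw [moveVal_snd_of_not h, current_of_not, sub_self]
        intro i j hij hik
        by_contra hjk
        rcases lt_or_eq_of_le (not_lt.1 hjk) with h' | rfl
        · exact hij.2.2.2.2 k hik h' hk
        · exact h ⟨i, hij⟩
    have hr : E.current x (k + 1) = bitInt (cs.val x k).2 - bitInt (E.moveVal x k).1 := by
      by_cases h : ∃ j, E.Adj x k j
      · obtain ⟨j, hj⟩ := h
        have := hj.2.2.1
        rw [current_of_adj hj (by omega) (by omega), moveVal_fst hj]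
      · rw [moveVal_fst_of_not h, current_of_not, sub_self]
        intro i j hij hik
        by_contra hjk
        rcases lt_or_eq_of_le (Int.lt_add_one_iff.1 hik) with h' | rfl
        · exact hij.2.2.2.2 k h' (by omega) hk
        · exact h ⟨j, hij⟩
    rw [hl, hr]
    ring
  · have hk' : ¬ cs.IsCell (E.move x) k := mt isCell_recolor.1 hk
    unfold wt
    rw [if_neg hk, if_neg hk']
    by_cases h : ∃ i j, E.Adj x i j ∧ i < k ∧ k ≤ j
    · obtain ⟨i, j, hij, h1, h2⟩ := h
      have : k ≠ j := by
        rintro rfl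
        exact hk hij.2.1
      rw [current_of_adj hij h1 h2, current_of_adj hij (by omega) (by omega)]
      ring
    · rw [current_of_not, current_of_not]
      · intro i j hij h1
        by_contra h2
        have : k ≠ i := by
          rintro rfl
          exact hk hij.1
        exact h ⟨i, j, hij, by omega, by omega⟩
      · intro i j hij h1
        by_contra h2
        exact h ⟨i, j, hij, h1, by omega⟩

/-- Outside the interval from `a` to `b`, the configuration `x` consists of cells chained at the
least distance, and no bit of them moves towards the interval. -/
structure Tails (cs : CellSystem X) (x : ℤ → A) (a b : ℤ) : Prop where
  left : ∀ k : ℕ, cs.IsCell x (a - k * cs.p)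
  right : ∀ k : ℕ, cs.IsCell x (b + k * cs.p)
  snd : ∀ i ≤ a, (cs.val x i).2 = false
  fst : ∀ i ≥ b, (cs.val x i).1 = false

lemma adj_of_add_p {x : ℤ → A} {i : ℤ} (h1 : cs.IsCell x i) (h2 : cs.IsCell x (i + cs.p)) :
    E.Adj x i (i + cs.p) := by
  have := cs.p_pos
  have := E.p_lt
  refine ⟨h1, h2, by omega, by omega, fun k hk1 hk2 hk => ?_⟩
  have := h1.sep hk hk1
  omega

/-- The cells of the chain are `p` apart and any two cells are at least `p` apart, so there is no
room for others. -/
lemma Tails.exists_left {x : ℤ → A} {a b i : ℤ} (h : Tails cs x a b) (hi : cs.IsCell x i)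
    (hia : i ≤ a) : ∃ k : ℕ, i = a - k * cs.p := by
  have hp := cs.p_pos
  refine ⟨((a - i) / cs.p).toNat, ?_⟩
  have h1 := Int.emod_add_mul_ediv (a - i) cs.p
  have h2 := Int.emod_nonneg (a - i) (b := cs.p) (by omega)
  have h3 := Int.emod_lt_of_pos (a - i) (b := cs.p) (by omega)
  have h4 : 0 ≤ (a - i) / cs.p := Int.ediv_nonneg (by omega) (by omega)
  have h5 := h.left ((a - i) / cs.p).toNat
  rw [Int.toNat_of_nonneg h4] at h5 ⊢
  rw [mul_comm] at h1
  exact (h5.unique hi (k := a - (a - i) / cs.p * cs.p) le_rfl (by omega) (by omega)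
    (by omega)).symm

lemma Tails.exists_right {x : ℤ → A} {a b i : ℤ} (h : Tails cs x a b) (hi : cs.IsCell x i)
    (hib : b ≤ i) : ∃ k : ℕ, i = b + k * cs.p := by
  have hp := cs.p_pos
  refine ⟨((i - b) / cs.p).toNat, ?_⟩
  have h1 := Int.emod_add_mul_ediv (i - b) cs.p
  have h2 := Int.emod_nonneg (i - b) (b := cs.p) (by omega)
  have h3 := Int.emod_lt_of_pos (i - b) (b := cs.p) (by omega)
  have h4 : 0 ≤ (i - b) / cs.p := Int.ediv_nonneg (by omega) (by omega)
  have h5 := h.right ((i - b) / cs.p).toNat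
  rw [Int.toNat_of_nonneg h4] at h5 ⊢
  rw [mul_comm] at h1
  exact (h5.unique hi (k := i) (by omega) (by omega) le_rfl (by omega)).symm

lemma Tails.add_p_left {x : ℤ → A} {a b i : ℤ} (h : Tails cs x a b) (hi : cs.IsCell x i)
    (hia : i < a) : cs.IsCell x (i + cs.p) ∧ i + cs.p ≤ a := by
  obtain ⟨k, rfl⟩ := h.exists_left hi hia.le
  have hp := cs.p_pos
  cases k with
  | zero => simp at hia
  | succ k =>
    have := h.left k
    have e : a - ((k + 1 : ℕ) : ℤ) * cs.p + cs.p = a - k * cs.p := by push_cast; ring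
    rw [e]
    exact ⟨this, by nlinarith⟩

lemma Tails.add_p_right {x : ℤ → A} {a b i : ℤ} (h : Tails cs x a b) (hi : cs.IsCell x i)
    (hib : b ≤ i) : cs.IsCell x (i + cs.p) := by
  obtain ⟨k, rfl⟩ := h.exists_right hi hib
  have := h.right (k + 1)
  push_cast at this
  convert this using 1
  ring

lemma Tails.sub_p_left {x : ℤ → A} {a b i : ℤ} (h : Tails cs x a b) (hi : cs.IsCell x i)
    (hia : i ≤ a) : cs.IsCell x (i - cs.p) := by
  obtain ⟨k, rfl⟩ := h.exists_left hi hia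
  have := h.left (k + 1)
  push_cast at this
  convert this using 1
  ring

lemma Tails.isCell_left {x : ℤ → A} {a b : ℤ} (h : Tails cs x a b) : cs.IsCell x a := by
  simpa using h.left 0

lemma Tails.isCell_right {x : ℤ → A} {a b : ℤ} (h : Tails cs x a b) : cs.IsCell x b := by
  simpa using h.right 0

lemma Tails.gapEnd {x : ℤ → A} {a b i : ℤ} (h : Tails cs x a b) (hi : E.GapEnd x i) :
    a ≤ i ∧ i < b := by
  constructor
  · by_contra hia
    exact hi.2 ⟨_, adj_of_add_p hi.1 (h.add_p_left hi.1 (by omega)).1⟩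
  · by_contra hib
    exact hi.2 ⟨_, adj_of_add_p hi.1 (h.add_p_right hi.1 (by omega))⟩

/-- Cells within `H` after a site are full, but those of the left tail lack the second bit and those
of the right tail the first. -/
lemma Tails.site {x : ℤ → A} {a b i : ℤ} (h : Tails cs x a b) (hi : E.Site x i) :
    a ≤ i ∧ i + E.H ≤ b := by
  have hp := cs.p_pos
  have hpH := E.p_lt
  have hc : cs.IsCell x i := ⟨_, hi.at⟩
  have hia : a ≤ i := by
    by_contra hia
    obtain ⟨h1, h2⟩ := h.add_p_left hc (by omega)
    have h3 := hi.inner (by omega) (by omega) h1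
    have h4 := h.snd _ h2
    rw [h3] at h4
    simp at h4
  refine ⟨hia, ?_⟩
  by_contra hib
  rcases lt_or_ge i b with h1 | h1
  · have h3 := hi.inner h1 (by omega) h.isCell_right
    have h4 := h.fst b le_rfl
    rw [h3] at h4
    simp at h4
  · have h3 := hi.inner (by omega) (by omega) (h.add_p_right hc h1)
    have h4 := h.fst (i + cs.p) (by omega)
    rw [h3] at h4
    simp at h4

lemma Tails.swap {x : ℤ → A} {a b : ℤ} (h : Tails cs x a b) : Tails cs (E.swap x) a b := by
  have hl : ∀ j ≤ a, ∀ i, E.Site x i → i < j → i + E.H ≤ j := fun j hj i hi hij => by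
    have := h.site hi
    omega
  have hr : ∀ j ≥ b, ∀ i, E.Site x i → i < j → i + E.H ≤ j := fun j hj i hi hij => by
    have := h.site hi
    omega
  refine ⟨fun k => ?_, fun k => ?_, fun i hi => ?_, fun i hi => ?_⟩
  · rw [isCell_swap (hl _ (by have : (0 : ℤ) ≤ k * cs.p := by positivity
                              omega))]
    exact h.left k
  · rw [isCell_swap (hr _ (by have : (0 : ℤ) ≤ k * cs.p := by positivity
                              omega))]
    exact h.right k
  · rw [val_swap (hl i hi)]
    exact h.snd i hi
  · rw [val_swap (hr i hi)]
    exact h.fst i hi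

lemma Tails.move {x : ℤ → A} {a b : ℤ} (h : Tails cs x a b) : Tails cs (E.move x) a b := by
  refine ⟨fun k => isCell_recolor.2 (h.left k), fun k => isCell_recolor.2 (h.right k),
    fun i hi => ?_, fun i hi => ?_⟩
  · by_cases hc : cs.IsCell x i
    · rw [Erosion.move, val_recolor _ hc]
      have h1 := h.sub_p_left hc hi
      have h2 := adj_of_add_p (E := E) h1 (by simpa using hc)
      rw [sub_add_cancel] at h2
      rw [moveVal_snd h2]
      exact h.snd _ (by omega)
    · rw [Erosion.move, val_of_not (mt isCell_recolor.1 hc)]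
  · by_cases hc : cs.IsCell x i
    · rw [Erosion.move, val_recolor _ hc,
        moveVal_fst (adj_of_add_p (E := E) hc (h.add_p_right hc hi))]
      exact h.fst _ (by omega)
    · rw [Erosion.move, val_of_not (mt isCell_recolor.1 hc)]

lemma Tails.step {x : ℤ → A} {a b : ℤ} (h : Tails cs x a b) : Tails cs (E.step x) a b :=
  h.move.swap

lemma step_iterate_mem {x : ℤ → A} (hx : x ∈ X.carrier) (t : ℕ) : E.step^[t] x ∈ X.carrier := by
  induction t with
  | zero => exact hx
  | succ t ih =>
    rw [Function.iterate_succ_apply']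
    exact step_mem ih

lemma Tails.iterate {x : ℤ → A} {a b : ℤ} (h : Tails cs x a b) (t : ℕ) :
    Tails cs (E.step^[t] x) a b := by
  induction t with
  | zero => exact h
  | succ t ih =>
    rw [Function.iterate_succ_apply']
    exact ih.step

/-- The currents telescope. At the two ends they only count bits going out, because no bit in the
tails moves inwards. -/
lemma Tails.sum_wt_step {x : ℤ → A} (hx : x ∈ X.carrier) {a : ℤ} {n : ℕ}
    (h : Tails cs x a (a + n)) :
    ∑ k ∈ Finset.range (n + 1), wt cs (E.step x) (a + k) =
      ∑ k ∈ Finset.range (n + 1), wt cs x (a + k) - bitInt (cs.val x a).1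
        - bitInt (cs.val x (a + n)).2 := by
  have h1 : ∀ k : ℕ, wt cs (E.step x) (a + k) - wt cs x (a + k) =
      E.current x (a + k) - E.current x (a + (k + 1 : ℕ)) := by
    intro k
    rw [Erosion.step, wt_swap (move_mem hx), wt_move]
    push_cast
    ring_nf
  have h2 := Finset.sum_range_sub' (fun k : ℕ => E.current x (a + k)) (n + 1)
  rw [← Finset.sum_congr rfl fun k _ => h1 k, Finset.sum_sub_distrib] at h2
  have hl := adj_of_add_p (E := E) (h.sub_p_left h.isCell_left le_rfl)
    (by simpa using h.isCell_left)
  rw [sub_add_cancel] at hl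
  have hr := adj_of_add_p (E := E) h.isCell_right (h.add_p_right h.isCell_right le_rfl)
  have hp := cs.p_pos
  have e1 : E.current x (a + (0 : ℕ)) = - bitInt (cs.val x a).1 := by
    rw [Nat.cast_zero, add_zero, current_of_adj hl (by omega) le_rfl, h.snd _ (by omega)]
    simp [bitInt]
  have e2 : E.current x (a + (n + 1 : ℕ)) = bitInt (cs.val x (a + n)).2 := by
    rw [current_of_adj hr (by push_cast; omega) (by push_cast; omega), h.fst _ (by omega)]
    simp [bitInt]
  rw [e1, e2] at h2
  linarith

/-- After some time no bit leaves through the left end. -/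
lemma Tails.eventually_fst {x : ℤ → A} (hx : x ∈ X.carrier) {a b : ℤ} (hab : a ≤ b)
    (h : Tails cs x a b) : ∃ T, ∀ t ≥ T, (cs.val (E.step^[t] x) a).1 = false := by
  obtain ⟨n, rfl⟩ : ∃ n : ℕ, b = a + n := ⟨(b - a).toNat, by omega⟩
  set N : ℕ → ℤ := fun t => ∑ k ∈ Finset.range (n + 1), wt cs (E.step^[t] x) (a + k) with hN
  have hstep : ∀ t, N (t + 1) = N t - bitInt (cs.val (E.step^[t] x) a).1
      - bitInt (cs.val (E.step^[t] x) (a + n)).2 := by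
    intro t
    simp only [hN, Function.iterate_succ_apply']
    exact (h.iterate t).sum_wt_step (step_iterate_mem hx t)
  have hanti : Antitone N := antitone_nat_of_succ_le fun t => by
    have := bitInt_nonneg (cs.val (E.step^[t] x) a).1
    have := bitInt_nonneg (cs.val (E.step^[t] x) (a + n)).2
    rw [hstep]
    omega
  have hbdd : ∀ t, -2 * (n + 1 : ℤ) ≤ N t := by
    intro t
    have := Finset.card_nsmul_le_sum (Finset.range (n + 1))
      (fun k => wt cs (E.step^[t] x) (a + k)) (-2) fun k _ => neg_two_le_wt _ _
    simp at this
    simp only [hN]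
    linarith
  -- Once the nonincreasing `N` has reached its least value, a bit that leaves would lower it
  -- further.
  obtain ⟨m, ⟨T, hT⟩, hm⟩ := Int.exists_least_of_bdd (P := fun m => ∃ t, N t = m)
    ⟨-2 * (n + 1 : ℤ), by rintro _ ⟨t, rfl⟩; exact hbdd t⟩ ⟨_, 0, rfl⟩
  refine ⟨T, fun t ht => ?_⟩
  have h1 := hanti ht
  have h2 := hm _ ⟨t + 1, rfl⟩
  have h3 := hstep t
  have h4 := bitInt_nonneg (cs.val (E.step^[t] x) a).1
  have h5 := bitInt_nonneg (cs.val (E.step^[t] x) (a + n)).2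
  by_contra hcon
  rw [Bool.not_eq_false] at hcon
  rw [hcon] at h3
  simp only [bitInt, if_true] at h3
  simp only [bitInt] at h5
  omega

end Erosion

end CellSystem

/-! ### Disappearance of the gaps -/

namespace CellSystem

namespace Erosion

variable {A : Type*} [TopologicalSpace A] {X : Subshift A ℤ} {cs : CellSystem X} {E : Erosion cs}

lemma gapEnd_move {x : ℤ → A} {i : ℤ} : E.GapEnd (E.move x) i ↔ E.GapEnd x i := by
  simp only [GapEnd, move, isCell_recolor, adj_recolor]

lemma exists_adj_left {x : ℤ → A} {a j : ℤ} (ha : cs.IsCell x a) (hj : cs.IsCell x j) (haj : a < j)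
    (h : ∀ i, a ≤ i → i < j → ¬ E.GapEnd x i) : ∃ i, a ≤ i ∧ E.Adj x i j := by
  obtain ⟨i, ⟨h1, h2, h3⟩, h4⟩ := Int.exists_greatest_of_bdd
    (P := fun i => cs.IsCell x i ∧ a ≤ i ∧ i < j) ⟨j, fun i hi => hi.2.2.le⟩ ⟨a, ha, le_rfl, haj⟩
  have h5 := h i h2 h3
  rw [GapEnd, not_and_not_right] at h5
  obtain ⟨k, hk⟩ := h5 h1
  refine ⟨i, h2, ?_⟩
  rcases lt_trichotomy k j with h' | rfl | h'
  · have := h4 k ⟨hk.2.1, by have := hk.2.2.1; omega, h'⟩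
    have := hk.2.2.1
    omega
  · exact hk
  · exact absurd hj (hk.2.2.2.2 j h3 h')

lemma val_move {x : ℤ → A} {j : ℤ} (hj : cs.IsCell x j) :
    cs.val (E.move x) j = E.moveVal x j := val_recolor _ hj

/-- Below a position without gaps to its left nothing is swapped. -/
lemma le_of_site_of_no_gap {x : ℤ → A} (hx : x ∈ X.carrier) {g : ℤ} (h1 : ∀ i < g, ¬ E.GapEnd x i)
    (h2 : ∀ i < g, ¬ E.GapEnd (E.step x) i) {i : ℤ} (hi : E.Site (E.move x) i) : g ≤ i := by
  by_contra hig
  rcases hi.gapEnd (move_mem hx) with h | h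
  · exact h1 i (by omega) (gapEnd_move.1 h)
  · exact h2 i (by omega) h

section Quiet

variable {x : ℤ → A} {a b g : ℤ} {T : ℕ}

lemma isCell_step_of_no_gap (hx : x ∈ X.carrier) (h1 : ∀ i < g, ¬ E.GapEnd x i)
    (h2 : ∀ i < g, ¬ E.GapEnd (E.step x) i) {j : ℤ} (hj : j ≤ g) :
    cs.IsCell (E.step x) j ↔ cs.IsCell x j := by
  rw [step, isCell_swap fun i hi hij => by have := le_of_site_of_no_gap hx h1 h2 hi; omega]
  exact isCell_recolor

lemma val_step_of_no_gap (hx : x ∈ X.carrier) (h1 : ∀ i < g, ¬ E.GapEnd x i)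
    (h2 : ∀ i < g, ¬ E.GapEnd (E.step x) i) {j : ℤ} (hj : j ≤ g) :
    cs.val (E.step x) j = cs.val (E.move x) j := by
  rw [step, val_swap fun i hi hij => by have := le_of_site_of_no_gap hx h1 h2 hi; omega]

/-- Every site is a gap end before or after its swap. So cells up to `g` are frozen, and only bits
move there. -/
lemma isCell_iterate_of_no_gap (hx : x ∈ X.carrier)
    (hg : ∀ t ≥ T, ∀ i < g, ¬ E.GapEnd (E.step^[t] x) i) {j : ℤ} (hj : j ≤ g) {t : ℕ} (ht : T ≤ t) :
    cs.IsCell (E.step^[t] x) j ↔ cs.IsCell (E.step^[T] x) j := by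
  induction t, ht using Nat.le_induction with
  | base => rfl
  | succ t ht ih =>
    have h2 := hg (t + 1) (by omega)
    rw [Function.iterate_succ_apply'] at h2 ⊢
    rw [isCell_step_of_no_gap (step_iterate_mem hx t) (hg t ht) h2 hj, ih]

lemma adj_iterate_of_no_gap (hx : x ∈ X.carrier)
    (hg : ∀ t ≥ T, ∀ i < g, ¬ E.GapEnd (E.step^[t] x) i) {i j : ℤ} (hj : j ≤ g)
    (h : E.Adj (E.step^[T] x) i j) {t : ℕ} (ht : T ≤ t) : E.Adj (E.step^[t] x) i j := by
  obtain ⟨h1, h2, h3, h4, h5⟩ := h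
  exact ⟨(isCell_iterate_of_no_gap hx hg (by omega) ht).2 h1,
    (isCell_iterate_of_no_gap hx hg hj ht).2 h2, h3, h4, fun k hk1 hk2 hk =>
      h5 k hk1 hk2 ((isCell_iterate_of_no_gap hx hg (by omega) ht).1 hk)⟩

lemma fst_iterate_succ (hx : x ∈ X.carrier)
    (hg : ∀ t ≥ T, ∀ i < g, ¬ E.GapEnd (E.step^[t] x) i) {i j : ℤ} (hi : i ≤ g) {t : ℕ}
    (ht : T ≤ t) (h : E.Adj (E.step^[t] x) i j) :
    (cs.val (E.step^[t + 1] x) i).1 = (cs.val (E.step^[t] x) j).1 := by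
  have h2 := hg (t + 1) (by omega)
  rw [Function.iterate_succ_apply'] at h2 ⊢
  rw [val_step_of_no_gap (step_iterate_mem hx t) (hg t ht) h2 hi, val_move h.1, moveVal_fst h]

lemma snd_iterate_succ (hx : x ∈ X.carrier)
    (hg : ∀ t ≥ T, ∀ i < g, ¬ E.GapEnd (E.step^[t] x) i) {i j : ℤ} (hj : j ≤ g) {t : ℕ}
    (ht : T ≤ t) (h : E.Adj (E.step^[t] x) i j) :
    (cs.val (E.step^[t + 1] x) j).2 = (cs.val (E.step^[t] x) i).2 := by
  have h2 := hg (t + 1) (by omega)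
  rw [Function.iterate_succ_apply'] at h2 ⊢
  rw [val_step_of_no_gap (step_iterate_mem hx t) (hg t ht) h2 hj, val_move h.2.1, moveVal_snd h]

/-- A first bit would be handed on to the left, cell by cell, until it arrived at `a`, which `ha`
forbids. -/
lemma Tails.fst_of_no_gap (hx : x ∈ X.carrier) (h : Tails cs x a b)
    (hg : ∀ t ≥ T, ∀ i < g, ¬ E.GapEnd (E.step^[t] x) i)
    (ha : ∀ t ≥ T, (cs.val (E.step^[t] x) a).1 = false) (n : ℕ) :
    ∀ j, a ≤ j → j < a + n → j ≤ g → cs.IsCell (E.step^[T] x) j →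
      ∀ t ≥ T, (cs.val (E.step^[t] x) j).1 = false := by
  induction n with
  | zero => intro j h1 h2; omega
  | succ n ih =>
    intro j h1 h2 h3 hj t ht
    rcases h1.eq_or_lt with rfl | h1
    · exact ha t ht
    obtain ⟨i, hai, hij⟩ := exists_adj_left (h.iterate T).isCell_left hj h1
      fun i _ hi => hg T le_rfl i (by omega)
    have := hij.2.2.1
    rw [← fst_iterate_succ hx hg (by omega) ht (adj_iterate_of_no_gap hx hg h3 hij ht)]
    exact ih i hai (by omega) (by omega) hij.1 (t + 1) (by omega)

/-- Second bits come from the left neighbour and the left tail supplies none, so the cells drain one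
after the other, starting from `a`. -/
lemma Tails.snd_of_no_gap (hx : x ∈ X.carrier) (h : Tails cs x a b)
    (hg : ∀ t ≥ T, ∀ i < g, ¬ E.GapEnd (E.step^[t] x) i) (n : ℕ) :
    ∀ j, j < a + n → j ≤ g → cs.IsCell (E.step^[T] x) j →
      ∀ᶠ t in Filter.atTop, (cs.val (E.step^[t] x) j).2 = false := by
  induction n with
  | zero =>
    intro j h2 h3 hj
    exact Filter.Eventually.of_forall fun t => (h.iterate t).snd j (by push_cast at h2; omega)
  | succ n ih =>
    intro j h2 h3 hj
    rcases le_or_gt j a with h1 | h1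
    · exact Filter.Eventually.of_forall fun t => (h.iterate t).snd j h1
    obtain ⟨i, hai, hij⟩ := exists_adj_left (h.iterate T).isCell_left hj h1
      fun i _ hi => hg T le_rfl i (by omega)
    have := hij.2.2.1
    obtain ⟨T', hT'⟩ := Filter.eventually_atTop.1 (ih i (by push_cast at h2; omega) (by omega) hij.1)
    refine Filter.eventually_atTop.2 ⟨max T T' + 1, fun t ht => ?_⟩
    obtain ⟨s, rfl⟩ : ∃ s, t = s + 1 := ⟨t - 1, by omega⟩
    rw [snd_iterate_succ hx hg h3 (by omega) (adj_iterate_of_no_gap hx hg h3 hij (by omega))]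
    exact hT' s (by omega)

/-- All gaps are eroded after some time. -/
lemma Tails.eventually_not_gapEnd (hx : x ∈ X.carrier) (hab : a ≤ b) (h : Tails cs x a b) :
    ∀ᶠ t in Filter.atTop, ∀ i, ¬ E.GapEnd (E.step^[t] x) i := by
  by_contra hcon
  have hfin : ∃ i, ∃ᶠ t in Filter.atTop, E.GapEnd (E.step^[t] x) i := by
    by_contra hno
    simp only [not_exists, Filter.not_frequently] at hno
    refine hcon (((Filter.eventually_all_finset (Finset.Icc a b)).2 fun i _ => hno i).mono
      fun t ht i hi => ?_)
    have := (h.iterate t).gapEnd hi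
    exact ht i (Finset.mem_Icc.2 ⟨this.1, this.2.le⟩) hi
  -- Take the leftmost position that is a gap end at infinitely many times.
  obtain ⟨g, hgf, hgmin⟩ := Int.exists_least_of_bdd
    (P := fun i => ∃ᶠ t in Filter.atTop, E.GapEnd (E.step^[t] x) i)
    ⟨a, fun i hi => by
      obtain ⟨t, ht⟩ := hi.exists
      exact ((h.iterate t).gapEnd ht).1⟩ hfin
  have hlow : ∀ᶠ t in Filter.atTop, ∀ i < g, ¬ E.GapEnd (E.step^[t] x) i := by
    have h1 : ∀ i ∈ Finset.Ico a g, ∀ᶠ t in Filter.atTop, ¬ E.GapEnd (E.step^[t] x) i := by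
      intro i hi
      rw [← Filter.not_frequently]
      intro hif
      have := hgmin i hif
      rw [Finset.mem_Ico] at hi
      omega
    refine ((Filter.eventually_all_finset _).2 h1).mono fun t ht i hi hgap => ?_
    exact ht i (Finset.mem_Ico.2 ⟨((h.iterate t).gapEnd hgap).1, hi⟩) hgap
  obtain ⟨T₁, hT₁⟩ := h.eventually_fst (E := E) hx hab
  obtain ⟨T, hT⟩ := Filter.eventually_atTop.1 (hlow.and (Filter.eventually_ge_atTop T₁))
  have hg : ∀ t ≥ T, ∀ i < g, ¬ E.GapEnd (E.step^[t] x) i := fun t ht => (hT t ht).1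
  have hgc : cs.IsCell (E.step^[T] x) g := by
    obtain ⟨t, ht1, ht2⟩ := Filter.frequently_atTop.1 hgf T
    exact (isCell_iterate_of_no_gap hx hg le_rfl ht1).1 ht2.1
  have hga : a ≤ g := by
    obtain ⟨t, ht⟩ := hgf.exists
    exact ((h.iterate t).gapEnd ht).1
  have hfst := h.fst_of_no_gap hx hg (fun t ht => hT₁ t (hT t ht).2) (g - a + 1).toNat g hga
    (by omega) le_rfl hgc
  obtain ⟨T₂, hT₂⟩ := Filter.eventually_atTop.1
    (h.snd_of_no_gap hx hg (g - a + 1).toNat g (by omega) le_rfl hgc)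
  obtain ⟨t, ht1, ht2⟩ := Filter.frequently_atTop.1 hgf (max T T₂)
  have hm := step_iterate_mem (E := E) hx t
  -- The cell at `g` is empty when `swap` inspects the gap after it, so a full cell is inserted
  -- there. One step later its first bit is at `g`, contrary to `hfst`.
  have hv : cs.val (E.step^[t + 1] x) g = (false, false) :=
    Prod.ext (hfst (t + 1) (by omega)) (hT₂ (t + 1) (by omega))
  have h2 := hg (t + 1) (by omega)
  rw [Function.iterate_succ_apply'] at hv h2
  rw [val_step_of_no_gap hm (hg t (by omega)) h2 le_rfl] at hv
  obtain ⟨j, hj1, hj2⟩ := exists_adj_swap (move_mem hm) (gapEnd_move.2 ht2) hv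
  have h3 : E.Adj (E.step^[t + 1] x) g j := by
    rw [Function.iterate_succ_apply']
    exact hj1
  have h4 := fst_iterate_succ hx hg le_rfl (by omega) h3
  rw [hfst _ (by omega), Function.iterate_succ_apply', Erosion.step, hj2] at h4
  simp at h4

/-- There are no gaps, no first bits from `a` on and no second bits up to `b`. -/
structure Quiet (E : Erosion cs) (x : ℤ → A) (a b : ℤ) : Prop extends Tails cs x a b where
  no_gap : ∀ i, ¬ E.GapEnd x i
  fst' : ∀ i ≥ a, (cs.val x i).1 = false
  snd' : ∀ i ≤ b, (cs.val x i).2 = false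

lemma Tails.eventually_quiet (hx : x ∈ X.carrier) (hab : a ≤ b) (h : Tails cs x a b) :
    ∃ T, ∀ t ≥ T, E.Quiet (E.step^[t] x) a b := by
  obtain ⟨T₁, hT₁⟩ := h.eventually_fst (E := E) hx hab
  obtain ⟨T, hT⟩ := Filter.eventually_atTop.1
    ((h.eventually_not_gapEnd (E := E) hx hab).and (Filter.eventually_ge_atTop T₁))
  have hg : ∀ g, ∀ t ≥ T, ∀ i < g, ¬ E.GapEnd (E.step^[t] x) i := fun g t ht i _ => (hT t ht).1 i
  have hsnd : ∀ᶠ t in Filter.atTop, ∀ i ∈ Finset.Icc a b, (cs.val (E.step^[t] x) i).2 = false := by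
    refine (Filter.eventually_all_finset _).2 fun i hi => ?_
    by_cases hc : cs.IsCell (E.step^[T] x) i
    · exact h.snd_of_no_gap hx (hg i) (i - a + 1).toNat i (by omega) le_rfl hc
    · filter_upwards [Filter.eventually_ge_atTop T] with t ht
      rw [val_of_not (mt (isCell_iterate_of_no_gap hx (hg i) le_rfl ht).1 hc)]
  obtain ⟨T₂, hT₂⟩ := Filter.eventually_atTop.1 hsnd
  refine ⟨max T T₂, fun t ht => ⟨h.iterate t, (hT t (by omega)).1, fun i hi => ?_, fun i hi => ?_⟩⟩
  · by_cases hc : cs.IsCell (E.step^[T] x) i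
    · exact h.fst_of_no_gap hx (hg i) (fun t ht => hT₁ t (hT t ht).2) (i - a + 1).toNat i hi
        (by omega) le_rfl hc t (by omega)
    · rw [val_of_not (mt (isCell_iterate_of_no_gap hx (hg i) le_rfl (by omega)).1 hc)]
  · rcases le_or_gt a i with h1 | h1
    · exact hT₂ t (by omega) i (Finset.mem_Icc.2 ⟨h1, hi⟩)
    · exact (h.iterate t).snd i h1.le

end Quiet

end Erosion

end CellSystem

/-! ### Bits traveling through quiet configurations -/

namespace CellSystem

namespace Erosion

variable {A : Type*} [TopologicalSpace A] {X : Subshift A ℤ} {cs : CellSystem X} {E : Erosion cs}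

lemma Tails.sub_p_right {x : ℤ → A} {a b i : ℤ} (h : Tails cs x a b) (hi : cs.IsCell x i)
    (hib : b < i) : cs.IsCell x (i - cs.p) := by
  obtain ⟨k, rfl⟩ := h.exists_right hi hib.le
  cases k with
  | zero => simp at hib
  | succ k =>
    have := h.right k
    convert this using 1
    push_cast
    ring

lemma Tails.outside {x : ℤ → A} {a b i : ℤ} (h : Tails cs x a b) (hi : cs.IsCell x i)
    (hib : i < a ∨ b < i) : cs.IsCell x (i - cs.p) ∧ cs.IsCell x (i + cs.p) := by
  rcases hib with h' | h'
  · exact ⟨h.sub_p_left hi h'.le, (h.add_p_left hi h').1⟩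
  · exact ⟨h.sub_p_right hi h', h.add_p_right hi h'.le⟩

variable {x : ℤ → A} {a b : ℤ}

lemma Quiet.exists_adj_right (h : E.Quiet x a b) {i : ℤ} (hi : cs.IsCell x i) :
    ∃ j, E.Adj x i j := by
  have := h.no_gap i
  rw [GapEnd, not_and_not_right] at this
  exact this hi

lemma Quiet.exists_adj_left (h : E.Quiet x a b) {j : ℤ} (hj : cs.IsCell x j) :
    ∃ i, E.Adj x i j := by
  rcases le_or_gt j a with h1 | h1
  · have h2 := adj_of_add_p (E := E) (h.sub_p_left hj h1) (by simpa using hj)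
    rw [sub_add_cancel] at h2
    exact ⟨_, h2⟩
  · obtain ⟨i, -, hi⟩ := Erosion.exists_adj_left h.isCell_left hj h1 fun i _ _ => h.no_gap i
    exact ⟨i, hi⟩

lemma Quiet.val_ne (hab : a ≤ b) (h : E.Quiet x a b) (j : ℤ) : cs.val x j ≠ (true, true) := by
  intro hv
  rcases le_or_gt a j with h1 | h1
  · have := h.fst' j h1
    rw [hv] at this
    simp at this
  · have := h.snd' j (by omega)
    rw [hv] at this
    simp at this

/-- A change of a single cell outside the interval does not create a site. -/
lemma Quiet.not_site (hab : a ≤ b) (h : E.Quiet x a b) {w : ℤ → A} {k : ℤ}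
    (hc : ∀ i, cs.IsCell w i ↔ cs.IsCell x i) (hv : ∀ i, i ≠ k → cs.val w i = cs.val x i)
    (hk : cs.val w k = (true, true) → k < a ∨ b < k) (i : ℤ) : ¬ E.Site w i := by
  intro hi
  have key : ∀ j, i < j → j < i + E.H → cs.IsCell x j → j = k := by
    intro j h1 h2 hj
    by_contra hjk
    have := hi.inner h1 h2 ((hc j).2 hj)
    rw [hv j hjk] at this
    exact h.val_ne hab j this
  obtain ⟨j, hj⟩ := h.exists_adj_right ((hc i).1 ⟨_, hi.at⟩)
  obtain ⟨h1, h2, h3, h4, h5⟩ := hj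
  have hjk := key j h3 h4 h2
  subst hjk
  have hvj := hi.inner h3 h4 ((hc j).2 h2)
  -- The full cell `j` lies in a tail, where cells are `p` apart. As `2 * p < H`, the cell `j + p`
  -- would also follow the site within `H`, hence be full.
  obtain ⟨h6, h7⟩ := h.outside h2 (hk hvj)
  have hp := cs.p_pos
  have hH := E.p_lt
  have h8 : j ≤ i + cs.p := by
    by_contra h9
    exact h5 _ (by omega) (by omega) h6
  have := key (j + cs.p) (by omega) (by omega) h7
  omega

lemma Quiet.step_eq (hx : x ∈ X.carrier) (h : E.Quiet x a b) (h' : E.Quiet (E.step x) a b) :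
    E.step x = E.move x := by
  refine swap_eq_self fun i hi => ?_
  rcases hi.gapEnd (move_mem hx) with h1 | h1
  · exact h.no_gap i (gapEnd_move.1 h1)
  · exact h'.no_gap i h1

open Classical in
/-- Set the first (for `l = true`) or second bit of the cell at `k`. -/
noncomputable def mark (cs : CellSystem X) (l : Bool) (x : ℤ → A) (k : ℤ) : ℤ → A :=
  cs.recolor x fun i =>
    if i = k then (l || (cs.val x i).1, !l || (cs.val x i).2) else cs.val x i

lemma isCell_mark {l : Bool} {k i : ℤ} : cs.IsCell (mark cs l x k) i ↔ cs.IsCell x i :=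
  isCell_recolor

lemma val_mark_of_ne {l : Bool} {k i : ℤ} (h : i ≠ k) :
    cs.val (mark cs l x k) i = cs.val x i := by
  by_cases hi : cs.IsCell x i
  · rw [mark, val_recolor _ hi, if_neg h]
  · rw [val_of_not hi, val_of_not (mt isCell_mark.1 hi)]

lemma val_mark {l : Bool} {k : ℤ} (hk : cs.IsCell x k) :
    cs.val (mark cs l x k) k = (l || (cs.val x k).1, !l || (cs.val x k).2) := by
  rw [mark, val_recolor _ hk, if_pos rfl]

lemma adj_mark {l : Bool} {k i j : ℤ} : E.Adj (mark cs l x k) i j ↔ E.Adj x i j := adj_recolor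

/-- Without gaps every cell has neighbours on both sides, so nothing is reflected and the added bit
just passes to the left neighbour. -/
lemma move_mark_true (h : E.Quiet x a b) {i k : ℤ} (hik : E.Adj x i k) :
    E.move (mark cs true x k) = mark cs true (E.move x) i := by
  rw [mark, mark, move, move, recolor_recolor, recolor_recolor, ← mark]
  refine recolor_congr fun n hn => ?_
  rw [val_recolor _ hn]
  obtain ⟨j, hj⟩ := h.exists_adj_right hn
  obtain ⟨m, hm⟩ := h.exists_adj_left hn
  have e1 : E.moveVal (mark cs true x k) n =
      ((cs.val (mark cs true x k) j).1, (cs.val (mark cs true x k) m).2) :=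
    Prod.ext (moveVal_fst (adj_mark.2 hj)) (moveVal_snd (adj_mark.2 hm))
  have e2 : E.moveVal x n = ((cs.val x j).1, (cs.val x m).2) :=
    Prod.ext (moveVal_fst hj) (moveVal_snd hm)
  rw [e1, e2]
  refine Prod.ext ?_ ?_
  · by_cases hni : n = i
    · subst hni
      rw [hj.right_unique hik, val_mark hik.2.1, if_pos rfl]
    · have hjk : j ≠ k := by
        rintro rfl
        exact hni (hj.left_unique hik)
      rw [if_neg hni, val_mark_of_ne hjk]
  · have e3 : (cs.val (mark cs true x k) m).2 = (cs.val x m).2 := by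
      by_cases hmk : m = k
      · subst hmk
        rw [val_mark hik.2.1]
        simp
      · rw [val_mark_of_ne hmk]
    rw [e3]
    split_ifs <;> simp

lemma move_mark_false (h : E.Quiet x a b) {k j : ℤ} (hkj : E.Adj x k j) :
    E.move (mark cs false x k) = mark cs false (E.move x) j := by
  rw [mark, mark, move, move, recolor_recolor, recolor_recolor, ← mark]
  refine recolor_congr fun n hn => ?_
  rw [val_recolor _ hn]
  obtain ⟨i, hi⟩ := h.exists_adj_right hn
  obtain ⟨m, hm⟩ := h.exists_adj_left hn
  have e1 : E.moveVal (mark cs false x k) n =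
      ((cs.val (mark cs false x k) i).1, (cs.val (mark cs false x k) m).2) :=
    Prod.ext (moveVal_fst (adj_mark.2 hi)) (moveVal_snd (adj_mark.2 hm))
  have e2 : E.moveVal x n = ((cs.val x i).1, (cs.val x m).2) :=
    Prod.ext (moveVal_fst hi) (moveVal_snd hm)
  rw [e1, e2]
  refine Prod.ext ?_ ?_
  · have e3 : (cs.val (mark cs false x k) i).1 = (cs.val x i).1 := by
      by_cases hik : i = k
      · subst hik
        rw [val_mark hkj.1]
        simp
      · rw [val_mark_of_ne hik]
    rw [e3]
    split_ifs <;> simp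
  · by_cases hnj : n = j
    · subst hnj
      rw [hm.left_unique hkj, val_mark hkj.1, if_pos rfl]
    · have hmk : m ≠ k := by
        rintro rfl
        exact hnj (hm.right_unique hkj)
      rw [if_neg hnj, val_mark_of_ne hmk]

lemma step_mark_true (hab : a ≤ b) (hx : x ∈ X.carrier) (h : E.Quiet x a b)
    (h' : E.Quiet (E.step x) a b) {k : ℤ} (hk : cs.IsCell x k) (hv : (cs.val x k).1 = false) :
    ∃ i, k < i + E.H ∧ i < k ∧ cs.IsCell (E.step x) i ∧ (cs.val (E.step x) i).1 = false ∧
      E.step (mark cs true x k) = mark cs true (E.step x) i := by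
  obtain ⟨i, hi⟩ := h.exists_adj_left hk
  have hs := h.step_eq hx h'
  have hci : cs.IsCell (E.step x) i := by
    rw [hs]
    exact isCell_recolor.2 hi.1
  refine ⟨i, hi.2.2.2.1, hi.2.2.1, hci, ?_, ?_⟩
  · rw [hs, val_move hi.1, moveVal_fst hi, hv]
  -- The added bit cannot trigger a swap: it makes its cell full only where a second bit is set,
  -- that is, to the right of `b`.
  · rw [hs, step, move_mark_true h hi, ← hs]
    refine swap_eq_self (h'.not_site hab (fun _ => isCell_mark) (fun n hn => val_mark_of_ne hn)
      fun hm => Or.inr ?_)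
    rw [val_mark hci, Prod.mk.injEq] at hm
    by_contra hib
    have := h'.snd' i (by omega)
    rw [this] at hm
    simp at hm

lemma step_mark_false (hab : a ≤ b) (hx : x ∈ X.carrier) (h : E.Quiet x a b)
    (h' : E.Quiet (E.step x) a b) {k : ℤ} (hk : cs.IsCell x k) (hv : (cs.val x k).2 = false) :
    ∃ j, k < j ∧ j < k + E.H ∧ cs.IsCell (E.step x) j ∧ (cs.val (E.step x) j).2 = false ∧
      E.step (mark cs false x k) = mark cs false (E.step x) j := by
  obtain ⟨j, hj⟩ := h.exists_adj_right hk
  have hs := h.step_eq hx h'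
  have hcj : cs.IsCell (E.step x) j := by
    rw [hs]
    exact isCell_recolor.2 hj.2.1
  refine ⟨j, hj.2.2.1, hj.2.2.2.1, hcj, ?_, ?_⟩
  · rw [hs, val_move hj.2.1, moveVal_snd hj, hv]
  · rw [hs, step, move_mark_false h hj, ← hs]
    refine swap_eq_self (h'.not_site hab (fun _ => isCell_mark) (fun n hn => val_mark_of_ne hn)
      fun hm => Or.inl ?_)
    rw [val_mark hcj, Prod.mk.injEq] at hm
    by_contra hib
    have := h'.fst' j (by omega)
    rw [this] at hm
    simp at hm

/-- The bit of `v` that `mark` with the parameter `l` sets. -/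
def bit (l : Bool) (v : Bool × Bool) : Bool := if l then v.1 else v.2

/-- The sign such that bits of the kind `l` move towards smaller values of `sign l * i`. -/
def sign (l : Bool) : ℤ := if l then 1 else -1

lemma step_mark {l : Bool} (hab : a ≤ b) (hx : x ∈ X.carrier) (h : E.Quiet x a b)
    (h' : E.Quiet (E.step x) a b) {k : ℤ} (hk : cs.IsCell x k)
    (hv : bit l (cs.val x k) = false) :
    ∃ i, sign l * i < sign l * k ∧ sign l * k < sign l * i + E.H ∧ cs.IsCell (E.step x) i ∧
      bit l (cs.val (E.step x) i) = false ∧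
      E.step (mark cs l x k) = mark cs l (E.step x) i := by
  cases l with
  | true =>
    obtain ⟨i, h1, h2, h3⟩ := step_mark_true hab hx h h' hk hv
    exact ⟨i, by simp only [sign, if_true]; omega, by simp only [sign, if_true]; omega, h3⟩
  | false =>
    obtain ⟨i, h1, h2, h3⟩ := step_mark_false hab hx h h' hk hv
    refine ⟨i, ?_, ?_, h3⟩ <;> simp only [sign, Bool.false_eq_true, if_false] <;> omega

lemma exists_ne_mark {l : Bool} {k : ℤ} (hk : cs.IsCell x k) (hv : bit l (cs.val x k) = false) :
    ∃ o : ℤ, 0 ≤ o ∧ o < cs.m ∧ x (k + o) ≠ mark cs l x k (k + o) := by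
  by_contra hcon
  have h1 : EqWin x (mark cs l x k) k (k + cs.m) := fun n hn1 hn2 => by
    by_contra hne
    exact hcon ⟨n - k, by omega, by omega, by rwa [add_sub_cancel]⟩
  have h2 := val_congr (cs := cs) h1 le_rfl le_rfl
  rw [val_mark hk] at h2
  rw [h2] at hv
  cases l <;> simp [bit] at hv

/-- A bit set in a quiet configuration travels forever. -/
lemma exists_traveler {l : Bool} (hab : a ≤ b) (hx : x ∈ X.carrier)
    (h : ∀ t, E.Quiet (E.step^[t] x) a b) {k : ℤ} (hk : cs.IsCell x k)
    (hv : bit l (cs.val x k) = false) :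
    ∃ π : ℕ → ℤ, π 0 = k ∧ ∀ s, sign l * π (s + 1) < sign l * π s ∧
      sign l * π s < sign l * π (s + 1) + E.H ∧
      ∃ o : ℤ, 0 ≤ o ∧ o < cs.m ∧
        E.step^[s] x (π s + o) ≠ E.step^[s] (mark cs l x k) (π s + o) := by
  -- Invariant: the perturbed orbit is the unperturbed one with a single additional bit, in the cell
  -- at `i`.
  let P : ℕ → ℤ → Prop := fun s i => cs.IsCell (E.step^[s] x) i ∧
    bit l (cs.val (E.step^[s] x) i) = false ∧
    E.step^[s] (mark cs l x k) = mark cs l (E.step^[s] x) i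
  have hstep : ∀ s i, P s i → ∃ j, P (s + 1) j ∧ sign l * j < sign l * i ∧
      sign l * i < sign l * j + E.H := by
    intro s i ⟨h1, h2, h3⟩
    have h4 := h (s + 1)
    rw [Function.iterate_succ_apply'] at h4
    obtain ⟨j, h5, h6, h7, h8, h9⟩ := step_mark hab (step_iterate_mem hx s) (h s) h4 h1 h2
    refine ⟨j, ?_, h5, h6⟩
    simp only [P, Function.iterate_succ_apply']
    exact ⟨h7, h8, by rw [h3, h9]⟩
  choose f hf1 hf2 using hstep
  let π : (s : ℕ) → {i : ℤ // P s i} := fun s => Nat.rec ⟨k, hk, hv, rfl⟩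
    (fun s i => ⟨f s i.1 i.2, hf1 s i.1 i.2⟩) s
  refine ⟨fun s => (π s).1, rfl, fun s => ⟨(hf2 s _ (π s).2).1, (hf2 s _ (π s).2).2, ?_⟩⟩
  obtain ⟨h1, h2, h3⟩ := (π s).2
  rw [h3]
  exact exists_ne_mark h1 h2

end Erosion

end CellSystem

/-! ### Density of the configurations with tails -/

namespace CellSystem

section TailsExist

variable {A : Type*} [TopologicalSpace A] {X : Subshift A ℤ} {cs : CellSystem X}

lemma val_of_belt {e : ℤ → A} {s : ℤ} (h : ∀ k : ℤ, At e (s + k * cs.p) (cs.c (false, false)))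
    (i : ℤ) : cs.val e i = (false, false) := by
  by_cases hi : cs.IsCell e i
  · have hp := cs.p_pos
    have h1 := Int.emod_add_mul_ediv (i - s) cs.p
    have h2 := Int.emod_nonneg (i - s) (b := cs.p) (by omega)
    have h3 := Int.emod_lt_of_pos (i - s) (b := cs.p) (by omega)
    rw [mul_comm] at h1
    have h4 := h ((i - s) / cs.p)
    have h5 : cs.IsCell e (s + (i - s) / cs.p * cs.p) := ⟨_, h4⟩
    rw [h5.unique hi (k := i) (by omega) (by omega) le_rfl (by omega)] at h4
    exact val_eq h4
  · exact val_of_not hi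

/-- Configurations with tails are dense. -/
lemma exists_tails (ht : IsTransitive X) {x : ℤ → A} (hx : x ∈ X.carrier) (N : ℕ) :
    ∃ y ∈ X.carrier, EqWin x y (-N) N ∧ ∃ a b, a ≤ b ∧ Erosion.Tails cs y a b := by
  classical
  obtain ⟨e, he, hbelt⟩ := cs.belt
  set c := cs.c (false, false) with hc
  have hcl : c.length = cs.m := cs.length_c _
  have hcL : c ∈ language X := mem_language_of_at he (hbelt 0)
  -- By transitivity the window occurs between two empty cells. Everything outside them is then
  -- replaced by belts, which is allowed because the empty cell is synchronizing.
  obtain ⟨g, hg⟩ := ht.exists_append hcL (fac_mem_language hx (-N) (2 * N))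
  obtain ⟨g', hg'⟩ := ht.exists_append hg hcL
  obtain ⟨x', hx', hat⟩ := exists_at_of_mem_language hg' (-N - g.length - cs.m)
  simp only [at_append, List.length_append, length_fac, hcl] at hat
  obtain ⟨⟨⟨⟨ha1, -⟩, hu⟩, -⟩, hb1⟩ := hat
  generalize hba : (-N - g.length - cs.m : ℤ) = a at *
  have hau : a + ((cs.m + g.length : ℕ) : ℤ) = -N := by push_cast; omega
  rw [hau] at hu
  generalize hbb : (a + ((cs.m + g.length + 2 * N + g'.length : ℕ) : ℤ) : ℤ) = b at *
  have hab : a + cs.m ≤ b := by push_cast at hbb; omega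
  have hNb : (N : ℤ) ≤ b := by push_cast at hbb; omega
  have hl : ∀ k : ℤ, At (shift (-a) e) (a + k * cs.p) c := fun k => by
    rw [at_shift]
    simpa [neg_add_cancel_left] using hbelt k
  have hr : ∀ k : ℤ, At (shift (-b) e) (b + k * cs.p) c := fun k => by
    rw [at_shift]
    simpa [neg_add_cancel_left] using hbelt k
  have hl0 : At (shift (-a) e) a c := by simpa using hl 0
  have hr0 : At (shift (-b) e) b c := by simpa using hr 0
  let z : ℤ → A := fun j => if j < a then shift (-a) e j else x' j
  have hz : z ∈ X.carrier := (cs.sync (false, false)).splice (X.mapsTo _ he) hx' hl0 ha1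
    (fun j hj => if_pos hj) (fun j hj => if_neg (by omega))
  have hzb : At z b c := hb1.congr fun k hk => if_neg (by omega)
  let y : ℤ → A := fun j => if j < b then z j else shift (-b) e j
  have hy : y ∈ X.carrier := (cs.sync (false, false)).splice hz (X.mapsTo _ he) hzb hr0
    (fun j hj => if_pos hj) (fun j hj => if_neg (by omega))
  have hyl : ∀ j < a + cs.m, y j = shift (-a) e j := by
    intro j hj
    have h1 : y j = z j := if_pos (by omega)
    rw [h1]
    by_cases hja : j < a
    · exact if_pos hja
    · have h2 : z j = x' j := if_neg hja
      have h3 := ha1 (j - a).toNat (by omega)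
      have h4 := hl0 (j - a).toNat (by omega)
      rw [h2]
      rw [← h4, Int.toNat_of_nonneg (by omega), add_sub_cancel] at h3
      exact h3
  have hyr : ∀ j ≥ b, y j = shift (-b) e j := fun j hj => if_neg (by omega)
  refine ⟨y, hy, fun k h1 h2 => ?_, a, b, by omega, fun k => ⟨(false, false), ?_⟩, fun k => ⟨(false, false), ?_⟩,
    fun i hi => ?_, fun i hi => ?_⟩
  · have h3 : y k = z k := if_pos (by omega)
    have h4 : z k = x' k := if_neg (by omega)
    have h5 := at_fac x (-N) (2 * N) (k + N).toNat (by simp; omega)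
    have h6 := hu (k + N).toNat (by simp; omega)
    rw [← h5, Int.toNat_of_nonneg (by omega), neg_add_cancel_comm_assoc] at h6
    rw [h3, h4, h6]
  · have := hl (-k)
    rw [neg_mul, ← sub_eq_add_neg] at this
    refine this.congr fun n hn => hyl _ ?_
    have : (0 : ℤ) ≤ k * cs.p := by positivity
    omega
  · refine (hr k).congr fun n hn => hyr _ ?_
    have : (0 : ℤ) ≤ k * cs.p := by positivity
    omega
  · have h1 : EqWin y (shift (-a) e) i (i + cs.m) := fun n _ hn => hyl n (by omega)
    rw [val_congr h1 le_rfl le_rfl, val_of_belt hl]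
  · have h1 : EqWin y (shift (-b) e) i (i + cs.m) := fun n hn _ => hyr n (by omega)
    rw [val_congr h1 le_rfl le_rfl, val_of_belt hr]

end TailsExist

/-! ### Pulling traveling bits back to the initial time -/

namespace Erosion

variable {A : Type*} [TopologicalSpace A] {X : Subshift A ℤ} {cs : CellSystem X} {E : Erosion cs}

lemma unmoveVal_local {x y : ℤ → A} {i : ℤ} (h : EqWin x y (i - E.H) (i + E.H + cs.m)) :
    E.unmoveVal x i = E.unmoveVal y i := by
  have hr : ∀ {x y : ℤ → A}, EqWin x y (i - E.H) (i + E.H + cs.m) → ∀ j, E.Adj x i j →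
      E.Adj y i j := fun h j hj => hj.congr h (by omega) (by have := hj.2.2.2.1; omega)
  have hl : ∀ {x y : ℤ → A}, EqWin x y (i - E.H) (i + E.H + cs.m) → ∀ j, E.Adj x j i →
      E.Adj y j i := fun h j hj => hj.congr h (by have := hj.2.2.2.1; omega) (by omega)
  refine Prod.ext ?_ ?_
  · by_cases hex : ∃ j, E.Adj x j i
    · obtain ⟨j, hj⟩ := hex
      have := hj.2.2
      rw [unmoveVal_fst hj, unmoveVal_fst (hl h j hj), val_congr h (by omega) (by omega)]
    · rw [unmoveVal_fst_of_not hex, unmoveVal_fst_of_not fun ⟨j, hj⟩ => hex ⟨j, hl h.symm j hj⟩,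
        val_congr h (by omega) (by omega)]
  · by_cases hex : ∃ j, E.Adj x i j
    · obtain ⟨j, hj⟩ := hex
      have := hj.2.2
      rw [unmoveVal_snd hj, unmoveVal_snd (hr h j hj), val_congr h (by omega) (by omega)]
    · rw [unmoveVal_snd_of_not hex, unmoveVal_snd_of_not fun ⟨j, hj⟩ => hex ⟨j, hr h.symm j hj⟩,
        val_congr h (by omega) (by omega)]

lemma unmove_local {x y : ℤ → A} {k : ℤ}
    (h : EqWin x y (k - E.H - cs.m) (k + E.H + cs.m)) : E.unmove x k = E.unmove y k := by
  have := cs.p_le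
  exact recolor_local (h.mono (by omega) (by omega)) fun i _ h1 h2 =>
    unmoveVal_local (h.mono (by omega) (by omega))

variable (E)

/-- The inverse of `step`. -/
noncomputable def unstep (x : ℤ → A) : ℤ → A := E.unmove (E.swap x)

variable {E}

lemma unstep_mem {x : ℤ → A} (hx : x ∈ X.carrier) : E.unstep x ∈ X.carrier :=
  recolor_mem (swap_mem hx) _

lemma unstep_step {x : ℤ → A} (hx : x ∈ X.carrier) : E.unstep (E.step x) = x := by
  rw [unstep, step, swap_swap (move_mem hx), unmove_move]

lemma step_unstep {x : ℤ → A} (hx : x ∈ X.carrier) : E.step (E.unstep x) = x := by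
  rw [unstep, step, move_unmove, swap_swap hx]

lemma unstep_local {x y : ℤ → A} (hx : x ∈ X.carrier) (hy : y ∈ X.carrier) {a b : ℤ}
    (h : EqWin x y (a - 2 * (E.H + cs.m)) (b + 2 * (E.H + cs.m))) :
    EqWin (E.unstep x) (E.unstep y) a b :=
  fun _ _ _ => unmove_local fun _ _ _ => swap_local hx hy (h.mono (by omega) (by omega))

/-- Configurations that agree on a large window have preimages that agree on a given window. -/
lemma exists_preimage_eqWin (T N : ℕ) : ∃ M : ℕ, ∀ x ∈ X.carrier, ∀ z ∈ X.carrier,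
    EqWin (E.step^[T] x) z (-M) M → ∃ w ∈ X.carrier, EqWin x w (-N) N ∧ E.step^[T] w = z := by
  induction T with
  | zero => exact ⟨N, fun x _ z hz h => ⟨z, hz, h, rfl⟩⟩
  | succ T ih =>
    obtain ⟨M, hM⟩ := ih
    refine ⟨M + 2 * (E.H + cs.m), fun x hx z hz h => ?_⟩
    have hxT := step_iterate_mem (E := E) hx T
    rw [Function.iterate_succ_apply'] at h
    obtain ⟨w, hw, h1, h2⟩ := hM x hx (E.unstep z) (unstep_mem hz) (by
      rw [← unstep_step hxT]
      exact unstep_local (step_mem hxT) hz (h.mono (by push_cast; omega) (by push_cast; omega)))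
    exact ⟨w, hw, h1, by rw [Function.iterate_succ_apply', h2, step_unstep hz]⟩

lemma mark_apply {x : ℤ → A} {l : Bool} {k n : ℤ} (h : n < k ∨ k + cs.p ≤ n) :
    mark cs l x k n = x n :=
  recolor_eq_self_at fun i _ h1 h2 => if_neg (by omega)

lemma Tails.exists_cell_sign {x : ℤ → A} {a b : ℤ} (h : Tails cs x a b) (l : Bool) (D : ℤ) :
    ∃ k, cs.IsCell x k ∧ bit l (cs.val x k) = false ∧ D ≤ sign l * k := by
  have hp := cs.p_pos
  have hD : D ≤ D.toNat * cs.p := by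
    rcases le_or_gt D 0 with h' | h'
    · exact h'.trans (by positivity)
    · rw [Int.toNat_of_nonneg h'.le]
      nlinarith
  cases l with
  | true =>
    have hb : -b ≤ (-b).toNat * cs.p := by
      rcases le_or_gt (-b) 0 with h' | h'
      · exact h'.trans (by positivity)
      · rw [Int.toNat_of_nonneg h'.le]
        nlinarith
    refine ⟨_, h.right (D.toNat + (-b).toNat), h.fst _ ?_, ?_⟩
    · have : (0 : ℤ) ≤ ((D.toNat + (-b).toNat : ℕ) : ℤ) * cs.p := by positivity
      omega
    · simp only [sign, if_true]
      push_cast [Nat.cast_add] at *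
      linarith
  | false =>
    have ha : a ≤ a.toNat * cs.p := by
      rcases le_or_gt a 0 with h' | h'
      · exact h'.trans (by positivity)
      · rw [Int.toNat_of_nonneg h'.le]
        nlinarith
    refine ⟨_, h.left (D.toNat + a.toNat), h.snd _ ?_, ?_⟩
    · have : (0 : ℤ) ≤ ((D.toNat + a.toNat : ℕ) : ℤ) * cs.p := by positivity
      omega
    · simp only [sign, Bool.false_eq_true, if_false]
      push_cast [Nat.cast_add] at *
      linarith

/-- Arbitrarily close to a configuration with tails there is another one from which it differs by a
traveling bit that starts arbitrarily far. -/
lemma Tails.exists_travelers {y : ℤ → A} (hy : y ∈ X.carrier) {a b : ℤ} (hab : a ≤ b)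
    (h : Tails cs y a b) (l : Bool) : ∃ T : ℕ, ∀ (N : ℕ) (D : ℤ), ∃ z ∈ X.carrier,
      EqWin y z (-N) N ∧ ∃ π : ℕ → ℤ, D ≤ sign l * π 0 ∧ ∀ s,
        sign l * π (s + 1) < sign l * π s ∧ sign l * π s < sign l * π (s + 1) + E.H ∧
        ∃ o : ℤ, 0 ≤ o ∧ o < cs.m ∧ E.step^[s + T] y (π s + o) ≠ E.step^[s + T] z (π s + o) := by
  obtain ⟨T, hT⟩ := h.eventually_quiet (E := E) hy hab
  refine ⟨T, fun N D => ?_⟩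
  -- The bit is added at time `T`, when the orbit is quiet, and so far out that going back `T` steps
  -- does not affect the window of radius `N`.
  obtain ⟨M, hM⟩ := exists_preimage_eqWin (E := E) T N
  have hyT := step_iterate_mem (E := E) hy T
  -- The summand `cs.p` keeps all the letters that the mark may change out of the window when the
  -- bit comes from the left.
  obtain ⟨k, hk, hv, hD⟩ := (h.iterate (E := E) T).exists_cell_sign l (max D (M + cs.p))
  have hDM : (M + cs.p : ℤ) ≤ sign l * k := (le_max_right _ _).trans hD
  obtain ⟨z, hz, h1, h2⟩ := hM y hy (mark cs l (E.step^[T] y) k) (recolor_mem hyT _)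
    fun n hn1 hn2 => (mark_apply (by cases l <;> simp [sign] at hDM <;> omega)).symm
  obtain ⟨π, h3, h4⟩ := exists_traveler (E := E) (l := l) hab hyT
    (fun t => by rw [← Function.iterate_add_apply]; exact hT _ (by omega)) hk hv
  refine ⟨z, hz, h1, π, by rw [h3]; exact (le_max_left _ _).trans hD, fun s => ?_⟩
  obtain ⟨h5, h6, o, h7, h8, h9⟩ := h4 s
  refine ⟨h5, h6, o, h7, h8, ?_⟩
  rwa [Function.iterate_add_apply, Function.iterate_add_apply, h2]

end Erosion

end CellSystem

/-! ### Sensitivity in every direction -/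

/-- A sequence of integers that decreases by bounded steps from a nonnegative value passes through
a window of the same length. -/
lemma exists_mem_window {u : ℕ → ℤ} {C : ℤ} (h0 : 0 ≤ u 0) (h1 : ∀ n, u (n + 1) < u n)
    (h2 : ∀ n, u n ≤ u (n + 1) + C) : ∃ n, 0 ≤ u n ∧ u n ≤ C := by
  classical
  have hC : 0 ≤ C := by
    have := h1 0
    have := h2 0
    omega
  have hle : ∀ n : ℕ, u n ≤ u 0 - n := by
    intro n
    induction n with
    | zero => simp
    | succ n ih =>
      have := h1 n
      push_cast
      omega
  have hex : ∃ n, u n ≤ C := ⟨(u 0).toNat, by have := hle (u 0).toNat; omega⟩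
  refine ⟨Nat.find hex, ?_, Nat.find_spec hex⟩
  rcases Nat.eq_zero_or_pos (Nat.find hex) with h | h
  · rw [h]
    exact h0
  · have h3 := Nat.find_min hex (m := Nat.find hex - 1) (by omega)
    have h4 := h2 (Nat.find hex - 1)
    rw [Nat.sub_add_cancel h] at h4
    omega

section Uniform

variable {A : Type*} [UniformSpace A] {X : Subshift A ℤ}

/-- Agreement on a finite window is an entourage. -/
lemma window_mem_uniformity [DiscreteUniformity A] (X : Subshift A ℤ) (W : ℤ) :
    {r : X.carrier × X.carrier | ∀ k ∈ Finset.Icc (-W) W,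
      (r.1 : ℤ → A) k = (r.2 : ℤ → A) k} ∈ uniformity X.carrier := by
  have h : ∀ k : ℤ, {r : X.carrier × X.carrier | (r.1 : ℤ → A) k = (r.2 : ℤ → A) k} ∈
      uniformity X.carrier := by
    intro k
    have hu : UniformContinuous fun x : X.carrier => (x : ℤ → A) k :=
      (Pi.uniformContinuous_proj _ k).comp uniformContinuous_subtype_val
    exact hu (DiscreteUniformity.relId_mem_uniformity A)
  exact (Filter.eventually_all_finset (Finset.Icc (-W) W)).2 fun k _ => h k

/-- Every neighbourhood contains a cylinder. -/
lemma exists_cylinder {x : X.carrier} {U : Set X.carrier} (hU : U ∈ nhds x) :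
    ∃ N : ℕ, ∀ y : X.carrier, EqWin (x : ℤ → A) y (-N) N → y ∈ U := by
  obtain ⟨t, ht, htU⟩ := mem_nhds_subtype _ _ _ |>.1 hU
  obtain ⟨s, hst, hs, hxs⟩ := mem_nhds_iff.1 ht
  obtain ⟨I, u, hu, hI⟩ := isOpen_pi_iff.1 hs _ hxs
  refine ⟨I.sup Int.natAbs + 1, fun y hy => htU (hst (hI fun k hk => ?_))⟩
  have h1 : k.natAbs ≤ I.sup Int.natAbs := Finset.le_sup (f := Int.natAbs) hk
  rw [← hy k (by push_cast; omega) (by push_cast; omega)]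
  exact (hu k hk).2

/-- A sensitive system on a compact space is not almost equicontinuous. -/
lemma IsSensitive.not_isAlmostEquicontinuous {Y : Type*} [UniformSpace Y] [BaireSpace Y]
    [Nonempty Y] {T : Y → Y} (h : IsSensitive T) : ¬ IsAlmostEquicontinuous T := by
  intro hae
  obtain ⟨V, hV, h⟩ := h
  obtain ⟨x, hx⟩ := (dense_of_mem_residual hae).nonempty
  obtain ⟨y, hy, n, hn⟩ := h x _ (hx V hV)
  exact hn (hy n)

namespace CellSystem.Erosion

variable {cs : CellSystem X} {E : Erosion cs}

lemma step_iterate_shift (x : ℤ → A) (s : ℤ) (n : ℕ) :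
    E.step^[n] (shift s x) = shift s (E.step^[n] x) := by
  induction n with
  | zero => rfl
  | succ n ih => rw [Function.iterate_succ_apply', Function.iterate_succ_apply', ih, step_shift]

lemma automaton_iterate (n : ℕ) (x : X.carrier) :
    (E.automaton^[n] x : ℤ → A) = E.step^[n] x := by
  induction n with
  | zero => rfl
  | succ n ih =>
    rw [Function.iterate_succ_apply', Function.iterate_succ_apply', ← ih]
    rfl

lemma directionMap_iterate (p : ℤ) (q n : ℕ) (x : X.carrier) (k : ℤ) :
    ((directionMap E.automaton p q)^[n] x : ℤ → A) k = E.step^[q * n] x (p * n + k) := by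
  suffices h : ((directionMap E.automaton p q)^[n] x : ℤ → A) =
      shift (p * n) (E.step^[q * n] (x : ℤ → A)) by
    rw [h, shift_apply]
  induction n with
  | zero =>
    ext k
    simp [shift_apply]
  | succ n ih =>
    rw [Function.iterate_succ_apply']
    show shift p ((E.automaton^[q] _ : X.carrier) : ℤ → A) = _
    rw [automaton_iterate, ih, step_iterate_shift, ← Function.iterate_add_apply]
    ext k
    simp only [shift_apply]
    have e1 : q + q * n = q * (n + 1) := by ring
    have e2 : p * (n : ℤ) + (p + k) = p * (n + 1 : ℕ) + k := by
      push_cast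
      ring
    rw [e1, e2]

/-- Every direction is sensitive. -/
theorem isSensitive_directionMap [DiscreteUniformity A] (ht : IsTransitive X) (p : ℤ) {q : ℕ} (hq : 0 < q) :
    IsSensitive (directionMap E.automaton p q) := by
  -- Choose the kind of bit that moves against the frame of slope `p/q`, so that the two velocities
  -- add up and the relative position strictly decreases.
  obtain ⟨l, hl⟩ : ∃ l, 0 ≤ sign l * p := by
    rcases le_total 0 p with h | h
    · exact ⟨true, by simpa [sign] using h⟩
    · exact ⟨false, by simpa [sign] using h⟩
  -- This bounds the relative displacement during one iteration of `directionMap`: `q` moves of the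
  -- bit and one shift by `p`.
  set C : ℤ := q * E.H + sign l * p with hC
  refine ⟨_, window_mem_uniformity X (C + cs.m), fun x U hU => ?_⟩
  obtain ⟨N, hN⟩ := exists_cylinder hU
  obtain ⟨y, hy, hxy, a, b, hab, htails⟩ := exists_tails (cs := cs) ht x.2 N
  obtain ⟨T, hT⟩ := htails.exists_travelers (E := E) hy hab l
  -- The bit starts far enough out not to have passed the origin of the moving frame at the iterate
  -- `T`.
  obtain ⟨z, hz, hyz, π, hπ0, hπ⟩ := hT N ((q * T : ℕ) * E.H + sign l * p * T)
  have hπd : ∀ s r : ℕ, sign l * π (s + r) ≤ sign l * π s - r ∧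
      sign l * π s ≤ sign l * π (s + r) + r * E.H := by
    intro s r
    induction r with
    | zero => simp
    | succ r ih =>
      obtain ⟨h1, h2, -⟩ := hπ (s + r)
      rw [← add_assoc]
      push_cast
      rw [add_mul]
      omega
  have hqT : T ≤ q * T := Nat.le_mul_of_pos_left T hq
  have hsub : ∀ n, q * (T + n) - T + T = q * (T + n) := fun n =>
    Nat.sub_add_cancel (hqT.trans (Nat.mul_le_mul_left q (Nat.le_add_right T n)))
  -- The relative position of the bit at the iterate `T + n`, which is time `q * (T + n)` of the
  -- automaton. The clock of `π` starts at time `T` of the automaton.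
  set u : ℕ → ℤ := fun n => sign l * π (q * (T + n) - T) - sign l * p * (T + n : ℕ) with hu
  obtain ⟨n, hn1, hn2⟩ : ∃ n, 0 ≤ u n ∧ u n ≤ C := by
    have hs : ∀ n, q * (T + (n + 1)) - T = q * (T + n) - T + q := fun n => by
      have := hsub n
      rw [← add_assoc, mul_add_one]
      omega
    refine exists_mem_window ?_ (fun n => ?_) (fun n => ?_)
    · obtain ⟨-, h2⟩ := hπd 0 (q * T - T)
      rw [zero_add] at h2
      have h3 : ((q * T - T : ℕ) : ℤ) * E.H ≤ (q * T : ℕ) * E.H := by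
        gcongr
        exact Nat.sub_le _ _
      simp only [hu, add_zero]
      linarith
    · obtain ⟨h1, -⟩ := hπd (q * (T + n) - T) q
      simp only [hu, hs]
      push_cast
      nlinarith
    · obtain ⟨-, h2⟩ := hπd (q * (T + n) - T) q
      simp only [hu, hs, hC]
      push_cast
      nlinarith
  obtain ⟨-, -, o, ho1, ho2, hne⟩ := hπ (q * (T + n) - T)
  rw [hsub] at hne
  have hyU : (⟨y, hy⟩ : X.carrier) ∈ U := hN _ hxy
  have hzU : (⟨z, hz⟩ : X.carrier) ∈ U :=
    hN ⟨z, hz⟩ fun k h1 h2 => (hxy k h1 h2).trans (hyz k h1 h2)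
  -- Both `y` and `z` are in `U`, and their orbits differ in the window at some time, so they cannot
  -- both agree there with the orbit of `x`.
  by_contra hcon
  simp only [not_exists, not_and, not_not] at hcon
  set k : ℤ := π (q * (T + n) - T) - p * (T + n : ℕ) + o with hk
  have hkm : k ∈ Finset.Icc (-(C + cs.m)) (C + cs.m) := by
    rw [Finset.mem_Icc]
    have e : u n = sign l * (k - o) := by
      simp only [hu, hk]
      ring
    rw [e] at hn1 hn2
    cases l <;> simp only [sign, if_true, Bool.false_eq_true, if_false] at hn1 hn2 <;> omega
  have h1 := (hcon _ hyU (T + n) k hkm).symm.trans (hcon _ hzU (T + n) k hkm)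
  simp only [directionMap_iterate] at h1
  have e : p * (T + n : ℕ) + k = π (q * (T + n) - T) + o := by
    simp only [hk]
    ring
  rw [e] at h1
  exact hne h1

end CellSystem.Erosion

end Uniform

end SoficCA

theorem mainTheorem3 {A : Type*} [Finite A] [UniformSpace A] [DiscreteUniformity A]
    (X : SymbolicDynamics.FullShift.Subshift A ℤ) (hinf : X.carrier.Infinite)
    (htrans : SoficCA.IsTransitive X) (hsofic : SoficCA.IsSofic X) :
    ∃ F : X.carrier → X.carrier, SoficCA.IsReversibleCA F ∧
      (∀ (p : ℤ) (q : ℕ), ¬ SoficCA.IsAlmostEquicontinuousDirection F p q) ∧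
      (∀ (p : ℤ) (q : ℕ), 0 < q → IsCoprime p (q : ℤ) →
        SoficCA.IsSensitiveDirection F p q) := by
  obtain ⟨cs⟩ := SoficCA.exists_cellSystem hinf htrans hsofic
  obtain ⟨E⟩ := SoficCA.CellSystem.exists_erosion cs hinf.nonempty htrans hsofic
  -- Compactness supplies the Baire property that turns sensitivity into failure of almost
  -- equicontinuity.
  have : CompactSpace X.carrier := isCompact_iff_compactSpace.1 X.isClosed.isCompact
  have : Nonempty X.carrier := hinf.nonempty.to_subtype
  exact ⟨E.automaton, E.isReversibleCA_automaton,
    fun p q ⟨hq, _, h⟩ => (E.isSensitive_directionMap htrans p hq).not_isAlmostEquicontinuous h,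
    fun p q hq hpq => ⟨hq, hpq, E.isSensitive_directionMap htrans p hq⟩⟩
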